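/- **Setting.** Let $M$ be a smooth manifold and $(V,\partial)$ a finite-dimensional real cochain complex: $V=\bigoplus_p V^p$, $\partial$ of degree $1$, $\partial^2=0$. Let $\mathrm{End}^e(V)$ be the space of endomorphisms of degree $e$, with $[\partial,f]=\partial f-(-1)^e f\partial$ for $f\in \mathrm{End}^e(V)$. Forms with values in $\mathrm{End}(V)$ are multiplied in the graded algebra $\Omega\otimes\mathrm{End}(V)$, i.e. $(\omega\otimes f)(\eta\otimes g)=(-1)^{|f||\eta|}(\omega\wedge\eta)\otimes fg$. A flat superconnection on $M$ with values in $(V,\partial)$ is a sequence of smooth forms $\alpha=\alpha^1+\alpha^2+\cdots$ with $\alpha^i\in\Omega^i(M,\mathrm{End}^{1-i}(V))$ such that for all $n\ge 1$ $$[\partial,\alpha^n]+d\alpha^{n-1}+\sum_{i+j=n}\alpha^i\alpha^j=0$$ (with $\alpha^0=0$, and $[\partial,\omega\otimes f]=(-1)^{|\omega|}\omega\otimes[\partial,f]$), i.e. $(d+\partial+\alpha)^2=0$. Let $I=[0,1]$, with coordinates $(t,s)$ on $I^2$, and $\Delta_k=\{1\ge t_1\ge\cdots\ge t_k\ge 0\}$.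 A 2-path in $M$ is a map $\Gamma:I^2\to M$ that is constant on each of the two vertical sides and piecewise smooth, i.e. continuous and smooth on each of finitely many closed convex sets whose union is $I^2$. It is well-supported if there is a box $Q=[x_0,x_1]\times[y_0,y_1]$ with $\tfrac12<x_0<x_1<1$, $0<y_0<y_1<\tfrac12$ such that, at the points where $\Gamma$ is differentiable, the rank of $\Gamma$ is at most $1$ in the interior of $I^2$ outside $Q$, and is $0$ in the interiors of the trapezoids with vertices $(0,0),(0,1),(x_0,y_1),(x_0,y_0)$ and $(1,0),(1,1),(x_1,y_1),(x_1,y_0)$. For $G:I^2\to M$ let $G_{(k)}:\Delta_k\times I\to M^k$, $G_{(k)}(t_1,\dots,t_k,s)=(G(t_1,s),\dots,G(t_k,s))$, let $p_i:M^k\to M$ be the projections and, for $m,n\ge 0$, $$\Omega_{m,n}=p_1^*\alpha^1\wedge\cdots\wedge p_m^*\alpha^1\wedge p_{m+1}^*\alpha^2\wedge p_{m+2}^*\alpha^1\wedge\cdots\wedge p_{m+n+1}^*\alpha^1 .$$ Orient $\Delta_k\times I$ by $dt_1\wedge\cdots\wedge dt_k\wedge ds$. Let $\mu(t,s)=(1-t,s)$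 and $\Theta=q\circ\lambda$, where $q(t,s)=(\max\{t,s\},s)$, and $\lambda(t,s)=(s,1-2t)$ for $t\le \tfrac12$, $\lambda(t,s)=((2-2t)s,0)$ for $t\ge\tfrac12$; $\Theta$ maps $I^2$ to $\Delta_2$. Let $b:\Delta_2\to I^2$ be the inclusion $b(t,s)=(t,s)$. **Proposition.** Let $\Gamma$ be a well-supported 2-path in $M$ and $\alpha$ a flat superconnection on $M$ with values in $(V,\partial)$. Then the integrals below exist, the series $$Z(\Gamma)=\sum_{m,n\ge 0}(-1)^{m+n}\int_{\Delta_{m+n+1}\times I}(\Gamma\circ\mu)_{(m+n+1)}^*\Omega_{m,n},$$ $$X(\Gamma)=\sum_{m,n\ge 0}(-1)^{m+n+1}\int_{\Delta_{m+n+1}\times I}(\Gamma\circ b\circ\Theta)_{(m+n+1)}^*\Omega_{m,n}$$ converge absolutely, their sums lie in $\mathrm{End}^{-1}(V)$, and $$Z(\Gamma)-X(\Gamma)\in[\partial,\mathrm{End}^{-2}(V)]=\{\partial h-h\partial : h\in \mathrm{End}^{-2}(V)\},$$ i.e. $Z(\Gamma)$ and $X(\Gamma)$ represent the same element of $\mathrm{End}^{-1}(V)/[\partial,\mathrm{End}^{-2}(V)]$.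 -/

import Mathlib

open MeasureTheory
open scoped Manifold ContDiff

noncomputable section

namespace SurfaceHolonomy

/-! ### Cochain complexes and their graded endomorphisms -/

/-- A finite dimensional real cochain complex structure on `V`: a `ℤ`-grading
`V = ⨁ V^p` and a differential `∂` of degree `1`. As `V` is finite dimensional, only
finitely many `V^p` are nonzero. (The norm on `V` only provides its topology.) -/
structure GradedComplex (V : Type*) [NormedAddCommGroup V] [NormedSpace ℝ V]
    [FiniteDimensional ℝ V] where
  /-- the homogeneous component `V^p` -/
  comp : ℤ → Submodule ℝ V
  isInternal : DirectSum.IsInternal comp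
  /-- the differential `∂` -/
  diff : V →L[ℝ] V
  diff_mem : ∀ (p : ℤ), ∀ v ∈ comp p, diff v ∈ comp (p + 1)
  diff_sq : ∀ v, diff (diff v) = 0

section Complex

variable {V : Type*} [NormedAddCommGroup V] [NormedSpace ℝ V] [FiniteDimensional ℝ V]

/-- `End^e(V)`, the endomorphisms of degree `e`. -/
def GradedComplex.endDeg (C : GradedComplex V) (e : ℤ) : Submodule ℝ (V →L[ℝ] V) where
  carrier := {f | ∀ (p : ℤ), ∀ v ∈ C.comp p, f v ∈ C.comp (p + e)}
  add_mem' hf hg p v hv := (C.comp (p + e)).add_mem (hf p v hv) (hg p v hv)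
  zero_mem' p _ _ := (C.comp (p + e)).zero_mem
  smul_mem' c _ hf p v hv := (C.comp (p + e)).smul_mem c (hf p v hv)

/-- The graded commutator `[∂, f] = ∂ f - (-1)^e f ∂` of `∂` with `f ∈ End^e(V)`. -/
def GradedComplex.bracket (C : GradedComplex V) (e : ℤ) :
    (V →L[ℝ] V) →ₗ[ℝ] (V →L[ℝ] V) where
  toFun f := C.diff * f - ((-1 : ℝ) ^ e) • (f * C.diff)
  map_add' f g := by simp only [mul_add, add_mul, smul_add]; abel
  map_smul' c f := by
    simp only [mul_smul_comm, smul_mul_assoc, smul_sub, RingHom.id_apply, smul_comm c]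

/-- The subspace `[∂, End^e(V)]`. -/
def GradedComplex.boundaries (C : GradedComplex V) (e : ℤ) : Submodule ℝ (V →L[ℝ] V) :=
  (C.endDeg e).map (C.bracket e)

end Complex

/-! ### Wedge products of endomorphism valued forms -/

/-- The product `θ₁ ∧ ⋯ ∧ θ_r`, at one point with tangent space `W`, of forms `θ_i` of form
degree `d i` with values in a graded algebra `A`, where `θ_i` takes values in degree `1 - d i`
(so that every factor has total degree one). It is the usual wedge product
`1 / ∏ (d i)! * ∑_σ sgn σ * ∏_i θ_i (v_{σ(block i)})`, with the Koszul sign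
`(θ ⊗ f)(η ⊗ g) = (-1)^{|f||η|} (θ ∧ η) ⊗ f g` of the graded algebra `Ω ⊗ A`. -/
def superWedge {W A : Type*} [Ring A] [Algebra ℝ A] {r N : ℕ} (d : Fin r → ℕ)
    (h : ∑ i, d i = N) (θ : ∀ i, (Fin (d i) → W) → A) (v : Fin N → W) : A :=
  ((∏ i, ∏ j ∈ Finset.Ioi i, (-1 : ℝ) ^ ((1 - (d i : ℤ)) * (d j : ℤ))) *
      (∏ i, ((d i).factorial : ℝ))⁻¹) •
    ∑ σ : Equiv.Perm (Fin N), ((Equiv.Perm.sign σ : ℤ) : ℝ) •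
      (List.ofFn fun i => θ i fun a => v (σ (Fin.cast h (finSigmaFinEquiv ⟨i, a⟩)))).prod

/-! ### Differential forms and flat superconnections on a manifold -/

section Forms

variable {E : Type*} [NormedAddCommGroup E] [NormedSpace ℝ E]
  {M : Type*} [TopologicalSpace M] [ChartedSpace E M]
  {F : Type*} [NormedAddCommGroup F] [NormedSpace ℝ F]

/-- The expression of a `k`-form on `M` in the preferred chart at `x₀`, i.e. its pullback along
the inverse of the chart. -/
def formInChart {k : ℕ} (θ : ∀ x : M, TangentSpace 𝓘(ℝ, E) x [⋀^Fin k]→L[ℝ] F) (x₀ : M) :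
    E → E [⋀^Fin k]→L[ℝ] F := fun y =>
  (θ ((extChartAt 𝓘(ℝ, E) x₀).symm y)).compContinuousLinearMap
    (mfderiv 𝓘(ℝ, E) 𝓘(ℝ, E) (extChartAt 𝓘(ℝ, E) x₀).symm y)

/-- A form is smooth if its expressions in the charts are. -/
def IsSmoothForm {k : ℕ} (θ : ∀ x : M, TangentSpace 𝓘(ℝ, E) x [⋀^Fin k]→L[ℝ] F) : Prop :=
  ∀ x₀ : M, ContDiffOn ℝ ∞ (formInChart θ x₀) (extChartAt 𝓘(ℝ, E) x₀).target

/-- The exterior derivative of a form on `M` at `x`, computed in the preferred chart at `x`. -/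
def formDeriv {k : ℕ} (θ : ∀ x : M, TangentSpace 𝓘(ℝ, E) x [⋀^Fin k]→L[ℝ] F) (x : M) :
    TangentSpace 𝓘(ℝ, E) x [⋀^Fin (k + 1)]→L[ℝ] F :=
  (extDeriv (formInChart θ x) (extChartAt 𝓘(ℝ, E) x x)).compContinuousLinearMap
    (mfderiv 𝓘(ℝ, E) 𝓘(ℝ, E) (extChartAt 𝓘(ℝ, E) x) x)

end Forms

/-- A flat superconnection `α = α¹ + α² + ⋯` on `M` with values in `(V, ∂)`:
`α^k ∈ Ω^k(M, End^{1-k}(V))` for `k ≥ 1` (we put `α⁰ = 0`), and for all `n = k + 1 ≥ 1`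
`[∂, α^n] + dα^{n-1} + ∑_{i+j=n} α^i ∘ α^j = 0` in the graded algebra `Ω(M) ⊗ End(V)`, that is,
`(d + ∂ + α)² = 0`. In this algebra `[∂, θ ⊗ f] = (-1)^{|θ|} θ ⊗ [∂, f]`. -/
structure FlatSuperconnection (E : Type*) [NormedAddCommGroup E] [NormedSpace ℝ E]
    (M : Type*) [TopologicalSpace M] [ChartedSpace E M]
    {V : Type*} [NormedAddCommGroup V] [NormedSpace ℝ V] [FiniteDimensional ℝ V]
    (C : GradedComplex V) where
  /-- the component `α^k` -/
  form : ∀ (k : ℕ) (x : M), TangentSpace 𝓘(ℝ, E) x [⋀^Fin k]→L[ℝ] (V →L[ℝ] V)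
  form_zero : form 0 = 0
  smooth : ∀ k, IsSmoothForm (form k)
  degree : ∀ (k : ℕ) (x : M) (v : Fin k → TangentSpace 𝓘(ℝ, E) x),
    form k x v ∈ C.endDeg (1 - k)
  flat : ∀ (k : ℕ) (x : M) (v : Fin (k + 1) → TangentSpace 𝓘(ℝ, E) x),
    (-1 : ℝ) ^ (k + 1) • C.bracket (1 - ((k + 1 : ℕ) : ℤ)) (form (k + 1) x v)
      + formDeriv (form k) x v
      + ∑ i : Fin (k + 2), superWedge (N := k + 1) ![(i : ℕ), k + 1 - i]
          (by simp [Fin.sum_univ_two]; omega)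
          (fun a u => form (![(i : ℕ), k + 1 - i] a) x u) v = 0

/-! ### Piecewise smooth 2-paths -/

/-- The unit square `I²`, with coordinates `(t, s)`. -/
def square : Set (ℝ × ℝ) := Set.Icc 0 1 ×ˢ Set.Icc 0 1

section Paths

variable (E : Type*) [NormedAddCommGroup E] [NormedSpace ℝ E]
  {M : Type*} [TopologicalSpace M] [ChartedSpace E M]

/-- `Γ : I² → M` is piecewise smooth: it is continuous, and the square is a finite union of closed
convex pieces (for instance the triangles of a triangulation) on each of which `Γ` is smooth.
Only the values of `Γ` on the square matter. -/
def IsPiecewiseSmooth (Γ : ℝ × ℝ → M) : Prop :=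
  ContinuousOn Γ square ∧
  ∃ (r : ℕ) (K : Fin r → Set (ℝ × ℝ)), (∀ i, IsClosed (K i)) ∧ (∀ i, Convex ℝ (K i)) ∧
    (⋃ i, K i) = square ∧ ∀ i, ContMDiffOn 𝓘(ℝ, ℝ × ℝ) 𝓘(ℝ, E) ∞ Γ (K i)

/-- A 2-path is a piecewise smooth map `Γ : I² → M` that is constant on the vertical sides. -/
structure IsTwoPath (Γ : ℝ × ℝ → M) : Prop where
  piecewiseSmooth : IsPiecewiseSmooth E Γ
  left_const : ∀ s ∈ Set.Icc (0 : ℝ) 1, Γ (0, s) = Γ (0, 0)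
  right_const : ∀ s ∈ Set.Icc (0 : ℝ) 1, Γ (1, s) = Γ (1, 0)

/-- The rank of `Γ` at a point. At a point where `Γ` is not differentiable (such points
of a piecewise smooth map form a null set) it is zero by convention, so that the conditions on
the rank below impose nothing there. -/
def rankAt (Γ : ℝ × ℝ → M) (p : ℝ × ℝ) : ℕ :=
  Module.finrank ℝ (LinearMap.range (mfderiv 𝓘(ℝ, ℝ × ℝ) 𝓘(ℝ, E) Γ p).toLinearMap)

/-- A 2-path is well-supported if there is a small box `[x₀, x₁] × [y₀, y₁]` in the interior of
the lower right quarter of the square such that the rank of `Γ` is at most `1` outside of the box,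
and is `0` inside the two trapezoids that join the left (right) side of the box to the
left (right) side of the square. -/
structure IsWellSupported (Γ : ℝ × ℝ → M) : Prop where
  isTwoPath : IsTwoPath E Γ
  support : ∃ x₀ x₁ y₀ y₁ : ℝ, 1 / 2 < x₀ ∧ x₀ < x₁ ∧ x₁ < 1 ∧ 0 < y₀ ∧ y₀ < y₁ ∧ y₁ < 1 / 2 ∧
    (∀ p ∈ interior square \ (Set.Icc x₀ x₁ ×ˢ Set.Icc y₀ y₁), rankAt E Γ p ≤ 1) ∧
    (∀ p ∈ interior (convexHull ℝ {((0 : ℝ), (0 : ℝ)), (0, 1), (x₀, y₀), (x₀, y₁)}),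
      rankAt E Γ p = 0) ∧
    (∀ p ∈ interior (convexHull ℝ {((1 : ℝ), (0 : ℝ)), (1, 1), (x₁, y₀), (x₁, y₁)}),
      rankAt E Γ p = 0)

end Paths

/-! ### The maps `μ` and `Θ` and the iterated integrals -/

/-- `μ(t, s) = (1 - t, s)`. -/
def muMap (p : ℝ × ℝ) : ℝ × ℝ := (1 - p.1, p.2)

/-- `λ(-, s)` is the piecewise linear path `(s, 1) → (s, 0) → (0, 0)` which arrives at `(s, 0)` at
time `1/2`. -/
def lambdaMap (p : ℝ × ℝ) : ℝ × ℝ :=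
  if p.1 ≤ 1 / 2 then (p.2, 1 - 2 * p.1) else ((2 - 2 * p.1) * p.2, 0)

/-- The folding map `q : I² → Δ₂`, `q(t, s) = (max {t, s}, s)`. -/
def foldMap (p : ℝ × ℝ) : ℝ × ℝ := (max p.1 p.2, p.2)

/-- `Θ = q ∘ λ : I² → Δ₂`. -/
def thetaMap : ℝ × ℝ → ℝ × ℝ := foldMap ∘ lambdaMap

/-- The embedding `b : Δ₂ → I²`, `b(t, s) = (t, s)`, of the simplex
`Δ₂ = {1 ≥ t ≥ s ≥ 0}` into the square. -/
def lowerEmbedding (p : ℝ × ℝ) : ℝ × ℝ := (p.1, p.2)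

/-- The simplex `Δ_k = {1 ≥ t₁ ≥ ⋯ ≥ t_k ≥ 0}`. -/
def orderedSimplex (k : ℕ) : Set (Fin k → ℝ) :=
  {t | Antitone t ∧ ∀ i, t i ∈ Set.Icc (0 : ℝ) 1}

/-- The form degrees of the factors of `α¹ ∧ ⋯ ∧ α¹ ∧ α² ∧ α¹ ∧ ⋯ ∧ α¹`, with `m` factors `α¹`
before and `n` factors `α¹` after the factor `α²`. -/
def omegaDeg (m n : ℕ) (i : Fin (m + n + 1)) : ℕ := if (i : ℕ) = m then 2 else 1

lemma sum_omegaDeg (m n : ℕ) : ∑ i, omegaDeg m n i = m + n + 1 + 1 := by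
  have h : ∀ i : Fin (m + n + 1),
      omegaDeg m n i = 1 + if i = ⟨m, by omega⟩ then 1 else 0 := by
    intro i
    simp only [omegaDeg, Fin.ext_iff]
    split_ifs <;> rfl
  simp only [h, Finset.sum_add_distrib]
  simp

/-- The coordinate frame `∂/∂t₁, …, ∂/∂t_k, ∂/∂s` of `Δ_k × I`. -/
def frame (k : ℕ) : Fin (k + 1) → (Fin k → ℝ) × ℝ :=
  Fin.snoc (α := fun _ => (Fin k → ℝ) × ℝ) (fun i => (Pi.single i 1, 0)) (0, 1)

section Series

variable {E : Type*} [NormedAddCommGroup E] [NormedSpace ℝ E]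
  {M : Type*} [TopologicalSpace M] [ChartedSpace E M]
  {V : Type*} [NormedAddCommGroup V] [NormedSpace ℝ V] [FiniteDimensional ℝ V]
  {C : GradedComplex V}

/-- For `G : I² → M`, the pullback to `Δ_k × I`, `k = m + n + 1`, of
`p₁^* α¹ ∧ ⋯ ∧ p_m^* α¹ ∧ p_{m+1}^* α² ∧ p_{m+2}^* α¹ ∧ ⋯ ∧ p_k^* α¹` along
`G_{(k)} : Δ_k × I → M^k`, `(t₁, …, t_k, s) ↦ (G(t₁, s), …, G(t_k, s))`,
evaluated at the point `x = (t, s)` on tangent vectors `v`. -/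
def pulledBackOmega (α : FlatSuperconnection E M C) (G : ℝ × ℝ → M) (m n : ℕ)
    (x : (Fin (m + n + 1) → ℝ) × ℝ)
    (v : Fin (m + n + 1 + 1) → (Fin (m + n + 1) → ℝ) × ℝ) : V →L[ℝ] V :=
  superWedge (omegaDeg m n) (sum_omegaDeg m n)
    (fun i u => α.form (omegaDeg m n i) (G (x.1 i, x.2)) fun a =>
      mfderiv 𝓘(ℝ, (Fin (m + n + 1) → ℝ) × ℝ) 𝓘(ℝ, E)
        (fun y : (Fin (m + n + 1) → ℝ) × ℝ => G (y.1 i, y.2)) x (u a)) v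

/-- The integrand of `∫_{Δ_k × I}` of the above form, for the orientation
`dt₁ ∧ ⋯ ∧ dt_k ∧ ds`. -/
def omegaDensity (α : FlatSuperconnection E M C) (G : ℝ × ℝ → M) (m n : ℕ)
    (x : (Fin (m + n + 1) → ℝ) × ℝ) : V →L[ℝ] V :=
  pulledBackOmega α G m n x (frame (m + n + 1))

/-- The domain of integration `Δ_k × I`. -/
def simplexTimesInterval (k : ℕ) : Set ((Fin k → ℝ) × ℝ) :=
  orderedSimplex k ×ˢ Set.Icc 0 1

/-- `∫_{Δ_{m+n+1} × I} G_{(m+n+1)}^* (p₁^* α¹ ∧ ⋯ ∧ p_{m+1}^* α² ∧ ⋯ ∧ p_{m+n+1}^* α¹)`. -/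
def omegaIntegral (α : FlatSuperconnection E M C) (G : ℝ × ℝ → M) (m n : ℕ) : V →L[ℝ] V :=
  ∫ x in simplexTimesInterval (m + n + 1), omegaDensity α G m n x

/-- The `(m, n)`-th term of the series `Z(Γ)`. -/
def zTerm (α : FlatSuperconnection E M C) (Γ : ℝ × ℝ → M) (p : ℕ × ℕ) : V →L[ℝ] V :=
  (-1 : ℝ) ^ (p.1 + p.2) • omegaIntegral α (Γ ∘ muMap) p.1 p.2

/-- The series `Z(Γ)`. -/
def zSeries (α : FlatSuperconnection E M C) (Γ : ℝ × ℝ → M) : V →L[ℝ] V :=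
  ∑' p, zTerm α Γ p

/-- The `(m, n)`-th term of the series `β²(σ)` attached to a 2-simplex `σ : Δ₂ → M` by the
integration functor. -/
def betaTwoTerm (α : FlatSuperconnection E M C) (σ : ℝ × ℝ → M) (p : ℕ × ℕ) : V →L[ℝ] V :=
  (-1 : ℝ) ^ (p.1 + p.2 + 1) • omegaIntegral α (σ ∘ thetaMap) p.1 p.2

/-- The holonomy `β²(σ)` of a 2-simplex. -/
def betaTwo (α : FlatSuperconnection E M C) (σ : ℝ × ℝ → M) : V →L[ℝ] V :=
  ∑' p, betaTwoTerm α σ p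

/-- `X(Γ) = β²(Γ_b)`, where `Γ_b = Γ ∘ b`. -/
def xSeries (α : FlatSuperconnection E M C) (Γ : ℝ × ℝ → M) : V →L[ℝ] V :=
  betaTwo α (Γ ∘ lowerEmbedding)

end Series

end SurfaceHolonomy

end

/-! Let `G = foldPath Γ`: the restriction of Γ to the simplex s ≤ t, extended to the square by the
retraction (t, s) ↦ (max(t, s), s) and read in the coordinates u = 1 - t, v = 1 - s. The left side
and the bottom side of `G` go to one point. Hence the horizontal transports g(u, v) from (0, v) and
the vertical transports h(u, v) from (u, 0) all start over the same point and can be compared. Up to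
a common sign, Z integrates α² transported along the horizontal lines of `G`, and X integrates α²
transported along a vertical line followed by the top edge.

Write b for the coefficient of the pullback of α² along `G`, a₂ for the vertical coefficient of the
pullback of α¹, k = g⁻¹, l = h⁻¹, β(u, v) = ∫₀ᵘ k b g and γ(u, v) = ∫₀ᵛ l b h. Flatness says that α¹
takes values in cochain maps of degree 0 and that its curvature is -[∂, α²]. So transports commute
with ∂, and the non-abelian Stokes formula (`NiceMap.stokes`) becomes ∂_v g = -a₂ g - g [∂, β]. For
the loop holonomy H = k h the connection terms cancel: ∂_v H = [∂, β] H and ∂_u H = [∂, H γ]. With W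
= H γ this gives ∂_v W - ∂_u (β H) = [∂, β] W - β [∂, W] = [∂, β W]. Integrated over the square, ∫
W(u, 1) du and ∫ β(1, v) H(1, v) dv differ by a boundary
(`GradedComplex.integral_eq_evenBracket_add`). A one-variable argument
(`GradedComplex.exists_evenBracket_eq`) replaces the second integral by H(1, 1) ∫ H(1, v)⁻¹ β(1, v)
dv, again up to a boundary.

The iterated integrals with one insertion B sum, by variation of constants, to U(1) ∫ U⁻¹ B U
(`hasSum_iterInt_insertedList`). This yields Z = -∫ g(1, v) β(1, v) dv and X = -g(1, 1) ∫ W(u, 1)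
du, and X is therefore congruent to -h(1, 1) ∫ l(1, v) g(1, v) β(1, v) dv. The support condition now
enters: β(1, v) = 0 for almost every v with 1 - v outside [y₀, y₁], because the rank is at most 1
there; and for v ≥ 1 - y₁ the right edge of `G` above v runs inside the left trapezoid, where Γ is
locally constant, so that h(1, 1) l(1, v) = 1. The same trapezoid allows Γ ∘ μ to be replaced by `G`
in Z.

Since Γ is only piecewise smooth, all differential equations are meant for Lipschitz functions with
derivatives almost everywhere (`LipDeriv`), and the Stokes formula is proved from difference
quotients, without mixed second derivatives of the map. -/

set_option linter.unusedSectionVars false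

noncomputable section

namespace SurfaceHolonomy

/-! ### Lipschitz functions with a prescribed almost everywhere derivative -/

section LipDeriv

open Set

variable {X Y Z : Type*} [NormedAddCommGroup X] [NormedSpace ℝ X]
  [NormedAddCommGroup Y] [NormedSpace ℝ Y] [NormedAddCommGroup Z] [NormedSpace ℝ Z]

/-- `F` is Lipschitz on `[a, b]` and has derivative `f` almost everywhere there. -/
structure LipDeriv (F f : ℝ → X) (a b : ℝ) : Prop where
  lip : ∃ K : NNReal, LipschitzOnWith K F (Icc a b)
  deriv : ∀ᵐ x, x ∈ Ioo a b → HasDerivAt F (f x) x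

lemma ae_ne_real (c : ℝ) : ∀ᵐ x : ℝ, x ≠ c := by
  simp [ae_iff, measure_singleton]

lemma lipschitzOnWith_integral [CompleteSpace X] {f : ℝ → X} {a b : ℝ} {C : ℝ}
    (hC : ∀ x ∈ Icc a b, ‖f x‖ ≤ C) (hf : IntervalIntegrable f volume a b) (hab : a ≤ b) :
    LipschitzOnWith C.toNNReal (fun x => ∫ t in a..x, f t) (Icc a b) := by
  refine LipschitzOnWith.of_dist_le_mul fun x hx y hy => ?_
  have hsub : ∀ z ∈ Icc a b, IntervalIntegrable f volume a z := fun z hz =>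
    hf.mono_set (by rw [uIcc_of_le hab, uIcc_of_le hz.1]; exact Icc_subset_Icc_right hz.2)
  rw [dist_eq_norm, intervalIntegral.integral_interval_sub_left (hsub x hx) (hsub y hy),
    Real.dist_eq]
  have h0 : 0 ≤ C := (norm_nonneg _).trans (hC x hx)
  rw [Real.coe_toNNReal C h0]
  refine intervalIntegral.norm_integral_le_of_norm_le_const fun t ht => hC t ?_
  have := uIoc_subset_uIcc ht
  exact (uIcc_subset_Icc hy hx) this

namespace LipDeriv

variable {F f G g : ℝ → X} {a b : ℝ}

lemma continuousOn (h : LipDeriv F f a b) : ContinuousOn F (Icc a b) :=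
  let ⟨_, hK⟩ := h.lip; hK.continuousOn

lemma mono (h : LipDeriv F f a b) {c d : ℝ} (hc : a ≤ c) (hd : d ≤ b) : LipDeriv F f c d where
  lip := let ⟨K, hK⟩ := h.lip; ⟨K, hK.mono (Icc_subset_Icc hc hd)⟩
  deriv := by
    filter_upwards [h.deriv] with x hx hx'
    exact hx (Ioo_subset_Ioo hc hd hx')

lemma congr_deriv (h : LipDeriv F f a b) (hfg : ∀ᵐ x, x ∈ Ioo a b → f x = g x) :
    LipDeriv F g a b where
  lip := h.lip
  deriv := by
    filter_upwards [h.deriv, hfg] with x hx hx' hx''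
    rw [← hx' hx'']; exact hx hx''

lemma congr (h : LipDeriv F f a b) (hFG : ∀ x ∈ Icc a b, F x = G x) : LipDeriv G f a b where
  lip := let ⟨K, hK⟩ := h.lip; ⟨K, by
    intro x hx y hy; rw [← hFG x hx, ← hFG y hy]; exact hK hx hy⟩
  deriv := by
    filter_upwards [h.deriv] with x hx hx'
    refine (hx hx').congr_of_eventuallyEq ?_
    filter_upwards [isOpen_Ioo.mem_nhds hx'] with y hy
    exact (hFG y (Ioo_subset_Icc_self hy)).symm

lemma const (c : X) (a b : ℝ) : LipDeriv (fun _ => c) (fun _ => 0) a b where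
  lip := ⟨0, LipschitzWith.const c |>.lipschitzOnWith⟩
  deriv := Filter.Eventually.of_forall fun x _ => hasDerivAt_const x c

lemma add (hF : LipDeriv F f a b) (hG : LipDeriv G g a b) :
    LipDeriv (fun x => F x + G x) (fun x => f x + g x) a b where
  lip := by
    obtain ⟨K, hK⟩ := hF.lip
    obtain ⟨K', hK'⟩ := hG.lip
    exact ⟨K + K', hK.add hK'⟩
  deriv := by
    filter_upwards [hF.deriv, hG.deriv] with x h1 h2 hx
    exact (h1 hx).add (h2 hx)

lemma sub (hF : LipDeriv F f a b) (hG : LipDeriv G g a b) :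
    LipDeriv (fun x => F x - G x) (fun x => f x - g x) a b where
  lip := by
    obtain ⟨K, hK⟩ := hF.lip
    obtain ⟨K', hK'⟩ := hG.lip
    exact ⟨K + K', hK.sub hK'⟩
  deriv := by
    filter_upwards [hF.deriv, hG.deriv] with x h1 h2 hx
    exact (h1 hx).sub (h2 hx)

lemma bounded (h : LipDeriv F f a b) : ∃ C, ∀ x ∈ Icc a b, ‖F x‖ ≤ C :=
  isCompact_Icc.exists_bound_of_continuousOn h.continuousOn

lemma clm (hF : LipDeriv F f a b) (L : X →L[ℝ] Y) :
    LipDeriv (fun x => L (F x)) (fun x => L (f x)) a b where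
  lip := by
    obtain ⟨K, hK⟩ := hF.lip
    exact ⟨_, L.lipschitz.comp_lipschitzOnWith hK⟩
  deriv := by
    filter_upwards [hF.deriv] with x h1 hx
    exact L.hasFDerivAt.comp_hasDerivAt x (h1 hx)

lemma bilin {G g : ℝ → Y} (B : X →L[ℝ] Y →L[ℝ] Z) (hF : LipDeriv F f a b)
    (hG : LipDeriv G g a b) :
    LipDeriv (fun x => B (F x) (G x)) (fun x => B (f x) (G x) + B (F x) (g x)) a b where
  lip := by
    obtain ⟨K, hK⟩ := hF.lip
    obtain ⟨K', hK'⟩ := hG.lip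
    obtain ⟨C, hC⟩ := hF.bounded
    obtain ⟨C', hC'⟩ := hG.bounded
    refine ⟨(‖B‖ * (C * K') + ‖B‖ * (K * C')).toNNReal,
      LipschitzOnWith.of_dist_le_mul fun x hx y hy => ?_⟩
    have e : B (F x) (G x) - B (F y) (G y) = B (F x) (G x - G y) + B (F x - F y) (G y) := by
      simp
    have hKd := hK.dist_le_mul x hx y hy
    have hKd' := hK'.dist_le_mul x hx y hy
    rw [dist_eq_norm] at hKd hKd' ⊢
    have hC0 : 0 ≤ C := (norm_nonneg _).trans (hC x hx)
    have hC0' : 0 ≤ C' := (norm_nonneg _).trans (hC' x hx)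
    calc _ = ‖B (F x) (G x - G y) + B (F x - F y) (G y)‖ := by rw [e]
      _ ≤ ‖B (F x) (G x - G y)‖ + ‖B (F x - F y) (G y)‖ := norm_add_le _ _
      _ ≤ ‖B‖ * ‖F x‖ * ‖G x - G y‖ + ‖B‖ * ‖F x - F y‖ * ‖G y‖ :=
        add_le_add (B.le_opNorm₂ _ _) (B.le_opNorm₂ _ _)
      _ ≤ ‖B‖ * C * (K' * dist x y) + ‖B‖ * (K * dist x y) * C' := by
        gcongr
        · exact hC x hx
        · exact hC' y hy
      _ = (‖B‖ * (C * K') + ‖B‖ * (K * C')) * dist x y := by ring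
      _ ≤ _ := by gcongr; exact Real.le_coe_toNNReal _
  deriv := by
    filter_upwards [hF.deriv, hG.deriv] with x h1 h2 hx
    have := B.hasFDerivAt_of_bilinear (h1 hx).hasFDerivAt (h2 hx).hasFDerivAt
    convert! this.hasDerivAt using 1
    simp [add_comm]

lemma mul {𝔄 : Type*} [NormedRing 𝔄] [NormedAlgebra ℝ 𝔄] {F f G g : ℝ → 𝔄}
    (hF : LipDeriv F f a b) (hG : LipDeriv G g a b) :
    LipDeriv (fun x => F x * G x) (fun x => f x * G x + F x * g x) a b :=
  bilin (ContinuousLinearMap.mul ℝ 𝔄) hF hG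

lemma comp_affine {c d : ℝ} (hc : 0 < c) (h : LipDeriv F f (c * a + d) (c * b + d)) :
    LipDeriv (fun x => F (c * x + d)) (fun x => c • f (c * x + d)) a b where
  lip := by
    obtain ⟨K, hK⟩ := h.lip
    refine ⟨K * c.toNNReal, hK.comp (f := fun x : ℝ => c * x + d) ?_ ?_⟩
    · refine LipschitzOnWith.of_dist_le_mul fun x _ y _ => ?_
      rw [Real.coe_toNNReal c hc.le, Real.dist_eq, Real.dist_eq]
      rw [show c * x + d - (c * y + d) = c * (x - y) by ring, abs_mul, abs_of_pos hc]
    · intro x hx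
      exact ⟨by nlinarith [hx.1], by nlinarith [hx.2]⟩
  deriv := by
    -- The derivative of `F` is known off a null set only; its preimage under an affine map with
    -- nonzero slope is again null.
    have hq : Measure.QuasiMeasurePreserving (fun x : ℝ => c * x + d) volume volume := by
      refine ⟨by fun_prop, ?_⟩
      have : (fun x : ℝ => c * x + d) = (fun x => x + d) ∘ (fun x => c * x) := rfl
      rw [this, ← Measure.map_map (by fun_prop) (by fun_prop), Real.map_volume_mul_left hc.ne',
        Measure.map_smul, map_add_right_eq_self]
      exact Measure.smul_absolutelyContinuous
    filter_upwards [hq.ae h.deriv] with x hx hx'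
    have h1 : c * x + d ∈ Ioo (c * a + d) (c * b + d) :=
      ⟨by have := hx'.1; gcongr, by have := hx'.2; gcongr⟩
    have h2 : HasDerivAt (fun x : ℝ => c * x + d) c x := by
      simpa using ((hasDerivAt_id x).const_mul c).add_const d
    exact (hx h1).scomp x h2

/-- A Lipschitz function is absolutely continuous, which rules out Cantor-type behaviour. The
endpoints, where nothing is assumed about the derivative, form a null set. -/
lemma eq_of_deriv_zero (h : LipDeriv F (fun _ => 0) a b) (hab : a ≤ b) : F b = F a := by
  obtain ⟨K, hK⟩ := h.lip
  rw [← uIcc_of_le hab] at hK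
  obtain ⟨C, hC⟩ := hK.absolutelyContinuousOnInterval.const_of_ae_hasDerivAt_zero (by
    filter_upwards [h.deriv, ae_ne_real a, ae_ne_real b] with x hx ha hb hx'
    rw [uIcc_of_le hab] at hx'
    exact hx ⟨lt_of_le_of_ne hx'.1 ha.symm, lt_of_le_of_ne hx'.2 hb⟩)
  rw [hC b right_mem_uIcc, hC a left_mem_uIcc]

lemma glue {c : ℝ} (hab : a ≤ b) (hbc : b ≤ c) (h : LipDeriv F f a b) (h' : LipDeriv F f b c) :
    LipDeriv F f a c where
  lip := by
    obtain ⟨K, hK⟩ := h.lip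
    obtain ⟨K', hK'⟩ := h'.lip
    have key : ∀ x y, x ∈ Icc a c → y ∈ Icc a c → x ≤ y →
        dist (F x) (F y) ≤ (max K K' : NNReal) * dist x y := by
      intro x y hx hy hxy
      have l1 : (K : ℝ) ≤ (max K K' : NNReal) := by exact_mod_cast le_max_left K K'
      have l2 : (K' : ℝ) ≤ (max K K' : NNReal) := by exact_mod_cast le_max_right K K'
      rcases le_total y b with hyb | hyb
      · refine (hK.dist_le_mul x ⟨hx.1, hxy.trans hyb⟩ y ⟨hy.1, hyb⟩).trans ?_
        gcongr
      rcases le_total x b with hxb | hxb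
      · refine (dist_triangle _ (F b) _).trans ?_
        have e1 := hK.dist_le_mul x ⟨hx.1, hxb⟩ b ⟨hab, le_rfl⟩
        have e2 := hK'.dist_le_mul b ⟨le_rfl, hbc⟩ y ⟨hyb, hy.2⟩
        have e3 : dist x y = dist x b + dist b y := by
          rw [Real.dist_eq, Real.dist_eq, Real.dist_eq, abs_of_nonpos (by linarith),
            abs_of_nonpos (by linarith), abs_of_nonpos (by linarith)]; ring
        rw [e3, mul_add]
        refine add_le_add (e1.trans ?_) (e2.trans ?_) <;> gcongr
      · refine (hK'.dist_le_mul x ⟨hxb, hx.2⟩ y ⟨hyb, hy.2⟩).trans ?_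
        gcongr
    refine ⟨max K K', LipschitzOnWith.of_dist_le_mul fun x hx y hy => ?_⟩
    rcases le_total x y with hxy | hxy
    · exact key x y hx hy hxy
    · rw [dist_comm, dist_comm x]; exact key y x hy hx hxy
  deriv := by
    filter_upwards [h.deriv, h'.deriv, ae_ne_real b] with x h1 h2 hb hx
    rcases lt_or_gt_of_ne hb with hlt | hlt
    · exact h1 ⟨hx.1, hlt⟩
    · exact h2 ⟨hlt, hx.2⟩

variable [CompleteSpace X]

/-- `f` agrees almost everywhere with `deriv F`, which is measurable and bounded by the Lipschitz
constant. -/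
lemma intervalIntegrable (h : LipDeriv F f a b) (hab : a ≤ b) :
    IntervalIntegrable f volume a b := by
  obtain ⟨K, hK⟩ := h.lip
  rw [intervalIntegrable_iff_integrableOn_Ioo_of_le hab]
  have h1 : ∀ᵐ x ∂(volume.restrict (Ioo a b)), _root_.deriv F x = f x := by
    rw [ae_restrict_iff' measurableSet_Ioo]
    filter_upwards [h.deriv] with x hx hx'
    exact (hx hx').deriv
  have h2 : IntegrableOn (_root_.deriv F) (Ioo a b) := by
    refine Measure.integrableOn_of_bounded (M := K) (by simp)
      (aestronglyMeasurable_deriv F volume) ?_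
    rw [ae_restrict_iff' measurableSet_Ioo]
    refine Filter.Eventually.of_forall fun x hx => ?_
    exact norm_deriv_le_of_lipschitzOn (Icc_mem_nhds hx.1 hx.2) hK
  exact h2.congr h1

/-- The primitive of a bounded measurable function. -/
lemma primitive {C : ℝ} (hab : a ≤ b) (hC : ∀ x ∈ Icc a b, ‖f x‖ ≤ C)
    (hf : AEStronglyMeasurable f (volume.restrict (Icc a b))) :
    LipDeriv (fun x => ∫ t in a..x, f t) f a b := by
  have hint : IntervalIntegrable f volume a b := by
    rw [intervalIntegrable_iff_integrableOn_Icc_of_le hab]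
    refine Integrable.of_bound hf C ?_
    rw [ae_restrict_iff' measurableSet_Icc]
    exact Filter.Eventually.of_forall hC
  refine ⟨⟨_, lipschitzOnWith_integral hC hint hab⟩, ?_⟩
  filter_upwards [hint.ae_hasDerivAt_integral] with x hx hx'
  exact hx (by rw [uIcc_of_le hab]; exact Ioo_subset_Icc_self hx') a left_mem_uIcc

lemma primitive_const_add {C : ℝ} (hab : a ≤ b) (hC : ∀ x ∈ Icc a b, ‖f x‖ ≤ C)
    (hf : AEStronglyMeasurable f (volume.restrict (Icc a b))) (c : X) :
    LipDeriv (fun x => c + ∫ t in a..x, f t) f a b := by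
  simpa using (LipDeriv.const c a b).add (primitive hab hC hf)

/-- The fundamental theorem of calculus. -/
lemma integral_eq (h : LipDeriv F f a b) (hab : a ≤ b) : ∫ x in a..b, f x = F b - F a := by
  obtain ⟨K, hK⟩ := h.lip
  -- `f` may be wild on a null set, so it is replaced by a measurable version bounded everywhere.
  -- The difference between `F` and the primitive of that version is constant.
  have h1 : ∀ᵐ x, x ∈ Ioo a b → f x = (Ioo a b).indicator (_root_.deriv F) x := by
    filter_upwards [h.deriv] with x hx hx'
    rw [indicator_of_mem hx', (hx hx').deriv]
  have h2 : LipDeriv (fun x => ∫ t in a..x, (Ioo a b).indicator (_root_.deriv F) t)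
      ((Ioo a b).indicator (_root_.deriv F)) a b := by
    refine primitive (C := K) hab (fun x _ => ?_)
      ((stronglyMeasurable_deriv F).indicator measurableSet_Ioo).aestronglyMeasurable
    by_cases hx : x ∈ Ioo a b
    · rw [indicator_of_mem hx]
      exact norm_deriv_le_of_lipschitzOn (Icc_mem_nhds hx.1 hx.2) hK
    · rw [indicator_of_notMem hx]; simp
  have h3 : LipDeriv (fun x => F x - ∫ t in a..x, (Ioo a b).indicator (_root_.deriv F) t)
      (fun _ => 0) a b := by
    refine (h.sub h2).congr_deriv ?_
    filter_upwards [h1] with x hx hx'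
    rw [hx hx', sub_self]
  have h4 := h3.eq_of_deriv_zero hab
  rw [intervalIntegral.integral_same, sub_zero] at h4
  rw [← h4, sub_sub_cancel]
  refine intervalIntegral.integral_congr_ae ?_
  filter_upwards [h1, ae_ne_real b] with x hx hb hx'
  rw [uIoc_of_le hab] at hx'
  exact hx ⟨hx'.1, lt_of_le_of_ne hx'.2 hb⟩

lemma eq_add_integral (h : LipDeriv F f a b) {x : ℝ} (hx : x ∈ Icc a b) :
    F x = F a + ∫ t in a..x, f t := by
  rw [(h.mono le_rfl hx.2).integral_eq hx.1]; abel

end LipDeriv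

end LipDeriv

/-! ### Linear differential equations with bounded measurable coefficients -/

section Flow

open Set

variable {X : Type*} [NormedAddCommGroup X] [NormedSpace ℝ X]

/-- `f` is measurable on `[0, 1]` and bounded there by `C`. -/
structure Coeff (C : ℝ) (f : ℝ → X) : Prop where
  meas : AEStronglyMeasurable f (volume.restrict (Icc 0 1))
  bound : ∀ t ∈ Icc (0 : ℝ) 1, ‖f t‖ ≤ C

/-- A family of operators that can serve as coefficients of a linear differential equation. -/
structure OpCoeff (C : ℝ) (Λ : ℝ → X →L[ℝ] X) : Prop where
  meas : ∀ y : ℝ → X, ContinuousOn y (Icc 0 1) →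
    AEStronglyMeasurable (fun t => Λ t (y t)) (volume.restrict (Icc 0 1))
  bound : ∀ t ∈ Icc (0 : ℝ) 1, ‖Λ t‖ ≤ C

/-- The terms of the Picard series. -/
def picard (Λ : ℝ → X →L[ℝ] X) (x : X) : ℕ → ℝ → X
  | 0 => fun _ => x
  | n + 1 => fun t => ∫ τ in 0..t, Λ τ (picard Λ x n τ)

/-- The solution of `y' = Λ y`, `y(0) = x`, on `[0, 1]`, as a Picard series. -/
def flow (Λ : ℝ → X →L[ℝ] X) (x : X) (t : ℝ) : X := ∑' n, picard Λ x n t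

lemma integral_pow_div_factorial (c C : ℝ) (n : ℕ) (t : ℝ) :
    ∫ τ in (0 : ℝ)..t, C * (c * (C * τ) ^ n / n.factorial) =
      c * (C * t) ^ (n + 1) / (n + 1).factorial := by
  have : ∀ τ : ℝ, C * (c * (C * τ) ^ n / n.factorial) =
      (C * c * C ^ n / n.factorial) * τ ^ n := fun τ => by rw [mul_pow]; ring
  simp_rw [this]
  rw [intervalIntegral.integral_const_mul, integral_pow, Nat.factorial_succ, mul_pow]
  have : (n.factorial : ℝ) ≠ 0 := by positivity
  have : (n : ℝ) + 1 ≠ 0 := by positivity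
  push_cast
  field_simp
  simp only [pow_succ]
  simp
  ring

lemma flow_zero (Λ : ℝ → X →L[ℝ] X) (x : X) : flow Λ x 0 = x := by
  rw [flow, tsum_eq_single 0]
  · rfl
  · intro n hn
    obtain ⟨m, rfl⟩ := Nat.exists_eq_succ_of_ne_zero hn
    simp [picard]

variable [CompleteSpace X] {Λ : ℝ → X →L[ℝ] X} {C : ℝ}

lemma norm_integral_le_pow_succ {F : ℝ → X} {c C : ℝ} {n : ℕ}
    (hF : ∀ τ ∈ Icc (0 : ℝ) 1, ‖F τ‖ ≤ C * (c * (C * τ) ^ n / n.factorial))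
    {t : ℝ} (ht : t ∈ Icc (0 : ℝ) 1) :
    ‖∫ τ in 0..t, F τ‖ ≤ c * (C * t) ^ (n + 1) / (n + 1).factorial := by
  rw [← integral_pow_div_factorial]
  refine intervalIntegral.norm_integral_le_of_norm_le ht.1 ?_
    (Continuous.intervalIntegrable (by fun_prop) _ _)
  refine Filter.Eventually.of_forall fun τ hτ => hF τ ⟨hτ.1.le, hτ.2.trans ht.2⟩

/-- The two claims need each other: `OpCoeff` gives measurability only along continuous curves, so
continuity of one term makes the next integrand measurable, while the bound (C t)ⁿ / n! integrates
to the next bound. -/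
lemma picard_spec (hΛ : OpCoeff C Λ) (x : X) (n : ℕ) :
    ContinuousOn (picard Λ x n) (Icc 0 1) ∧
    ∀ t ∈ Icc (0 : ℝ) 1, ‖picard Λ x n t‖ ≤ ‖x‖ * (C * t) ^ n / n.factorial := by
  induction n with
  | zero => exact ⟨continuousOn_const, fun t _ => by simp [picard]⟩
  | succ n ih =>
    have hC : 0 ≤ C := (norm_nonneg _).trans (hΛ.bound 0 (by simp))
    have hb : ∀ τ ∈ Icc (0 : ℝ) 1,
        ‖Λ τ (picard Λ x n τ)‖ ≤ C * (‖x‖ * (C * τ) ^ n / n.factorial) := fun τ hτ =>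
      (ContinuousLinearMap.le_opNorm _ _).trans
        (mul_le_mul (hΛ.bound τ hτ) (ih.2 τ hτ) (norm_nonneg _) hC)
    constructor
    · refine (LipDeriv.primitive (C := C * (‖x‖ * C ^ n / n.factorial)) zero_le_one ?_
        (hΛ.meas _ ih.1)).continuousOn
      intro τ hτ
      refine (hb τ hτ).trans ?_
      have h1 : C * τ ≤ C := mul_le_of_le_one_right hC hτ.2
      have h0 : 0 ≤ C * τ := mul_nonneg hC hτ.1
      gcongr
    · intro t ht
      exact norm_integral_le_pow_succ hb ht

lemma picard_bound (hΛ : OpCoeff C Λ) (x : X) (n : ℕ) {t : ℝ} (ht : t ∈ Icc (0 : ℝ) 1) :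
    ‖picard Λ x n t‖ ≤ ‖x‖ * (C ^ n / n.factorial) := by
  have hC : 0 ≤ C := (norm_nonneg _).trans (hΛ.bound 0 (by simp))
  refine ((picard_spec hΛ x n).2 t ht).trans ?_
  have h1 : C * t ≤ C := mul_le_of_le_one_right hC ht.2
  have h0 : 0 ≤ C * t := mul_nonneg hC ht.1
  rw [mul_div_assoc]
  gcongr

lemma summable_picard_bound (x : X) (C : ℝ) :
    Summable fun n : ℕ => ‖x‖ * (C ^ n / n.factorial) :=
  (Real.summable_pow_div_factorial C).mul_left _

lemma hasSum_flow (hΛ : OpCoeff C Λ) (x : X) {t : ℝ} (ht : t ∈ Icc (0 : ℝ) 1) :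
    HasSum (fun n => picard Λ x n t) (flow Λ x t) :=
  (Summable.of_norm_bounded (summable_picard_bound x C)
    fun n => picard_bound hΛ x n ht).hasSum

lemma continuousOn_flow (hΛ : OpCoeff C Λ) (x : X) : ContinuousOn (flow Λ x) (Icc 0 1) :=
  continuousOn_tsum (fun n => (picard_spec hΛ x n).1) (summable_picard_bound x C)
    fun n _ ht => picard_bound hΛ x n ht

lemma norm_flow_le (hΛ : OpCoeff C Λ) (x : X) {t : ℝ} (ht : t ∈ Icc (0 : ℝ) 1) :
    ‖flow Λ x t‖ ≤ ‖x‖ * Real.exp C := by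
  refine tsum_of_norm_bounded ?_ fun n => picard_bound hΛ x n ht
  rw [Real.exp_eq_exp_ℝ, NormedSpace.exp_eq_tsum_div]
  exact (Real.summable_pow_div_factorial C).hasSum.mul_left _

/-- The Picard series may be integrated term by term, being dominated by an exponential series. -/
lemma flow_eq_integral (hΛ : OpCoeff C Λ) (x : X) {t : ℝ} (ht : t ∈ Icc (0 : ℝ) 1) :
    flow Λ x t = x + ∫ τ in 0..t, Λ τ (flow Λ x τ) := by
  have hC : 0 ≤ C := (norm_nonneg _).trans (hΛ.bound 0 (by simp))
  have h1 := (hasSum_flow hΛ x ht).summable.tsum_eq_zero_add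
  have hsub : Ioc 0 t ⊆ Icc (0 : ℝ) 1 := fun τ hτ => ⟨hτ.1.le, hτ.2.trans ht.2⟩
  have h2 : HasSum (fun n => picard Λ x (n + 1) t) (∫ τ in 0..t, Λ τ (flow Λ x τ)) := by
    refine intervalIntegral.hasSum_integral_of_dominated_convergence
      (fun n _ => C * (‖x‖ * (C ^ n / n.factorial))) ?_ ?_ ?_ ?_ ?_
    · intro n
      rw [uIoc_of_le ht.1]
      exact (hΛ.meas _ (picard_spec hΛ x n).1).mono_measure
        (Measure.restrict_mono hsub le_rfl)
    · intro n
      refine Filter.Eventually.of_forall fun τ hτ => ?_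
      rw [uIoc_of_le ht.1] at hτ
      exact (ContinuousLinearMap.le_opNorm _ _).trans (mul_le_mul (hΛ.bound τ (hsub hτ))
        (picard_bound hΛ x n (hsub hτ)) (norm_nonneg _) hC)
    · exact Filter.Eventually.of_forall fun _ _ => (summable_picard_bound x C).mul_left C
    · exact intervalIntegrable_const
    · refine Filter.Eventually.of_forall fun τ hτ => ?_
      rw [uIoc_of_le ht.1] at hτ
      exact (hasSum_flow hΛ x (hsub hτ)).mapL (Λ τ)
  rw [h2.tsum_eq] at h1
  exact h1

lemma lipDeriv_flow (hΛ : OpCoeff C Λ) (x : X) :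
    LipDeriv (flow Λ x) (fun t => Λ t (flow Λ x t)) 0 1 := by
  have hC : 0 ≤ C := (norm_nonneg _).trans (hΛ.bound 0 (by simp))
  refine (LipDeriv.primitive_const_add (C := C * (‖x‖ * Real.exp C)) zero_le_one ?_
    (hΛ.meas _ (continuousOn_flow hΛ x)) x).congr fun t ht => (flow_eq_integral hΛ x ht).symm
  exact fun τ hτ => (ContinuousLinearMap.le_opNorm _ _).trans
    (mul_le_mul (hΛ.bound τ hτ) (norm_flow_le hΛ x hτ) (norm_nonneg _) hC)

/-- The projection to the quotient by `S`, a normed space since `S` is closed, commutes with the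
integral. A non-integrable function has integral zero by convention. -/
lemma intervalIntegral_mem {S : Submodule ℝ X} (hS : IsClosed (S : Set X)) {f : ℝ → X} {a b : ℝ}
    (hab : a ≤ b) (hf : ∀ t ∈ Icc a b, f t ∈ S) : ∫ t in a..b, f t ∈ S := by
  by_cases hi : IntervalIntegrable f volume a b
  · have : IsClosed (S : Set X) := hS
    have h1 : S.mkQL (∫ t in a..b, f t) = 0 := by
      rw [← ContinuousLinearMap.intervalIntegral_comp_comm _ hi]
      have : ∀ t ∈ uIcc a b, S.mkQL (f t) = 0 := by
        intro t ht
        rw [uIcc_of_le hab] at ht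
        simpa using hf t ht
      rw [intervalIntegral.integral_congr this]
      simp
    simpa using h1
  · rw [intervalIntegral.integral_undef hi]; exact S.zero_mem

lemma flow_mem {S : Submodule ℝ X} (hS : IsClosed (S : Set X))
    (hΛS : ∀ t ∈ Icc (0 : ℝ) 1, ∀ y ∈ S, Λ t y ∈ S)
    {x : X} (hx : x ∈ S) {t : ℝ} (ht : t ∈ Icc (0 : ℝ) 1) : flow Λ x t ∈ S := by
  have h : ∀ n, ∀ t ∈ Icc (0 : ℝ) 1, picard Λ x n t ∈ S := by
    intro n
    induction n with
    | zero => exact fun _ _ => hx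
    | succ n ih =>
      intro t ht
      refine intervalIntegral_mem hS ht.1 fun τ hτ => ?_
      have hτ' : τ ∈ Icc (0 : ℝ) 1 := ⟨hτ.1, hτ.2.trans ht.2⟩
      exact hΛS τ hτ' _ (ih τ hτ')
  exact tsum_mem hS fun n => h n t ht

end Flow

/-! ### Parallel transport and iterated integrals -/

section Transport

open Set

variable {𝔄 : Type*} [NormedRing 𝔄] [NormedAlgebra ℝ 𝔄]

lemma Coeff.opCoeff_left {C : ℝ} {a : ℝ → 𝔄} (ha : Coeff C a) :
    OpCoeff C fun t => ContinuousLinearMap.mul ℝ 𝔄 (a t) where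
  meas _ hy := ha.meas.mul (hy.aestronglyMeasurable measurableSet_Icc)
  bound t ht := (ContinuousLinearMap.opNorm_mul_apply_le ℝ 𝔄 _).trans (ha.bound t ht)

lemma Coeff.opCoeff_right {C : ℝ} {a : ℝ → 𝔄} (ha : Coeff C a) :
    OpCoeff C fun t => (ContinuousLinearMap.mul ℝ 𝔄).flip (-(a t)) where
  meas _ hy := (hy.aestronglyMeasurable measurableSet_Icc).mul ha.meas.neg
  bound t ht := by
    refine ContinuousLinearMap.opNorm_le_bound _
      ((norm_nonneg _).trans (ha.bound 0 (by simp))) fun x => ?_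
    rw [ContinuousLinearMap.flip_apply, ContinuousLinearMap.mul_apply', mul_comm C]
    refine (norm_mul_le _ _).trans ?_
    rw [norm_neg]
    exact mul_le_mul_of_nonneg_left (ha.bound t ht) (norm_nonneg _)

/-- The solution of `U' = a U`, `U(0) = 1`. -/
def transport (a : ℝ → 𝔄) (t : ℝ) : 𝔄 := flow (fun τ => ContinuousLinearMap.mul ℝ 𝔄 (a τ)) 1 t

/-- The solution of `K' = - K a`, `K(0) = 1`. -/
def transportInv (a : ℝ → 𝔄) (t : ℝ) : 𝔄 :=
  flow (fun τ => (ContinuousLinearMap.mul ℝ 𝔄).flip (-(a τ))) 1 t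

lemma transport_zero (a : ℝ → 𝔄) : transport a 0 = 1 := flow_zero _ _

lemma transportInv_zero (a : ℝ → 𝔄) : transportInv a 0 = 1 := flow_zero _ _

variable [CompleteSpace 𝔄] {C : ℝ} {a : ℝ → 𝔄}

lemma lipDeriv_transport (ha : Coeff C a) :
    LipDeriv (transport a) (fun t => a t * transport a t) 0 1 :=
  lipDeriv_flow ha.opCoeff_left 1

lemma lipDeriv_transportInv (ha : Coeff C a) :
    LipDeriv (transportInv a) (fun t => -(transportInv a t * a t)) 0 1 := by
  have := lipDeriv_flow ha.opCoeff_right 1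
  simp only [ContinuousLinearMap.flip_apply, ContinuousLinearMap.mul_apply', mul_neg] at this
  exact this

lemma LipDeriv.eq_const {X : Type*} [NormedAddCommGroup X] [NormedSpace ℝ X]
    {F f : ℝ → X} {a b : ℝ} (h : LipDeriv F f a b) (hf : ∀ᵐ x, x ∈ Ioo a b → f x = 0)
    {x : ℝ} (hx : x ∈ Icc a b) : F x = F a :=
  ((h.congr_deriv hf).mono le_rfl hx.2).eq_of_deriv_zero hx.1

lemma transportInv_mul (ha : Coeff C a) {t : ℝ} (ht : t ∈ Icc (0 : ℝ) 1) :
    transportInv a t * transport a t = 1 := by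
  have h := ((lipDeriv_transportInv ha).mul (lipDeriv_transport ha)).eq_const
    (Filter.Eventually.of_forall fun x _ => by noncomm_ring) ht
  simpa [transport_zero, transportInv_zero] using h

/-- The other order of the product satisfies no evidently constant equation; instead, a
finite-dimensional algebra is Noetherian, and there one-sided inverses are two-sided. -/
lemma transport_mul_inv [FiniteDimensional ℝ 𝔄] (ha : Coeff C a) {t : ℝ}
    (ht : t ∈ Icc (0 : ℝ) 1) : transport a t * transportInv a t = 1 := by
  have : IsNoetherianRing 𝔄 := isNoetherian_of_tower ℝ inferInstance
  exact mul_eq_one_comm.1 (transportInv_mul ha ht)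

/-- Uniqueness of solutions: `transportInv a * y` has derivative zero almost everywhere. -/
lemma eq_transport_mul [FiniteDimensional ℝ 𝔄] (ha : Coeff C a) {y : ℝ → 𝔄}
    (hy : LipDeriv y (fun t => a t * y t) 0 1) {t : ℝ} (ht : t ∈ Icc (0 : ℝ) 1) :
    y t = transport a t * y 0 := by
  have h := ((lipDeriv_transportInv ha).mul hy).eq_const
    (Filter.Eventually.of_forall fun x _ => by noncomm_ring) ht
  rw [transportInv_zero, one_mul] at h
  rw [← h, ← mul_assoc, transport_mul_inv ha ht, one_mul]

/-- Iterated integrals `∫_{t ≥ t₁ ≥ ⋯ ≥ t_k ≥ 0} f₁(t₁) ⋯ f_k(t_k)`. -/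
def iterInt : List (ℝ → 𝔄) → ℝ → 𝔄
  | [] => fun _ => 1
  | f :: l => fun t => ∫ τ in 0..t, f τ * iterInt l τ

lemma iterInt_spec {l : List (ℝ → 𝔄)} (hl : ∀ f ∈ l, Coeff C f) (hC : 0 ≤ C) :
    ContinuousOn (iterInt l) (Icc 0 1) ∧
    ∀ t ∈ Icc (0 : ℝ) 1,
      ‖iterInt l t‖ ≤ ‖(1 : 𝔄)‖ * (C * t) ^ l.length / l.length.factorial := by
  induction l with
  | nil => exact ⟨continuousOn_const, fun t _ => by simp [iterInt]⟩
  | cons f l ih =>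
    have ih := ih fun g hg => hl g (List.mem_cons_of_mem _ hg)
    have hf := hl f List.mem_cons_self
    have hb : ∀ τ ∈ Icc (0 : ℝ) 1, ‖f τ * iterInt l τ‖ ≤
        C * (‖(1 : 𝔄)‖ * (C * τ) ^ l.length / l.length.factorial) := fun τ hτ =>
      (norm_mul_le _ _).trans
        (mul_le_mul (hf.bound τ hτ) (ih.2 τ hτ) (norm_nonneg _) hC)
    constructor
    · refine (LipDeriv.primitive (C := C * (‖(1 : 𝔄)‖ * C ^ l.length / l.length.factorial))
        zero_le_one ?_
        (hf.meas.mul (ih.1.aestronglyMeasurable measurableSet_Icc))).continuousOn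
      intro τ hτ
      refine (hb τ hτ).trans ?_
      have h1 : C * τ ≤ C := mul_le_of_le_one_right hC hτ.2
      have h0 : 0 ≤ C * τ := mul_nonneg hC hτ.1
      gcongr
    · intro t ht
      exact norm_integral_le_pow_succ hb ht

/-- The sequence of functions `a, …, a, B, a, …, a`. -/
def insertedList (a B : ℝ → 𝔄) (m n : ℕ) : List (ℝ → 𝔄) :=
  List.replicate m a ++ B :: List.replicate n a

lemma insertedList_coeff {B : ℝ → 𝔄} (ha : Coeff C a) (hB : Coeff C B) (m n : ℕ) :
    ∀ f ∈ insertedList a B m n, Coeff C f := by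
  intro f hf
  simp only [insertedList, List.mem_append, List.mem_replicate, List.mem_cons] at hf
  rcases hf with h | h | h
  · exact h.2 ▸ ha
  · exact h ▸ hB
  · exact h.2 ▸ ha

lemma norm_iterInt_insertedList_le {B : ℝ → 𝔄} (ha : Coeff C a) (hB : Coeff C B) (m n : ℕ)
    {t : ℝ} (ht : t ∈ Icc (0 : ℝ) 1) :
    ‖iterInt (insertedList a B m n) t‖ ≤
      ‖(1 : 𝔄)‖ * C * (C ^ m / m.factorial * (C ^ n / n.factorial)) := by
  have hC : 0 ≤ C := (norm_nonneg _).trans (ha.bound 0 (by simp))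
  refine ((iterInt_spec (insertedList_coeff ha hB m n) hC).2 t ht).trans ?_
  have hlen : (insertedList a B m n).length = m + n + 1 := by simp [insertedList]; ring
  rw [hlen]
  have h1 : C * t ≤ C := mul_le_of_le_one_right hC ht.2
  have h0 : 0 ≤ C * t := mul_nonneg hC ht.1
  -- Weakening 1 / (m + n + 1)! to 1 / (m! n!) makes the bound a product, so that the double series
  -- is dominated by a product of two exponential series.
  have h2 : ((m.factorial * n.factorial : ℕ) : ℝ) ≤ (m + n + 1).factorial := by
    exact_mod_cast (Nat.le_of_dvd (Nat.factorial_pos _)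
      (Nat.factorial_mul_factorial_dvd_factorial_add m n)).trans
      (Nat.factorial_le (Nat.le_succ _))
  calc _ ≤ ‖(1 : 𝔄)‖ * C ^ (m + n + 1) / ((m.factorial * n.factorial : ℕ) : ℝ) := by
        gcongr
    _ = _ := by push_cast; field_simp; ring

lemma summable_insertedList_bound (c C : ℝ) :
    Summable fun p : ℕ × ℕ => c * (C ^ p.1 / p.1.factorial * (C ^ p.2 / p.2.factorial)) := by
  refine Summable.mul_left c ?_
  exact summable_mul_of_summable_norm (Real.summable_pow_div_factorial C).norm
    (Real.summable_pow_div_factorial C).norm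

/-- The operator `(U, W) ↦ (a U, B U + a W)`. -/
def pairOp (a B : ℝ → 𝔄) (t : ℝ) : 𝔄 × 𝔄 →L[ℝ] 𝔄 × 𝔄 :=
  ((ContinuousLinearMap.mul ℝ 𝔄 (a t)).comp (ContinuousLinearMap.fst ℝ 𝔄 𝔄)).prod
    ((ContinuousLinearMap.mul ℝ 𝔄 (B t)).comp (ContinuousLinearMap.fst ℝ 𝔄 𝔄) +
      (ContinuousLinearMap.mul ℝ 𝔄 (a t)).comp (ContinuousLinearMap.snd ℝ 𝔄 𝔄))

lemma pairOp_apply (a B : ℝ → 𝔄) (t : ℝ) (p : 𝔄 × 𝔄) :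
    pairOp a B t p = (a t * p.1, B t * p.1 + a t * p.2) := rfl

lemma opCoeff_pairOp {B : ℝ → 𝔄} (ha : Coeff C a) (hB : Coeff C B) :
    OpCoeff (2 * C) (pairOp a B) where
  meas y hy := by
    have h := hy.aestronglyMeasurable (μ := volume) measurableSet_Icc
    simp only [pairOp_apply]
    exact (ha.meas.mul h.fst).prodMk ((hB.meas.mul h.fst).add (ha.meas.mul h.snd))
  bound t ht := by
    have hC : 0 ≤ C := (norm_nonneg _).trans (ha.bound 0 (by simp))
    refine ContinuousLinearMap.opNorm_le_bound _ (by positivity) fun p => ?_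
    rw [pairOp_apply, Prod.norm_def]
    have h1 := norm_fst_le p
    have h2 := norm_snd_le p
    have e1 : ‖a t * p.1‖ ≤ C * ‖p‖ := (norm_mul_le _ _).trans
      (mul_le_mul (ha.bound t ht) h1 (norm_nonneg _) hC)
    have e2 : ‖a t * p.2‖ ≤ C * ‖p‖ := (norm_mul_le _ _).trans
      (mul_le_mul (ha.bound t ht) h2 (norm_nonneg _) hC)
    have e3 : ‖B t * p.1‖ ≤ C * ‖p‖ := (norm_mul_le _ _).trans
      (mul_le_mul (hB.bound t ht) h1 (norm_nonneg _) hC)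
    have e4 := norm_add_le (B t * p.1) (a t * p.2)
    have e5 : 0 ≤ C * ‖p‖ := by positivity
    exact max_le (by linarith) (by linarith)

/-- Picard iterates are sums of words in the coefficients. A word of the second component contains
exactly one letter B, so with k + 1 letters it has k letters a, distributed before and after B. The
induction splits according to whether the first letter is B, which is the decomposition of the
antidiagonal of k + 1. -/
lemma picard_pairOp {B : ℝ → 𝔄} (ha : Coeff C a) (hB : Coeff C B) (k : ℕ) :
    ∀ t ∈ Icc (0 : ℝ) 1, (picard (pairOp a B) (1, 0) k t).1 = iterInt (List.replicate k a) t ∧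
      (picard (pairOp a B) (1, 0) (k + 1) t).2 =
        ∑ p ∈ Finset.HasAntidiagonal.antidiagonal k, iterInt (insertedList a B p.1 p.2) t := by
  have hΛ := opCoeff_pairOp ha hB
  have hint : ∀ k, ∀ t ∈ Icc (0 : ℝ) 1, IntervalIntegrable
      (fun τ => pairOp a B τ (picard (pairOp a B) (1, 0) k τ)) volume 0 t := by
    intro k t ht
    have h1 := (picard_spec hΛ (1, 0) k).1
    obtain ⟨M, hM⟩ := isCompact_Icc.exists_bound_of_continuousOn h1
    have hC : 0 ≤ 2 * C := (norm_nonneg _).trans (hΛ.bound 0 (by simp))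
    refine ((LipDeriv.primitive (C := 2 * C * M) zero_le_one ?_
      (hΛ.meas _ h1)).mono le_rfl ht.2).intervalIntegrable ht.1
    exact fun τ hτ => (ContinuousLinearMap.le_opNorm _ _).trans
      (mul_le_mul (hΛ.bound τ hτ) (hM τ hτ) (norm_nonneg _) hC)
  have hfst : ∀ k, ∀ t ∈ Icc (0 : ℝ) 1,
      (picard (pairOp a B) (1, 0) k t).1 = iterInt (List.replicate k a) t := by
    intro k
    induction k with
    | zero => exact fun _ _ => rfl
    | succ k ih =>
      intro t ht
      have := (ContinuousLinearMap.fst ℝ 𝔄 𝔄).intervalIntegral_comp_comm (hint k t ht)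
      change (ContinuousLinearMap.fst ℝ 𝔄 𝔄) (∫ τ in 0..t, _) = _
      rw [← this, List.replicate_succ, iterInt]
      refine intervalIntegral.integral_congr fun τ hτ => ?_
      rw [uIcc_of_le ht.1] at hτ
      simp [pairOp_apply, ih τ ⟨hτ.1, hτ.2.trans ht.2⟩]
  have hI : ∀ p : ℕ × ℕ, ∀ t ∈ Icc (0 : ℝ) 1, IntervalIntegrable
      (fun τ => a τ * iterInt (insertedList a B p.1 p.2) τ) volume 0 t := by
    intro p t ht
    have hC : 0 ≤ C := (norm_nonneg _).trans (ha.bound 0 (by simp))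
    have h1 := (iterInt_spec (insertedList_coeff ha hB p.1 p.2) hC).1
    obtain ⟨M, hM⟩ := isCompact_Icc.exists_bound_of_continuousOn h1
    refine ((LipDeriv.primitive (C := C * M) zero_le_one ?_
      (ha.meas.mul (h1.aestronglyMeasurable measurableSet_Icc))).mono le_rfl
        ht.2).intervalIntegrable ht.1
    exact fun τ hτ => (norm_mul_le _ _).trans
      (mul_le_mul (ha.bound τ hτ) (hM τ hτ) (norm_nonneg _) hC)
  have hB' : ∀ k, ∀ t ∈ Icc (0 : ℝ) 1, IntervalIntegrable
      (fun τ => B τ * iterInt (List.replicate k a) τ) volume 0 t := by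
    intro k t ht
    have hC : 0 ≤ C := (norm_nonneg _).trans (ha.bound 0 (by simp))
    have h1 := (iterInt_spec (C := C) (l := List.replicate k a) (by
      intro f hf; rw [List.mem_replicate] at hf; exact hf.2 ▸ ha) hC).1
    obtain ⟨M, hM⟩ := isCompact_Icc.exists_bound_of_continuousOn h1
    refine ((LipDeriv.primitive (C := C * M) zero_le_one ?_
      (hB.meas.mul (h1.aestronglyMeasurable measurableSet_Icc))).mono le_rfl
        ht.2).intervalIntegrable ht.1
    exact fun τ hτ => (norm_mul_le _ _).trans
      (mul_le_mul (hB.bound τ hτ) (hM τ hτ) (norm_nonneg _) hC)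
  refine fun t ht => ⟨hfst k t ht, ?_⟩
  induction k generalizing t with
  | zero =>
    have := (ContinuousLinearMap.snd ℝ 𝔄 𝔄).intervalIntegral_comp_comm (hint 0 t ht)
    change (ContinuousLinearMap.snd ℝ 𝔄 𝔄) (∫ τ in 0..t, _) = _
    rw [← this]
    simp [pairOp_apply, insertedList, iterInt, picard]
  | succ k ih =>
    have := (ContinuousLinearMap.snd ℝ 𝔄 𝔄).intervalIntegral_comp_comm (hint (k + 1) t ht)
    change (ContinuousLinearMap.snd ℝ 𝔄 𝔄) (∫ τ in 0..t, _) = _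
    rw [← this, Finset.Nat.antidiagonal_succ, Finset.sum_cons, Finset.sum_map]
    have e : ∫ τ in 0..t, (ContinuousLinearMap.snd ℝ 𝔄 𝔄)
          (pairOp a B τ (picard (pairOp a B) (1, 0) (k + 1) τ)) =
        ∫ τ in 0..t, (B τ * iterInt (List.replicate (k + 1) a) τ +
          ∑ p ∈ Finset.HasAntidiagonal.antidiagonal k, a τ * iterInt (insertedList a B p.1 p.2) τ) := by
      refine intervalIntegral.integral_congr fun τ hτ => ?_
      rw [uIcc_of_le ht.1] at hτ
      have hτ' : τ ∈ Icc (0 : ℝ) 1 := ⟨hτ.1, hτ.2.trans ht.2⟩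
      simp only [pairOp_apply, ContinuousLinearMap.coe_snd', hfst (k + 1) τ hτ', ih τ hτ',
        Finset.mul_sum]
    rw [e, intervalIntegral.integral_add (hB' _ t ht), intervalIntegral.integral_finsetSum]
    · rfl
    · exact fun p _ => hI p t ht
    · simpa only [Finset.sum_fn] using! IntervalIntegrable.sum (Finset.HasAntidiagonal.antidiagonal k)
        (fun p _ => hI p t ht)

/-- The sum of all iterated integrals with one factor `B` and all others equal to `a`, by
variation of constants. -/
theorem hasSum_iterInt_insertedList [FiniteDimensional ℝ 𝔄] {B : ℝ → 𝔄}
    (ha : Coeff C a) (hB : Coeff C B) :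
    HasSum (fun p : ℕ × ℕ => iterInt (insertedList a B p.1 p.2) 1)
      (transport a 1 * ∫ t in (0 : ℝ)..1, transportInv a t * B t * transport a t) := by
  have h1 : (1 : ℝ) ∈ Icc (0 : ℝ) 1 := by simp
  have hΛ := opCoeff_pairOp ha hB
  set y := flow (pairOp a B) (1, 0) with hy
  have hly := lipDeriv_flow hΛ (1, 0)
  have hyU : ∀ t ∈ Icc (0 : ℝ) 1, (y t).1 = transport a t := by
    intro t ht
    have := eq_transport_mul ha (y := fun t => (y t).1) (hly.clm (ContinuousLinearMap.fst ℝ 𝔄 𝔄)) ht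
    rw [this, hy, flow_zero, mul_one]
  have hW := hly.clm (ContinuousLinearMap.snd ℝ 𝔄 𝔄)
  -- Variation of constants: in the derivative of K W, with K the inverse transport, the term K a W
  -- cancels against K' W and only K B U remains.
  have hKW := ((lipDeriv_transportInv ha).mul hW).integral_eq zero_le_one
  have hW0 : (y 0).2 = 0 := by rw [hy, flow_zero]
  have hW1 : (y 1).2 =
      transport a 1 * ∫ t in (0 : ℝ)..1, transportInv a t * B t * transport a t := by
    have e : ∫ t in (0 : ℝ)..1, transportInv a t * B t * transport a t =
        transportInv a 1 * (y 1).2 := by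
      refine Eq.trans ?_ (hKW.trans ?_)
      · refine intervalIntegral.integral_congr fun t ht => ?_
        rw [uIcc_of_le zero_le_one] at ht
        simp only [pairOp_apply, ContinuousLinearMap.coe_snd', ← hy, hyU t ht]
        noncomm_ring
      · simp only [ContinuousLinearMap.coe_snd', ← hy, hW0, mul_zero, sub_zero]
    rw [e, ← mul_assoc, transport_mul_inv ha h1, one_mul]
  rw [← hW1]
  have hs : Summable fun p : ℕ × ℕ => iterInt (insertedList a B p.1 p.2) 1 :=
    Summable.of_norm_bounded (summable_insertedList_bound _ C)
      fun p => norm_iterInt_insertedList_le ha hB p.1 p.2 h1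
  have hsum := ((hasSum_flow hΛ (1, 0) h1).mapL (ContinuousLinearMap.snd ℝ 𝔄 𝔄))
  have h2 := hsum.summable.tsum_eq_zero_add
  rw [hsum.tsum_eq] at h2
  have h3 : (y 1).2 = ∑' k, ∑ p ∈ Finset.HasAntidiagonal.antidiagonal k, iterInt (insertedList a B p.1 p.2) 1 := by
    refine h2.trans ?_
    simp only [ContinuousLinearMap.coe_snd', (picard_pairOp ha hB _ 1 h1).2]
    simp [picard]
  -- The Picard series is ordered by total degree; absolute convergence permits the regrouping into
  -- a double series.
  have h4 : ∑' k, ∑ p ∈ Finset.HasAntidiagonal.antidiagonal k,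
      iterInt (insertedList a B p.1 p.2) 1 = ∑' p : ℕ × ℕ, iterInt (insertedList a B p.1 p.2) 1 := by
    conv_lhs => congr; ext; rw [← Finset.sum_finset_coe, ← tsum_fintype (L := .unconditional _)]
    rw [← Finset.HasAntidiagonal.sigmaAntidiagonalEquivProd.tsum_eq]
    exact (((Finset.HasAntidiagonal.sigmaAntidiagonalEquivProd (A := ℕ)).summable_iff.2 hs).tsum_sigma'
      fun n => (hasSum_fintype _).summable).symm
  rw [h3, h4]
  exact hs.hasSum

lemma transport_mem {S : Submodule ℝ 𝔄} (hS : IsClosed (S : Set 𝔄)) (h1 : (1 : 𝔄) ∈ S)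
    (hmul : ∀ x ∈ S, ∀ y ∈ S, x * y ∈ S) (ha : ∀ t ∈ Icc (0 : ℝ) 1, a t ∈ S) {t : ℝ}
    (ht : t ∈ Icc (0 : ℝ) 1) : transport a t ∈ S ∧ transportInv a t ∈ S :=
  ⟨flow_mem hS (fun t ht _ hy => hmul _ (ha t ht) _ hy) h1 ht,
    flow_mem hS (fun t ht _ hy => hmul _ hy _ (S.neg_mem (ha t ht))) h1 ht⟩

end Transport

/-! ### Evaluation of the wedge products -/

section Wedge

/-- Only the block of α² has length two, so exactly the blocks behind it are shifted by one place.
-/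
lemma coe_cast_finSigmaFinEquiv_omegaDeg (m n : ℕ) (i : Fin (m + n + 1))
    (a : Fin (omegaDeg m n i)) :
    ((Fin.cast (sum_omegaDeg m n) (finSigmaFinEquiv ⟨i, a⟩) : Fin (m + n + 1 + 1)) : ℕ) =
      i + (if m < i then 1 else 0) + a := by
  rw [Fin.val_cast, finSigmaFinEquiv_apply]
  congr 1
  have h : ∀ j : Fin i, omegaDeg m n (Fin.castLE i.2.le j) = 1 + if (j : ℕ) = m then 1 else 0 := by
    intro j
    simp only [omegaDeg, Fin.val_castLE]
    split_ifs <;> rfl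
  simp only [h, Finset.sum_add_distrib]
  congr 1
  · simp
  · rw [Fin.sum_univ_eq_sum_range (fun j => if j = m then 1 else 0)]
    simp

variable {W A : Type*} [Ring A] [Algebra ℝ A]

/-- The only permutations that contribute to the pairing of the wedge product with a frame
in which each factor sees its own vector and the last one. -/
lemma superWedge_omegaDeg (m n : ℕ) (θ : ∀ i : Fin (m + n + 1), (Fin (omegaDeg m n i) → W) → A)
    (e : Fin (m + n + 1 + 1) → W) (x : Fin (m + n + 1) → A)
    (h0 : ∀ i (u : Fin (omegaDeg m n i) → Fin (m + n + 1 + 1)),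
      (∃ a, u a ≠ i.castSucc ∧ u a ≠ Fin.last _) → θ i (fun a => e (u a)) = 0)
    (hx : ∀ i (u : Fin (omegaDeg m n i) → Fin (m + n + 1 + 1)),
      (∀ a, u a = if (a : ℕ) = 0 then i.castSucc else Fin.last _) → θ i (fun a => e (u a)) = x i)
    (hx' : ∀ i (u : Fin (omegaDeg m n i) → Fin (m + n + 1 + 1)), (i : ℕ) = m →
      (∀ a, u a = if (a : ℕ) = 0 then Fin.last _ else i.castSucc) →
        θ i (fun a => e (u a)) = - x i) :
    superWedge (omegaDeg m n) (sum_omegaDeg m n) θ e = (List.ofFn x).prod := by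
  classical
  set pos : (i : Fin (m + n + 1)) → Fin (omegaDeg m n i) → Fin (m + n + 1 + 1) :=
    fun i a => Fin.cast (sum_omegaDeg m n) (finSigmaFinEquiv ⟨i, a⟩) with hpos
  have hposv : ∀ i a, (pos i a : ℕ) = i + (if m < i then 1 else 0) + a :=
    coe_cast_finSigmaFinEquiv_omegaDeg m n
  set p1 : Fin (m + n + 1 + 1) := ⟨m + 1, by omega⟩ with hp1
  set p0 : Fin (m + n + 1 + 1) := ⟨m, by omega⟩ with hp0
  -- Position m + 1 is the second slot of α². This permutation puts the last frame vector ∂/∂s there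
  -- and moves the later positions back by one; it is a cycle of length n + 1, hence has sign (-1)ⁿ.
  set σ₀ : Equiv.Perm (Fin (m + n + 1 + 1)) := (Fin.cycleIcc p1 (Fin.last _))⁻¹ with hσ₀
  have hle : p1 ≤ Fin.last _ := Fin.le_last _
  have s_lt : ∀ j : Fin (m + n + 1 + 1), (j : ℕ) ≤ m → σ₀ j = j := by
    intro j hj
    rw [hσ₀, Equiv.Perm.inv_eq_iff_eq, Fin.cycleIcc_of_lt]
    rw [Fin.lt_def, hp1]; simp; omega
  have s_p1 : σ₀ p1 = Fin.last _ := by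
    rw [hσ₀, Equiv.Perm.inv_eq_iff_eq, Fin.cycleIcc_of_last hle]
  have s_gt : ∀ j : Fin (m + n + 1), m < (j : ℕ) → σ₀ j.succ = j.castSucc := by
    intro j hj
    rw [hσ₀, Equiv.Perm.inv_eq_iff_eq, Fin.cycleIcc_of_ge_of_lt]
    · ext; simp
    · rw [Fin.le_def]; simp [hp1]; omega
    · exact Fin.castSucc_lt_last j
  have hd1 : ∀ i : Fin (m + n + 1), (i : ℕ) ≠ m → omegaDeg m n i = 1 := fun i hi => by
    simp [omegaDeg, hi]
  have hd2 : ∀ i : Fin (m + n + 1), (i : ℕ) = m → omegaDeg m n i = 2 := fun i hi => by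
    simp [omegaDeg, hi]
  set q : Fin (m + n + 1) := ⟨m, by omega⟩ with hq
  have hσpos : ∀ i (a : Fin (omegaDeg m n i)), σ₀ (pos i a) =
      if (a : ℕ) = 0 then i.castSucc else Fin.last _ := by
    intro i a
    by_cases hi : (i : ℕ) = m
    · have ha : (a : ℕ) < 2 := a.2.trans_eq (hd2 i hi)
      by_cases h : (a : ℕ) = 0
      · rw [if_pos h, s_lt _ (by rw [hposv]; simp [hi, h])]
        ext; rw [hposv]; simp [hi, h]
      · rw [if_neg h, ← s_p1]
        congr 1
        ext; rw [hposv]; simp [hp1, hi]; omega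
    · have ha : (a : ℕ) = 0 := Nat.lt_one_iff.1 (a.2.trans_eq (hd1 i hi))
      rw [if_pos ha]
      rcases lt_or_gt_of_ne hi with h | h
      · have hnot : ¬ m < (i : ℕ) := by omega
        rw [s_lt _ (by rw [hposv, if_neg hnot]; omega)]
        ext; rw [hposv, if_neg hnot, ha]; rfl
      · rw [← s_gt i h]
        congr 1
        ext; rw [hposv]; simp [ha, h]
  have hne01 : p0 ≠ p1 := by simp [hp0, hp1]
  set f : Equiv.Perm (Fin (m + n + 1 + 1)) → A := fun σ =>
    ((Equiv.Perm.sign σ : ℤ) : ℝ) • (List.ofFn fun i => θ i fun a => e (σ (pos i a))).prod with hf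
  have hf0 : f σ₀ = ((-1 : ℝ) ^ n) • (List.ofFn x).prod := by
    have hsign : Equiv.Perm.sign σ₀ = (-1) ^ n := by
      rw [hσ₀, Equiv.Perm.sign_inv, Fin.sign_cycleIcc_of_le hle]
      congr 1
      simp only [hp1, Fin.val_last]; omega
    simp only [hf, hsign]
    congr 2
    · simp
    · congr 1; ext i
      exact hx i _ (hσpos i)
  have hposq : ∀ i (a : Fin (omegaDeg m n i)), (i : ℕ) ≠ m → pos i a ≠ p0 ∧ pos i a ≠ p1 := by
    intro i a hi
    have ha : (a : ℕ) = 0 := Nat.lt_one_iff.1 (a.2.trans_eq (hd1 i hi))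
    constructor <;> intro h <;> have := congrArg Fin.val h <;> rw [hposv] at this <;>
      simp only [hp0, hp1, ha] at this <;> split_ifs at this <;> omega
  -- Exchanging the two slots of α² changes the sign of the permutation and the sign of the value,
  -- so both summands are equal.
  have hf1 : f (σ₀ * Equiv.swap p0 p1) = ((-1 : ℝ) ^ n) • (List.ofFn x).prod := by
    have hsign : Equiv.Perm.sign (σ₀ * Equiv.swap p0 p1) = -(-1) ^ n := by
      rw [Equiv.Perm.sign_mul, Equiv.Perm.sign_swap hne01, hσ₀, Equiv.Perm.sign_inv,
        Fin.sign_cycleIcc_of_le hle]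
      have : ((Fin.last (m + n + 1) : ℕ) - (p1 : ℕ)) = n := by simp only [hp1, Fin.val_last]; omega
      rw [this]; simp
    have hlist : (List.ofFn fun i => θ i fun a => e ((σ₀ * Equiv.swap p0 p1) (pos i a))) =
        (List.ofFn x).set m (- x q) := by
      refine List.ext_getElem (by simp) fun j h1 h2 => ?_
      simp only [List.length_ofFn] at h1
      rw [List.getElem_ofFn, List.getElem_set]
      by_cases hj : m = j
      · subst hj
        rw [if_pos rfl]
        refine hx' q _ rfl fun a => ?_
        have ha : (a : ℕ) < 2 := a.2.trans_eq (hd2 q rfl)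
        by_cases h : (a : ℕ) = 0
        · rw [if_pos h]
          have : pos q a = p0 := by ext; rw [hposv]; simp [hp0, hq, h]
          rw [this, Equiv.Perm.mul_apply, Equiv.swap_apply_left, s_p1]
        · rw [if_neg h]
          have : pos q a = p1 := by ext; rw [hposv]; simp [hp1, hq]; omega
          rw [this, Equiv.Perm.mul_apply, Equiv.swap_apply_right, s_lt p0 le_rfl]
          rfl
      · rw [if_neg hj, List.getElem_ofFn]
        refine hx _ _ fun a => ?_
        have := hposq ⟨j, h1⟩ a (fun h => hj h.symm)
        rw [Equiv.Perm.mul_apply, Equiv.swap_apply_of_ne_of_ne this.1 this.2]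
        exact hσpos _ a
    have hprod : ((List.ofFn x).set m (- x q)).prod = -(List.ofFn x).prod := by
      have hl : m < (List.ofFn x).length := by rw [List.length_ofFn]; omega
      rw [List.prod_set, if_pos hl]
      conv_rhs => rw [← List.prod_take_mul_prod_drop (List.ofFn x) m,
        List.drop_eq_getElem_cons hl, List.prod_cons]
      have hxm : (List.ofFn x)[m] = x q := by rw [List.getElem_ofFn]
      rw [hxm]
      noncomm_ring
    simp only [hf, hsign, hlist, hprod]
    simp
  have hsum : ∑ σ, f σ = f σ₀ + f (σ₀ * Equiv.swap p0 p1) := by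
    refine Finset.sum_eq_add σ₀ (σ₀ * Equiv.swap p0 p1) ?_ ?_ (by simp) (by simp)
    · intro h
      have := congrArg (fun τ : Equiv.Perm _ => (σ₀⁻¹ * τ) p0) h
      simp at this
      exact hne01 this
    -- If a summand does not vanish, each block sees only its own vector and the last one. The two
    -- slots of α² receive distinct vectors, so one of them takes the last vector, and every other
    -- block is left with its own. Only the two permutations above do this.
    · rintro σ - ⟨hσ1, hσ2⟩
      by_contra hne
      have hfac : ∀ i, ∀ a, σ (pos i a) = i.castSucc ∨ σ (pos i a) = Fin.last _ := by
        intro i a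
        by_contra hcon
        push Not at hcon
        apply hne
        simp only [hf]
        rw [List.prod_eq_zero, smul_zero]
        rw [List.mem_ofFn]
        exact ⟨i, h0 i _ ⟨a, hcon⟩⟩
      have hq0 : pos q ⟨0, by rw [hd2 q rfl]; norm_num⟩ = p0 := by
        ext; rw [hposv]; simp [hp0, hq]
      have hq1 : pos q ⟨1, by rw [hd2 q rfl]; norm_num⟩ = p1 := by
        ext; rw [hposv]; simp [hp1, hq]
      have f0 := hfac q ⟨0, by rw [hd2 q rfl]; norm_num⟩
      have f1 := hfac q ⟨1, by rw [hd2 q rfl]; norm_num⟩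
      rw [hq0] at f0
      rw [hq1] at f1
      have hσne : σ p0 ≠ σ p1 := fun h => hne01 (σ.injective h)
      have hlast : σ p0 = Fin.last _ ∨ σ p1 = Fin.last _ := by
        rcases f0 with h | h
        · rcases f1 with h' | h'
          · exact absurd (h.trans h'.symm) hσne
          · exact Or.inr h'
        · exact Or.inl h
      have hother : ∀ i (a : Fin (omegaDeg m n i)), (i : ℕ) ≠ m →
          σ (pos i a) = i.castSucc := by
        intro i a hi
        rcases hfac i a with h | h
        · exact h
        · exfalso
          have h3 := hposq i a hi
          rcases hlast with h' | h'
          · exact h3.1 (σ.injective (h.trans h'.symm))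
          · exact h3.2 (σ.injective (h.trans h'.symm))
      have hsurj : ∀ j : Fin (m + n + 1 + 1), j ≠ p0 → j ≠ p1 →
          ∃ i, ∃ a : Fin (omegaDeg m n i), (i : ℕ) ≠ m ∧ pos i a = j := by
        intro j hj0 hj1
        have hj0' : (j : ℕ) ≠ m := fun h => hj0 (Fin.ext h)
        have hj1' : (j : ℕ) ≠ m + 1 := fun h => hj1 (Fin.ext h)
        by_cases hj : (j : ℕ) < m
        · refine ⟨⟨j, by omega⟩, ⟨0, by rw [hd1 _ hj0']; norm_num⟩, hj0', ?_⟩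
          ext; rw [hposv]; simp; omega
        · have hjm : (j : ℕ) - 1 ≠ m := by omega
          have hj2 := j.2
          refine ⟨⟨j - 1, by omega⟩, ⟨0, by rw [hd1 _ hjm]; norm_num⟩, hjm, ?_⟩
          ext; rw [hposv]; simp only; rw [if_pos (by omega)]; omega
      rcases hlast with h | h
      · have h' : σ p1 = q.castSucc := f1.resolve_right fun h' => hσne (h.trans h'.symm)
        apply hσ2
        ext1 j
        by_cases hj0 : j = p0
        · rw [hj0, Equiv.Perm.mul_apply, Equiv.swap_apply_left, s_p1, h]
        by_cases hj1 : j = p1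
        · rw [hj1, Equiv.Perm.mul_apply, Equiv.swap_apply_right, s_lt p0 le_rfl, h']; rfl
        obtain ⟨i, a, hi, rfl⟩ := hsurj j hj0 hj1
        have ha : (a : ℕ) = 0 := Nat.lt_one_iff.1 (a.2.trans_eq (hd1 i hi))
        rw [hother i a hi, Equiv.Perm.mul_apply, Equiv.swap_apply_of_ne_of_ne hj0 hj1, hσpos,
          if_pos ha]
      · have h' : σ p0 = q.castSucc := f0.resolve_right fun h' => hσne (h'.trans h.symm)
        apply hσ1
        ext1 j
        by_cases hj0 : j = p0
        · rw [hj0, s_lt p0 le_rfl, h']; rfl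
        by_cases hj1 : j = p1
        · rw [hj1, s_p1, h]
        obtain ⟨i, a, hi, rfl⟩ := hsurj j hj0 hj1
        have ha : (a : ℕ) = 0 := Nat.lt_one_iff.1 (a.2.trans_eq (hd1 i hi))
        rw [hother i a hi, hσpos, if_pos ha]
  -- Koszul sign: α² alone has nonzero endomorphism degree, namely -1, and it passes n one-forms.
  -- The resulting (-1)ⁿ cancels the sign of `σ₀`.
  have hK : (∏ i : Fin (m + n + 1), ∏ j ∈ Finset.Ioi i,
      (-1 : ℝ) ^ ((1 - (omegaDeg m n i : ℤ)) * (omegaDeg m n j : ℤ))) = (-1) ^ n := by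
    rw [Finset.prod_eq_single q]
    · rw [Finset.prod_congr rfl (g := fun _ => (-1 : ℝ))]
      · rw [Finset.prod_const, Fin.card_Ioi]
        congr 1
        simp [hq]
      · intro j hj
        rw [Finset.mem_Ioi, Fin.lt_def] at hj
        rw [hd2 q rfl, hd1 j (by simp only [hq] at hj; omega)]
        norm_num
    · intro i _ hi
      refine Finset.prod_eq_one fun j _ => ?_
      rw [hd1 i (fun h => hi (Fin.ext h))]
      simp
    · simp
  -- The factor 2! from α² compensates for the two equal summands.
  have hfact : (∏ i : Fin (m + n + 1), ((omegaDeg m n i).factorial : ℝ)) = 2 := by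
    rw [Finset.prod_eq_single q]
    · rw [hd2 q rfl]; norm_num
    · intro i _ hi
      rw [hd1 i (fun h => hi (Fin.ext h))]
      simp
    · simp
  have hpm : ((-1 : ℝ) ^ n) * (-1) ^ n = 1 := by rw [← mul_pow]; simp
  change (_ * _) • ∑ σ, f σ = _
  rw [hsum, hf0, hf1, hK, hfact, ← two_smul ℝ, smul_smul, smul_smul]
  rw [show (-1 : ℝ) ^ n * 2⁻¹ * 2 * (-1) ^ n = ((-1 : ℝ) ^ n) * (-1) ^ n by ring, hpm, one_smul]

end Wedge

/-! ### The integrand as an ordered product of pullbacks -/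

section Density

variable {E : Type*} [NormedAddCommGroup E] [NormedSpace ℝ E]
  {M : Type*} [TopologicalSpace M] [ChartedSpace E M]
  {V : Type*} [NormedAddCommGroup V] [NormedSpace ℝ V] [FiniteDimensional ℝ V]
  {C : GradedComplex V}

/-- The partial derivatives of `G`. -/
def partialDeriv (E : Type*) [NormedAddCommGroup E] [NormedSpace ℝ E]
    {M : Type*} [TopologicalSpace M] [ChartedSpace E M] (G : ℝ × ℝ → M) (p w : ℝ × ℝ) :
    TangentSpace 𝓘(ℝ, E) (G p) :=
  mfderiv 𝓘(ℝ, ℝ × ℝ) 𝓘(ℝ, E) G p w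

/-- The pullback of `α¹` along `G`, evaluated at `p` on `w`. -/
def pullOne (α : FlatSuperconnection E M C) (G : ℝ × ℝ → M) (p w : ℝ × ℝ) : V →L[ℝ] V :=
  α.form 1 (G p) fun _ => partialDeriv E G p w

/-- The coefficient of the pullback of `α²` along `G`. -/
def pullTwo (α : FlatSuperconnection E M C) (G : ℝ × ℝ → M) (p : ℝ × ℝ) : V →L[ℝ] V :=
  α.form 2 (G p) ![partialDeriv E G p (1, 0), partialDeriv E G p (0, 1)]

lemma form_of_degree_one (α : FlatSuperconnection E M C) (x : M) (v w : TangentSpace 𝓘(ℝ, E) x)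
    {d : ℕ} (h : d = 1) :
    α.form d x (fun a => if (a : ℕ) = 0 then v else w) = α.form 1 x fun _ => v := by
  subst h
  congr 1
  ext a
  simp

lemma form_of_degree_two (α : FlatSuperconnection E M C) (x : M) (v w : TangentSpace 𝓘(ℝ, E) x)
    {d : ℕ} (h : d = 2) :
    α.form d x (fun a => if (a : ℕ) = 0 then v else w) = α.form 2 x ![v, w] := by
  subst h
  congr 1
  ext a
  fin_cases a <;> rfl

lemma form_of_degree_two_swap (α : FlatSuperconnection E M C) (x : M)
    (v w : TangentSpace 𝓘(ℝ, E) x) {d : ℕ} (h : d = 2) :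
    α.form d x (fun a => if (a : ℕ) = 0 then w else v) =
      -α.form d x (fun a => if (a : ℕ) = 0 then v else w) := by
  subst h
  refine Eq.trans ?_ ((α.form 2 x).toAlternatingMap.map_swap
    (fun a => if (a : ℕ) = 0 then v else w) (show (0 : Fin 2) ≠ 1 by decide))
  refine congrArg (α.form 2 x) ?_
  ext a
  fin_cases a <;> simp

lemma mfderiv_frame {G : ℝ × ℝ → M} {k : ℕ} {x : (Fin k → ℝ) × ℝ} {i : Fin k}
    (hG : MDifferentiableAt 𝓘(ℝ, ℝ × ℝ) 𝓘(ℝ, E) G (x.1 i, x.2)) (w : (Fin k → ℝ) × ℝ) :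
    mfderiv 𝓘(ℝ, (Fin k → ℝ) × ℝ) 𝓘(ℝ, E) (fun y : (Fin k → ℝ) × ℝ => G (y.1 i, y.2)) x w =
      partialDeriv E G (x.1 i, x.2) (w.1 i, w.2) := by
  let L : (Fin k → ℝ) × ℝ →L[ℝ] ℝ × ℝ :=
    ((ContinuousLinearMap.proj i).comp (ContinuousLinearMap.fst ℝ (Fin k → ℝ) ℝ)).prod
      (ContinuousLinearMap.snd ℝ (Fin k → ℝ) ℝ)
  have h1 : (fun y : (Fin k → ℝ) × ℝ => G (y.1 i, y.2)) = G ∘ L := rfl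
  rw [h1]
  have h2 := mfderiv_comp (I := 𝓘(ℝ, (Fin k → ℝ) × ℝ)) (I' := 𝓘(ℝ, ℝ × ℝ)) (I'' := 𝓘(ℝ, E))
    x (g := G) (f := L) hG L.differentiableAt.mdifferentiableAt
  rw [h2]
  have h3 : mfderiv 𝓘(ℝ, (Fin k → ℝ) × ℝ) 𝓘(ℝ, ℝ × ℝ) L x = L := by
    rw [mfderiv_eq_fderiv]; exact L.fderiv
  change (mfderiv 𝓘(ℝ, ℝ × ℝ) 𝓘(ℝ, E) G (L x)) (mfderiv 𝓘(ℝ, (Fin k → ℝ) × ℝ) 𝓘(ℝ, ℝ × ℝ) L x w) = _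
  rw [h3]
  rfl

/-- Where `G` is differentiable, the integrand is a product of pullbacks. -/
lemma omegaDensity_eq (α : FlatSuperconnection E M C) (G : ℝ × ℝ → M) (m n : ℕ)
    (x : (Fin (m + n + 1) → ℝ) × ℝ)
    (hG : ∀ i, MDifferentiableAt 𝓘(ℝ, ℝ × ℝ) 𝓘(ℝ, E) G (x.1 i, x.2)) :
    omegaDensity α G m n x = (List.ofFn fun i : Fin (m + n + 1) =>
      if (i : ℕ) = m then pullTwo α G (x.1 i, x.2) else pullOne α G (x.1 i, x.2) (1, 0)).prod := by
  have key : ∀ (i : Fin (m + n + 1)) (j : Fin (m + n + 1 + 1)),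
      mfderiv 𝓘(ℝ, (Fin (m + n + 1) → ℝ) × ℝ) 𝓘(ℝ, E)
        (fun y : (Fin (m + n + 1) → ℝ) × ℝ => G (y.1 i, y.2)) x (frame (m + n + 1) j) =
      partialDeriv E G (x.1 i, x.2) ((frame (m + n + 1) j).1 i, (frame (m + n + 1) j).2) :=
    fun i j => mfderiv_frame (hG i) _
  -- The map (t, s) ↦ (tᵢ, s) sends ∂/∂tᵢ to (1, 0), ∂/∂s to (0, 1) and the rest of the frame to 0.
  -- This is the situation of `superWedge_omegaDeg`.
  have k1 : ∀ i : Fin (m + n + 1), ((frame (m + n + 1) i.castSucc).1 i,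
      (frame (m + n + 1) i.castSucc).2) = ((1 : ℝ), (0 : ℝ)) := fun i => by simp [frame]
  have k2 : ∀ i : Fin (m + n + 1), ((frame (m + n + 1) (Fin.last _)).1 i,
      (frame (m + n + 1) (Fin.last _)).2) = ((0 : ℝ), (1 : ℝ)) := fun i => by simp [frame]
  have k3 : ∀ (i : Fin (m + n + 1)) (j : Fin (m + n + 1 + 1)), j ≠ i.castSucc → j ≠ Fin.last _ →
      ((frame (m + n + 1) j).1 i, (frame (m + n + 1) j).2) = (0 : ℝ × ℝ) := by
    intro i j hj hl
    obtain ⟨j, rfl⟩ := Fin.exists_castSucc_eq.2 hl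
    have : i ≠ j := fun h => hj (by rw [h])
    simp [frame, this]
  rw [omegaDensity, pulledBackOmega]
  apply superWedge_omegaDeg m n
  · rintro i u ⟨a, ha1, ha2⟩
    refine ContinuousAlternatingMap.map_coord_zero (α.form (omegaDeg m n i) (G (x.1 i, x.2))) a ?_
    rw [key, k3 i _ ha1 ha2]
    exact map_zero (mfderiv 𝓘(ℝ, ℝ × ℝ) 𝓘(ℝ, E) G (x.1 i, x.2))
  · intro i u hu
    have e : (fun a => mfderiv 𝓘(ℝ, (Fin (m + n + 1) → ℝ) × ℝ) 𝓘(ℝ, E)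
        (fun y : (Fin (m + n + 1) → ℝ) × ℝ => G (y.1 i, y.2)) x (frame (m + n + 1) (u a))) =
        fun a : Fin (omegaDeg m n i) => if (a : ℕ) = 0 then partialDeriv E G (x.1 i, x.2) (1, 0)
          else partialDeriv E G (x.1 i, x.2) (0, 1) := by
      ext a
      rw [key, hu a]
      split_ifs
      · rw [k1]
      · rw [k2]
    refine (congrArg (α.form (omegaDeg m n i) (G (x.1 i, x.2))) e).trans ?_
    split_ifs with hi
    · exact form_of_degree_two α _ _ _ (by simp [omegaDeg, hi])
    · exact form_of_degree_one α _ _ _ (by simp [omegaDeg, hi])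
  · intro i u hi hu
    have e : (fun a => mfderiv 𝓘(ℝ, (Fin (m + n + 1) → ℝ) × ℝ) 𝓘(ℝ, E)
        (fun y : (Fin (m + n + 1) → ℝ) × ℝ => G (y.1 i, y.2)) x (frame (m + n + 1) (u a))) =
        fun a : Fin (omegaDeg m n i) => if (a : ℕ) = 0 then partialDeriv E G (x.1 i, x.2) (0, 1)
          else partialDeriv E G (x.1 i, x.2) (1, 0) := by
      ext a
      rw [key, hu a]
      split_ifs
      · rw [k2]
      · rw [k1]
    have hd : omegaDeg m n i = 2 := by simp [omegaDeg, hi]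
    refine (congrArg (α.form (omegaDeg m n i) (G (x.1 i, x.2))) e).trans ?_
    rw [if_pos hi, form_of_degree_two_swap α _ _ _ hd, form_of_degree_two α _ _ _ hd]
    rfl

end Density

/-! ### Integrals over simplices -/

section Simplex

open Set

variable {𝔄 : Type*} [NormedRing 𝔄] [NormedAlgebra ℝ 𝔄] [CompleteSpace 𝔄]

/-- The simplex `{T ≥ t₁ ≥ ⋯ ≥ t_k ≥ 0}`. -/
def simplexUpTo (k : ℕ) (T : ℝ) : Set (Fin k → ℝ) := {t | Antitone t ∧ ∀ i, t i ∈ Icc (0 : ℝ) T}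

lemma orderedSimplex_eq (k : ℕ) : orderedSimplex k = simplexUpTo k 1 := rfl

lemma isClosed_simplexUpTo_prod (k : ℕ) (T : ℝ) :
    IsClosed {p : ℝ × (Fin k → ℝ) | p.1 ∈ Icc 0 T ∧ p.2 ∈ simplexUpTo k p.1} := by
  have h1 : IsClosed {p : ℝ × (Fin k → ℝ) | Antitone p.2} :=
    isClosed_antitone.preimage continuous_snd
  have h2 : ∀ i, IsClosed {p : ℝ × (Fin k → ℝ) | p.2 i ∈ Icc 0 p.1} := fun i =>
    (isClosed_le (f := fun _ => (0 : ℝ)) (g := fun p : ℝ × (Fin k → ℝ) => p.2 i)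
      (by fun_prop) (by fun_prop)).inter
      (isClosed_le (f := fun p : ℝ × (Fin k → ℝ) => p.2 i) (by fun_prop) continuous_fst)
  have h3 : IsClosed {p : ℝ × (Fin k → ℝ) | p.1 ∈ Icc 0 T} := isClosed_Icc.preimage continuous_fst
  have : {p : ℝ × (Fin k → ℝ) | p.1 ∈ Icc 0 T ∧ p.2 ∈ simplexUpTo k p.1} =
      {p | p.1 ∈ Icc 0 T} ∩ ({p | Antitone p.2} ∩ ⋂ i, {p | p.2 i ∈ Icc 0 p.1}) := by
    ext p; simp [simplexUpTo]
  rw [this]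
  exact h3.inter (h1.inter (isClosed_iInter h2))

lemma isClosed_simplexUpTo (k : ℕ) (T : ℝ) : IsClosed (simplexUpTo k T) := by
  have : simplexUpTo k T = {t | Antitone t} ∩ Set.pi univ fun _ => Icc 0 T := by
    ext p; simp only [simplexUpTo, mem_inter_iff, mem_pi, mem_univ, true_imp_iff]; rfl
  rw [this]
  exact isClosed_antitone.inter (isClosed_set_pi fun _ _ => isClosed_Icc)

lemma simplexUpTo_subset (k : ℕ) {T : ℝ} (hT : T ≤ 1) :
    simplexUpTo k T ⊆ Set.pi univ fun _ => Icc (0 : ℝ) 1 :=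
  fun _ ht i _ => ⟨(ht.2 i).1, (ht.2 i).2.trans hT⟩

lemma volume_simplexUpTo_lt_top (k : ℕ) {T : ℝ} (hT : T ≤ 1) : volume (simplexUpTo k T) < ⊤ :=
  (measure_mono (simplexUpTo_subset k hT)).trans_lt
    (isCompact_univ_pi fun _ => isCompact_Icc).measure_lt_top

lemma mem_simplexUpTo_succ {k : ℕ} {T : ℝ} (t : Fin (k + 1) → ℝ) :
    t ∈ simplexUpTo (k + 1) T ↔ t 0 ∈ Icc 0 T ∧ (fun i : Fin k => t i.succ) ∈ simplexUpTo k (t 0) := by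
  constructor
  · rintro ⟨h1, h2⟩
    refine ⟨h2 0, fun i j hij => h1 (Fin.succ_le_succ_iff.2 hij), fun i => ⟨(h2 _).1, h1 (Fin.zero_le _)⟩⟩
  · rintro ⟨h0, h1, h2⟩
    constructor
    · rw [Fin.antitone_iff_succ_le]
      intro i
      rcases k with - | k
      · exact i.elim0
      · refine Fin.cases ?_ (fun j => ?_) i
        · exact (h2 0).2
        · have := h1 (show j.castSucc ≤ j.succ from j.castSucc_lt_succ.le)
          simpa using this
    · intro i
      refine Fin.cases h0 (fun j => ?_) i
      exact ⟨(h2 j).1, (h2 j).2.trans h0.2⟩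

lemma norm_prod_ofFn_le {k : ℕ} {x : Fin k → 𝔄} {C : ℝ} (hx : ∀ i, ‖x i‖ ≤ C) (hC : 0 ≤ C) :
    ‖(List.ofFn x).prod‖ ≤ ‖(1 : 𝔄)‖ * C ^ k := by
  induction k with
  | zero => simp
  | succ k ih =>
    rw [List.ofFn_succ, List.prod_cons]
    refine (norm_mul_le _ _).trans ?_
    calc _ ≤ C * (‖(1 : 𝔄)‖ * C ^ k) :=
          mul_le_mul (hx 0) (ih fun i => hx i.succ) (norm_nonneg _) hC
      _ = _ := by ring

lemma stronglyMeasurable_prod_ofFn {Ω : Type*} [MeasurableSpace Ω] {k : ℕ} {x : Fin k → Ω → 𝔄}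
    (hx : ∀ i, StronglyMeasurable (x i)) :
    StronglyMeasurable fun z => (List.ofFn fun i => x i z).prod := by
  induction k with
  | zero => simpa using! stronglyMeasurable_const
  | succ k ih =>
    simp only [List.ofFn_succ, List.prod_cons]
    exact (hx 0).mul (ih fun i => hx i.succ)

lemma integrableOn_prod_ofFn {Ω : Type*} [MeasureSpace Ω] {k : ℕ} {x : Fin k → Ω → 𝔄}
    (hx : ∀ i, StronglyMeasurable (x i)) {C : ℝ} (hC : 0 ≤ C) (hb : ∀ i z, ‖x i z‖ ≤ C) {s : Set Ω}
    (hs : volume s < ⊤) :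
    IntegrableOn (fun z => (List.ofFn fun i => x i z).prod) s := by
  have : Fact (volume s < ⊤) := ⟨hs⟩
  exact Integrable.of_bound (stronglyMeasurable_prod_ofFn hx).aestronglyMeasurable _
    (Filter.Eventually.of_forall fun z => norm_prod_ofFn_le (fun i => hb i z) hC)

/-- Iterated integrals as integrals over simplices. -/
lemma integral_simplexUpTo {k : ℕ} {f : Fin k → ℝ → 𝔄} (hf : ∀ i, StronglyMeasurable (f i))
    {C : ℝ} (hC : 0 ≤ C) (hb : ∀ i t, ‖f i t‖ ≤ C) {T : ℝ} (hT : T ∈ Icc (0 : ℝ) 1) :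
    ∫ t in simplexUpTo k T, (List.ofFn fun i => f i (t i)).prod = iterInt (List.ofFn f) T := by
  induction k generalizing T with
  | zero =>
    have : simplexUpTo 0 T = univ := by
      ext t; simp [simplexUpTo, Subsingleton.antitone]
    simp [this, iterInt, Measure.real, volume_pi]
  | succ k ih =>
    -- The coordinate with index 0 is the largest; once it equals τ, the others range over the
    -- simplex with top τ. Fubini then reproduces the recursion defining `iterInt`.
    set e := MeasurableEquiv.piFinSuccAbove (fun _ : Fin (k + 1) => ℝ) 0
    set S : Set (ℝ × (Fin k → ℝ)) := {p | p.1 ∈ Icc 0 T ∧ p.2 ∈ simplexUpTo k p.1} with hS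
    have hSm : MeasurableSet S := (isClosed_simplexUpTo_prod k T).measurableSet
    set g : ℝ × (Fin k → ℝ) → 𝔄 := fun p => f 0 p.1 * (List.ofFn fun i => f i.succ (p.2 i)).prod
      with hg
    have he : MeasurePreserving e volume volume :=
      volume_preserving_piFinSuccAbove (fun _ : Fin (k + 1) => ℝ) 0
    have hpre : simplexUpTo (k + 1) T = e ⁻¹' S := by
      ext t; exact mem_simplexUpTo_succ t
    have hge : (fun t : Fin (k + 1) → ℝ => (List.ofFn fun i => f i (t i)).prod) =
        fun t => g (e t) := by
      ext t
      rw [List.ofFn_succ, List.prod_cons]; rfl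
    rw [hge, hpre, he.setIntegral_preimage_emb e.measurableEmbedding, ← integral_indicator hSm]
    have hgm : StronglyMeasurable g := by
      refine ((hf 0).comp_measurable measurable_fst).mul (stronglyMeasurable_prod_ofFn
        (x := fun i (p : ℝ × (Fin k → ℝ)) => f i.succ (p.2 i)) fun i => ?_)
      exact (hf i.succ).comp_measurable ((measurable_pi_apply i).comp measurable_snd)
    have hSfin : volume S < ⊤ := by
      refine (measure_mono (t := Icc 0 1 ×ˢ Set.pi univ fun _ => Icc (0 : ℝ) 1) ?_).trans_lt
        (isCompact_Icc.prod (isCompact_univ_pi fun _ => isCompact_Icc)).measure_lt_top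
      rintro p ⟨h1, h2⟩
      exact ⟨⟨h1.1, h1.2.trans hT.2⟩, simplexUpTo_subset k (h1.2.trans hT.2) h2⟩
    have hgi : IntegrableOn g S := by
      have : Fact (volume S < ⊤) := ⟨hSfin⟩
      refine Integrable.of_bound hgm.aestronglyMeasurable (C * (‖(1 : 𝔄)‖ * C ^ k))
        (Filter.Eventually.of_forall fun p => ?_)
      exact (norm_mul_le _ _).trans (mul_le_mul (hb 0 _)
        (norm_prod_ofFn_le (fun i => hb i.succ _) hC) (norm_nonneg _) hC)
    rw [Measure.volume_eq_prod, integral_prod _ ((integrable_indicator_iff hSm).2 hgi)]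
    rw [List.ofFn_succ, iterInt]
    beta_reduce
    rw [intervalIntegral.integral_of_le hT.1, ← integral_Icc_eq_integral_Ioc,
      ← integral_indicator measurableSet_Icc]
    refine integral_congr_ae (Filter.Eventually.of_forall fun τ => ?_)
    by_cases hτ : τ ∈ Icc 0 T
    · have hτ1 : τ ∈ Icc (0 : ℝ) 1 := ⟨hτ.1, hτ.2.trans hT.2⟩
      simp only
      rw [indicator_of_mem hτ]
      have e1 : (fun t => S.indicator g (τ, t)) = (simplexUpTo k τ).indicator
          fun t => f 0 τ * (List.ofFn fun i => f i.succ (t i)).prod := by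
        ext t
        by_cases ht : t ∈ simplexUpTo k τ
        · rw [indicator_of_mem ht, indicator_of_mem (show (τ, t) ∈ S from ⟨hτ, ht⟩)]
        · rw [indicator_of_notMem ht, indicator_of_notMem (fun h => ht h.2)]
      rw [e1, integral_indicator (isClosed_simplexUpTo k τ).measurableSet]
      have hi := integrableOn_prod_ofFn (x := fun i (t : Fin k → ℝ) => f i.succ (t i))
        (fun i => (hf i.succ).comp_measurable (measurable_pi_apply i)) hC (fun i _ => hb i.succ _)
        (volume_simplexUpTo_lt_top k hτ1.2)
      have := (ContinuousLinearMap.mul ℝ 𝔄 (f 0 τ)).integral_comp_comm hi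
      simp only [ContinuousLinearMap.mul_apply'] at this
      rw [this, ih (fun i => hf i.succ) (fun i => hb i.succ) hτ1]
    · simp only
      rw [indicator_of_notMem hτ]
      have e1 : (fun t => S.indicator g (τ, t)) = 0 := by
        ext t
        exact indicator_of_notMem (fun h => hτ h.1) _
      rw [e1]; simp

lemma ofFn_eq_insertedList (a B : ℝ → 𝔄) (m n : ℕ) :
    (List.ofFn fun i : Fin (m + n + 1) => if (i : ℕ) = m then B else a) = insertedList a B m n := by
  refine List.ext_getElem (by simp [insertedList]; ring) fun j h1 h2 => ?_
  simp only [List.getElem_ofFn, insertedList, List.getElem_append, List.getElem_cons,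
    List.length_replicate, List.getElem_replicate]
  split_ifs <;> first | rfl | omega

/-- The sign (-1)^(m+n) of the series is absorbed into the connection: the series describes the
transport U' = -a U. -/
lemma iterInt_insertedList_neg (a B : ℝ → 𝔄) (m n : ℕ) (t : ℝ) :
    iterInt (insertedList (fun t => -a t) B m n) t =
      (-1 : ℝ) ^ (m + n) • iterInt (insertedList a B m n) t := by
  have h1 : ∀ n t, iterInt (List.replicate n fun t => -a t) t =
      (-1 : ℝ) ^ n • iterInt (List.replicate n a) t := by
    intro n
    induction n with
    | zero => intro t; simp [iterInt]
    | succ n ih =>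
      intro t
      simp only [List.replicate_succ, iterInt, ih]
      rw [← intervalIntegral.integral_smul]
      congr 1; ext τ
      rw [mul_smul_comm, pow_succ, mul_smul, neg_mul]
      simp
  induction m generalizing t with
  | zero =>
    simp only [insertedList, List.replicate_zero, List.nil_append, iterInt, h1, zero_add]
    rw [← intervalIntegral.integral_smul]
    congr 1; ext τ
    rw [mul_smul_comm]
  | succ m ih =>
    simp only [insertedList] at ih
    simp only [insertedList, List.replicate_succ, List.cons_append, iterInt, ih]
    rw [← intervalIntegral.integral_smul]
    congr 1; ext τ
    rw [mul_smul_comm, show m + 1 + n = m + n + 1 by ring, pow_succ, mul_smul, neg_mul]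
    simp

/-- The holonomy of a connection `a` along `[0, 1]` with one insertion of `B`. -/
def insertedHol (a B : ℝ → 𝔄) : 𝔄 :=
  transport a 1 * ∫ t in (0 : ℝ)..1, transportInv a t * B t * transport a t

end Simplex

/-! ### Summation of the iterated integrals -/

section Series

open Set

variable {E : Type*} [NormedAddCommGroup E] [NormedSpace ℝ E]
  {M : Type*} [TopologicalSpace M] [ChartedSpace E M]
  {V : Type*} [NormedAddCommGroup V] [NormedSpace ℝ V] [FiniteDimensional ℝ V]
  {C : GradedComplex V}

/-- Transfers statements that hold almost everywhere on the square to almost every point of the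
simplex times the interval, for all slots simultaneously. -/
lemma quasiMeasurePreserving_slot (k : ℕ) (i : Fin k) :
    Measure.QuasiMeasurePreserving (fun x : (Fin k → ℝ) × ℝ => (x.1 i, x.2)) volume volume :=
  QuasiMeasurePreserving.prodMap
    (Measure.quasiMeasurePreserving_eval (fun _ : Fin k => (volume : Measure ℝ)) i)
    (Measure.QuasiMeasurePreserving.id volume)

lemma volume_simplexTimesInterval_lt_top (k : ℕ) : volume (simplexTimesInterval k) < ⊤ := by
  rw [simplexTimesInterval, Measure.volume_eq_prod, Measure.prod_prod]
  exact ENNReal.mul_lt_top (volume_simplexUpTo_lt_top k le_rfl) (by simp)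

/-- The series of iterated integrals of `H`, given almost everywhere descriptions `a` and `B` of
the pullbacks of `α¹` and `α²`. -/
theorem omegaIntegral_series (α : FlatSuperconnection E M C) (H : ℝ × ℝ → M)
    {a B : ℝ × ℝ → V →L[ℝ] V} (ha : StronglyMeasurable a) (hB : StronglyMeasurable B)
    {c : ℝ} (hca : ∀ p, ‖a p‖ ≤ c) (hcB : ∀ p, ‖B p‖ ≤ c)
    (hae : ∀ᵐ p, p ∈ square → MDifferentiableAt 𝓘(ℝ, ℝ × ℝ) 𝓘(ℝ, E) H p ∧
      pullOne α H p (1, 0) = a p ∧ pullTwo α H p = B p) :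
    (∀ m n, IntegrableOn (omegaDensity α H m n) (simplexTimesInterval (m + n + 1))) ∧
    (Summable fun p : ℕ × ℕ => ‖omegaIntegral α H p.1 p.2‖) ∧
    ∑' p : ℕ × ℕ, (-1 : ℝ) ^ (p.1 + p.2) • omegaIntegral α H p.1 p.2 =
      ∫ s in (0 : ℝ)..1, insertedHol (fun t => -a (t, s)) (fun t => B (t, s)) := by
  have hc : 0 ≤ c := (norm_nonneg _).trans (hca 0)
  set x : ∀ m n : ℕ, Fin (m + n + 1) → (Fin (m + n + 1) → ℝ) × ℝ → V →L[ℝ] V :=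
    fun m n i y => if (i : ℕ) = m then B (y.1 i, y.2) else a (y.1 i, y.2) with hx
  have hslot : ∀ (k : ℕ) (i : Fin k), Measurable fun y : (Fin k → ℝ) × ℝ => (y.1 i, y.2) :=
    fun k i => (quasiMeasurePreserving_slot k i).measurable
  have hxm : ∀ m n i, StronglyMeasurable (x m n i) := by
    intro m n i
    simp only [hx]
    split_ifs
    · exact hB.comp_measurable (hslot _ i)
    · exact ha.comp_measurable (hslot _ i)
  have hxb : ∀ m n i y, ‖x m n i y‖ ≤ c := by
    intro m n i y
    simp only [hx]
    split_ifs
    · exact hcB _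
    · exact hca _
  have hms : ∀ k, MeasurableSet (simplexTimesInterval k) := fun k =>
    (isClosed_simplexUpTo k 1).measurableSet.prod measurableSet_Icc
  have hdens : ∀ m n, ∀ᵐ y ∂(volume.restrict (simplexTimesInterval (m + n + 1))),
      (List.ofFn fun i => x m n i y).prod = omegaDensity α H m n y := by
    intro m n
    rw [ae_restrict_iff' (hms _)]
    have : ∀ᵐ y : (Fin (m + n + 1) → ℝ) × ℝ, ∀ i, (y.1 i, y.2) ∈ square →
        MDifferentiableAt 𝓘(ℝ, ℝ × ℝ) 𝓘(ℝ, E) H (y.1 i, y.2) ∧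
        pullOne α H (y.1 i, y.2) (1, 0) = a (y.1 i, y.2) ∧
        pullTwo α H (y.1 i, y.2) = B (y.1 i, y.2) :=
      ae_all_iff.2 fun i => (quasiMeasurePreserving_slot _ i).ae hae
    filter_upwards [this] with y hy hys
    have hy' := fun i => hy i ⟨hys.1.2 i, hys.2⟩
    rw [omegaDensity_eq α H m n y fun i => (hy' i).1]
    congr 2
    ext1 i
    rw [(hy' i).2.1, (hy' i).2.2]
  have hint : ∀ m n, IntegrableOn (fun y => (List.ofFn fun i => x m n i y).prod)
      (simplexTimesInterval (m + n + 1)) := fun m n =>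
    integrableOn_prod_ofFn (hxm m n) hc (hxb m n) (volume_simplexTimesInterval_lt_top _)
  have hca' : ∀ s, Coeff c fun t => a (t, s) := fun s =>
    ⟨(ha.comp_measurable measurable_prodMk_right).aestronglyMeasurable, fun t _ => hca _⟩
  have hcB' : ∀ s, Coeff c fun t => B (t, s) := fun s =>
    ⟨(hB.comp_measurable measurable_prodMk_right).aestronglyMeasurable, fun t _ => hcB _⟩
  have hcn' : ∀ s, Coeff c fun t => -a (t, s) := fun s =>
    ⟨(hca' s).meas.neg, fun t ht => by rw [norm_neg]; exact (hca' s).bound t ht⟩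
  have hinner : ∀ m n s, ∫ t in simplexUpTo (m + n + 1) 1,
      (List.ofFn fun i => x m n i (t, s)).prod =
      iterInt (insertedList (fun t => a (t, s)) (fun t => B (t, s)) m n) 1 := by
    intro m n s
    rw [← ofFn_eq_insertedList, ← integral_simplexUpTo (C := c) _ hc _ (by simp)]
    · congr 1
      ext1 t
      congr 2
      ext1 i
      simp only [hx]
      split_ifs <;> rfl
    · intro i
      split_ifs
      · exact hB.comp_measurable measurable_prodMk_right
      · exact ha.comp_measurable measurable_prodMk_right
    · intro i t
      split_ifs
      · exact hcB _
      · exact hca _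
  have hprod : ∀ m n, Integrable (fun y => (List.ofFn fun i => x m n i y).prod)
      ((volume.restrict (simplexUpTo (m + n + 1) 1)).prod (volume.restrict (Icc (0 : ℝ) 1))) := by
    intro m n
    rw [Measure.prod_restrict]
    exact hint m n
  have hI : ∀ m n, omegaIntegral α H m n = ∫ s in Icc (0 : ℝ) 1,
      iterInt (insertedList (fun t => a (t, s)) (fun t => B (t, s)) m n) 1 := by
    intro m n
    rw [omegaIntegral, ← integral_congr_ae (hdens m n), simplexTimesInterval, orderedSimplex_eq,
      Measure.volume_eq_prod, ← Measure.prod_restrict, integral_prod_symm _ (hprod m n)]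
    exact integral_congr_ae (Filter.Eventually.of_forall fun s => hinner m n s)
  have hIi : ∀ m n, IntegrableOn (fun s =>
      iterInt (insertedList (fun t => a (t, s)) (fun t => B (t, s)) m n) 1) (Icc (0 : ℝ) 1) := by
    intro m n
    refine (hprod m n).integral_prod_right.congr (Filter.Eventually.of_forall fun s => hinner m n s)
  set bd : ℕ × ℕ → ℝ := fun p => ‖(1 : V →L[ℝ] V)‖ * c *
    (c ^ p.1 / p.1.factorial * (c ^ p.2 / p.2.factorial)) with hbd
  have hbds : Summable bd := summable_insertedList_bound _ c
  have hIb : ∀ (p : ℕ × ℕ) (s : ℝ),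
      ‖iterInt (insertedList (fun t => a (t, s)) (fun t => B (t, s)) p.1 p.2) 1‖ ≤ bd p :=
    fun p s => norm_iterInt_insertedList_le (hca' s) (hcB' s) p.1 p.2 (by simp)
  have hIn : ∀ p : ℕ × ℕ, ∫ s in Icc (0 : ℝ) 1,
      ‖iterInt (insertedList (fun t => a (t, s)) (fun t => B (t, s)) p.1 p.2) 1‖ ≤ bd p := by
    intro p
    calc _ ≤ ∫ s in Icc (0 : ℝ) 1, bd p :=
          integral_mono (hIi p.1 p.2).norm (integrable_const _) fun s => hIb p s
      _ = bd p := by simp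
  refine ⟨fun m n => (hint m n).congr (hdens m n), ?_, ?_⟩
  · refine Summable.of_nonneg_of_le (fun _ => norm_nonneg _) (fun p => ?_) hbds
    rw [hI]
    exact (norm_integral_le_integral_norm _).trans (hIn p)
  · have hpw : ∀ p : ℕ × ℕ, (-1 : ℝ) ^ (p.1 + p.2) • omegaIntegral α H p.1 p.2 =
        ∫ s in Icc (0 : ℝ) 1,
          iterInt (insertedList (fun t => -a (t, s)) (fun t => B (t, s)) p.1 p.2) 1 := by
      intro p
      rw [hI, ← integral_smul]
      simp only [iterInt_insertedList_neg (fun t => a (t, _))]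
    have hnorm : ∀ (p : ℕ × ℕ) s,
        ‖iterInt (insertedList (fun t => -a (t, s)) (fun t => B (t, s)) p.1 p.2) 1‖ =
        ‖iterInt (insertedList (fun t => a (t, s)) (fun t => B (t, s)) p.1 p.2) 1‖ := by
      intro p s
      rw [iterInt_insertedList_neg (fun t => a (t, s)), norm_smul]; simp
    simp only [hpw]
    -- The bounds on the iterated integrals are uniform in s, which justifies summing under the
    -- integral. For each s the sum is then given by variation of constants.
    rw [integral_tsum_of_summable_integral_norm]
    · rw [intervalIntegral.integral_of_le zero_le_one, ← integral_Icc_eq_integral_Ioc]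
      refine integral_congr_ae (Filter.Eventually.of_forall fun s => ?_)
      exact (hasSum_iterInt_insertedList (hcn' s) (hcB' s)).tsum_eq
    · intro p
      simp only [iterInt_insertedList_neg (fun t => a (t, _))]
      exact (hIi p.1 p.2).smul ((-1 : ℝ) ^ (p.1 + p.2))
    · simp only [hnorm]
      exact Summable.of_nonneg_of_le (fun _ => integral_nonneg fun _ => norm_nonneg _) hIn hbds

end Series

/-! ### The non-abelian Stokes formula on a small rectangle -/

section StokesCell

open Set Filter Topology

variable {E : Type*} [NormedAddCommGroup E] [NormedSpace ℝ E]
  {𝔄 : Type*} [NormedRing 𝔄] [NormedAlgebra ℝ 𝔄] [CompleteSpace 𝔄]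

lemma ae_ae_of_ae_swap {p : ℝ × ℝ → Prop} (h : ∀ᵐ z, p z) : ∀ᵐ v : ℝ, ∀ᵐ u : ℝ, p (u, v) := by
  have h1 : ∀ᵐ z : ℝ × ℝ, p z.swap :=
    (Measure.measurePreserving_swap (μ := (volume : Measure ℝ))
      (ν := (volume : Measure ℝ))).quasiMeasurePreserving.ae h
  exact Measure.ae_ae_of_ae_prod h1

/-- A pair of mutually inverse solutions `g`, `k` of the equations of parallel transport
`∂_u g = - a g`, `∂_u k = k a` in a rectangle. -/
structure TransportPair (a g k : ℝ × ℝ → 𝔄) (c u₀ u₁ v₀ v₁ : ℝ) : Prop where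
  g_eq : ∀ v ∈ Icc v₀ v₁, LipDeriv (fun u => g (u, v)) (fun u => -(a (u, v) * g (u, v))) u₀ u₁
  k_eq : ∀ v ∈ Icc v₀ v₁, LipDeriv (fun u => k (u, v)) (fun u => k (u, v) * a (u, v)) u₀ u₁
  kg : ∀ u ∈ Icc u₀ u₁, ∀ v ∈ Icc v₀ v₁, k (u, v) * g (u, v) = 1
  gk : ∀ u ∈ Icc u₀ u₁, ∀ v ∈ Icc v₀ v₁, g (u, v) * k (u, v) = 1
  g_le : ∀ u ∈ Icc u₀ u₁, ∀ v ∈ Icc v₀ v₁, ‖g (u, v)‖ ≤ c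
  k_le : ∀ u ∈ Icc u₀ u₁, ∀ v ∈ Icc v₀ v₁, ‖k (u, v)‖ ≤ c

/-- In the rectangle, the connection is the pullback of the connection form `A` along a Lipschitz
map `f` with partial derivatives `f₁`, `f₂`, and `Φ` is its curvature. -/
structure CellData (A : E → E →L[ℝ] 𝔄) (f f₁ f₂ : ℝ × ℝ → E) (a₁ a₂ Φ : ℝ × ℝ → 𝔄)
    (K : NNReal) (u₀ u₁ v₀ v₁ : ℝ) : Prop where
  f_lip : LipschitzOnWith K f (Icc u₀ u₁ ×ˢ Icc v₀ v₁)
  Af_lip : LipschitzOnWith K (fun p => A (f p)) (Icc u₀ u₁ ×ˢ Icc v₀ v₁)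
  Af_le : ∀ p ∈ Icc u₀ u₁ ×ˢ Icc v₀ v₁, ‖A (f p)‖ ≤ K
  A_diff : ∀ p ∈ Icc u₀ u₁ ×ˢ Icc v₀ v₁, DifferentiableAt ℝ A (f p)
  dA_le : ∀ p ∈ Icc u₀ u₁ ×ˢ Icc v₀ v₁, ‖fderiv ℝ A (f p)‖ ≤ K
  f₁_le : ∀ p ∈ Icc u₀ u₁ ×ˢ Icc v₀ v₁, ‖f₁ p‖ ≤ K
  f₁_deriv : ∀ v ∈ Icc v₀ v₁, ∀ᵐ u, u ∈ Ioo u₀ u₁ → HasDerivAt (fun u => f (u, v)) (f₁ (u, v)) u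
  a₁_eq : ∀ v ∈ Icc v₀ v₁, ∀ᵐ u, u ∈ Ioo u₀ u₁ → a₁ (u, v) = A (f (u, v)) (f₁ (u, v))
  f₂_deriv : ∀ u ∈ Icc u₀ u₁, ∀ᵐ v, v ∈ Ioo v₀ v₁ → HasDerivAt (fun v => f (u, v)) (f₂ (u, v)) v
  a₂_eq : ∀ u ∈ Icc u₀ u₁, ∀ᵐ v, v ∈ Ioo v₀ v₁ → a₂ (u, v) = A (f (u, v)) (f₂ (u, v))
  regular : ∀ᵐ p : ℝ × ℝ, p ∈ Ioo u₀ u₁ ×ˢ Ioo v₀ v₁ →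
    Tendsto (fun w => f₁ (p.1, w)) (𝓝 p.2) (𝓝 (f₁ p)) ∧
    HasDerivAt (fun w => f (p.1, w)) (f₂ p) p.2 ∧
    fderiv ℝ A (f p) (f₁ p) (f₂ p) - fderiv ℝ A (f p) (f₂ p) (f₁ p) +
      (A (f p) (f₁ p) * A (f p) (f₂ p) - A (f p) (f₂ p) * A (f p) (f₁ p)) = Φ p

namespace CellData

variable {A : E → E →L[ℝ] 𝔄} {f f₁ f₂ : ℝ × ℝ → E} {a₁ a₂ Φ g k : ℝ × ℝ → 𝔄}
  {K : NNReal} {u₀ u₁ v₀ v₁ c : ℝ}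

/-- The derivative of `k_v g_w + k_v A(f_v)(f_w - f_v) g_w`. -/
def remainder (A : E → E →L[ℝ] 𝔄) (f f₁ : ℝ × ℝ → E) (g k : ℝ × ℝ → 𝔄) (v w u : ℝ) : 𝔄 :=
  k (u, v) * (fderiv ℝ A (f (u, v)) (f₁ (u, v)) (f (u, w) - f (u, v))
    - (A (f (u, w)) - A (f (u, v))) (f₁ (u, w))
    + (A (f (u, v)) (f₁ (u, v)) * A (f (u, v)) (f (u, w) - f (u, v))
      - A (f (u, v)) (f (u, w) - f (u, v)) * A (f (u, w)) (f₁ (u, w)))) * g (u, w)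

/-- The derivative of k_v g_w alone contains f₁(u, v) - f₁(u, w), which need not be small, as f₁ is
merely bounded. Differentiating the correction term k_v A(f_v)(f_w - f_v) g_w produces the opposite
difference. In what survives, every term carries a factor f_w - f_v or A(f_w) - A(f_v), so no second
derivative of f is required. -/
lemma lipDeriv_remainder (h : CellData A f f₁ f₂ a₁ a₂ Φ K u₀ u₁ v₀ v₁)
    (ht : TransportPair a₁ g k c u₀ u₁ v₀ v₁) {v w : ℝ} (hv : v ∈ Icc v₀ v₁)
    (hw : w ∈ Icc v₀ v₁) :
    LipDeriv (fun u => k (u, v) * g (u, w) +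
        k (u, v) * A (f (u, v)) (f (u, w) - f (u, v)) * g (u, w))
      (remainder A f f₁ g k v w) u₀ u₁ := by
  have hf : ∀ v ∈ Icc v₀ v₁, LipDeriv (fun u => f (u, v)) (fun u => f₁ (u, v)) u₀ u₁ := fun v hv =>
    ⟨⟨K * 1, h.f_lip.comp ((LipschitzWith.prodMk_right v).lipschitzOnWith)
      fun u hu => ⟨hu, hv⟩⟩, h.f₁_deriv v hv⟩
  have hA : LipDeriv (fun u => A (f (u, v))) (fun u => fderiv ℝ A (f (u, v)) (f₁ (u, v))) u₀ u₁ := by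
    refine ⟨⟨K * 1, h.Af_lip.comp (f := fun u => (u, v))
      ((LipschitzWith.prodMk_right v).lipschitzOnWith) fun u hu => ⟨hu, hv⟩⟩, ?_⟩
    filter_upwards [h.f₁_deriv v hv] with u hu hu'
    exact (h.A_diff (u, v) ⟨Ioo_subset_Icc_self hu', hv⟩).hasFDerivAt.comp_hasDerivAt u (hu hu')
  have hAf := hA.bilin (ContinuousLinearMap.id ℝ (E →L[ℝ] 𝔄)) ((hf w hw).sub (hf v hv))
  have hP := ((ht.k_eq v hv).mul hAf).mul (ht.g_eq w hw)
  have hN := (ht.k_eq v hv).mul (ht.g_eq w hw)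
  refine (hN.add hP).congr_deriv ?_
  filter_upwards [h.a₁_eq v hv, h.a₁_eq w hw] with u h1 h2 hu
  simp only [remainder, h1 hu, h2 hu, ContinuousLinearMap.id_apply,
    sub_apply, map_sub]
  noncomm_ring

/-- Each term has one factor that is a difference between the heights v and w of a Lipschitz
function. The uniform constant serves both for the Lipschitz estimate in v and as dominating
function for the difference quotients. -/
lemma norm_remainder_le (h : CellData A f f₁ f₂ a₁ a₂ Φ K u₀ u₁ v₀ v₁)
    (ht : TransportPair a₁ g k c u₀ u₁ v₀ v₁) {v w u : ℝ} (hv : v ∈ Icc v₀ v₁)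
    (hw : w ∈ Icc v₀ v₁) (hu : u ∈ Icc u₀ u₁) :
    ‖remainder A f f₁ g k v w u‖ ≤ c * (K * K * K + K * K + 2 * (K * K * K * K)) * c * |w - v| := by
  have hc : 0 ≤ c := (norm_nonneg _).trans (ht.g_le u hu v hv)
  have hpv : (u, v) ∈ Icc u₀ u₁ ×ˢ Icc v₀ v₁ := ⟨hu, hv⟩
  have hpw : (u, w) ∈ Icc u₀ u₁ ×ˢ Icc v₀ v₁ := ⟨hu, hw⟩
  have hd : dist (u, w) (u, v) = |w - v| := by
    rw [Prod.dist_eq, dist_self, Real.dist_eq]; simp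
  have hΔ : ‖f (u, w) - f (u, v)‖ ≤ K * |w - v| := by
    rw [← dist_eq_norm, ← hd]; exact h.f_lip.dist_le_mul _ hpw _ hpv
  have hΔA : ‖A (f (u, w)) - A (f (u, v))‖ ≤ K * |w - v| := by
    rw [← dist_eq_norm, ← hd]; exact h.Af_lip.dist_le_mul _ hpw _ hpv
  have hK : (0 : ℝ) ≤ K := K.2
  have e1 : ‖fderiv ℝ A (f (u, v)) (f₁ (u, v)) (f (u, w) - f (u, v))‖ ≤ K * K * (K * |w - v|) := by
    refine ((fderiv ℝ A (f (u, v))).le_opNorm₂ _ _).trans ?_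
    have := h.dA_le _ hpv
    have := h.f₁_le _ hpv
    gcongr
  have e2 : ‖(A (f (u, w)) - A (f (u, v))) (f₁ (u, w))‖ ≤ K * |w - v| * K :=
    (ContinuousLinearMap.le_opNorm _ _).trans
      (mul_le_mul hΔA (h.f₁_le _ hpw) (norm_nonneg _) (by positivity))
  have e3 : ∀ p ∈ Icc u₀ u₁ ×ˢ Icc v₀ v₁, ‖A (f p) (f₁ p)‖ ≤ K * K := fun p hp =>
    (ContinuousLinearMap.le_opNorm _ _).trans
      (mul_le_mul (h.Af_le p hp) (h.f₁_le _ hp) (norm_nonneg _) hK)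
  have e4 : ‖A (f (u, v)) (f (u, w) - f (u, v))‖ ≤ K * (K * |w - v|) :=
    (ContinuousLinearMap.le_opNorm _ _).trans
      (mul_le_mul (h.Af_le _ hpv) hΔ (norm_nonneg _) hK)
  have e5 : ‖A (f (u, v)) (f₁ (u, v)) * A (f (u, v)) (f (u, w) - f (u, v))‖ ≤
      K * K * (K * (K * |w - v|)) :=
    (norm_mul_le _ _).trans (mul_le_mul (e3 _ hpv) e4 (norm_nonneg _) (by positivity))
  have e6 : ‖A (f (u, v)) (f (u, w) - f (u, v)) * A (f (u, w)) (f₁ (u, w))‖ ≤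
      K * (K * |w - v|) * (K * K) :=
    (norm_mul_le _ _).trans (mul_le_mul e4 (e3 _ hpw) (norm_nonneg _) (by positivity))
  have e7 := (norm_add_le _ _).trans
    (add_le_add ((norm_sub_le _ _).trans (add_le_add e1 e2)) ((norm_sub_le _ _).trans (add_le_add e5 e6)))
  unfold remainder
  refine (norm_mul_le _ _).trans (mul_le_mul ((norm_mul_le _ _).trans
    (mul_le_mul (ht.k_le u hu v hv) e7 (norm_nonneg _) hc)) (ht.g_le u hu w hw) (norm_nonneg _)
    (by positivity)) |>.trans (le_of_eq (by ring))

lemma remainder_self (v u : ℝ) : remainder A f f₁ g k v v u = 0 := by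
  simp [remainder]

/-- `lipDeriv_remainder` integrated from u₀ to u and multiplied by g_v, using g k = 1. Increments of
g in the vertical direction become boundary terms at u₀ and u plus the integral of the remainder. -/
lemma g_sub_eq (h : CellData A f f₁ f₂ a₁ a₂ Φ K u₀ u₁ v₀ v₁)
    (ht : TransportPair a₁ g k c u₀ u₁ v₀ v₁) {v w u : ℝ} (hv : v ∈ Icc v₀ v₁)
    (hw : w ∈ Icc v₀ v₁) (hu : u ∈ Icc u₀ u₁) :
    g (u, w) - g (u, v) = g (u, v) * (k (u₀, v) * (g (u₀, w) - g (u₀, v)) +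
      k (u₀, v) * A (f (u₀, v)) (f (u₀, w) - f (u₀, v)) * g (u₀, w) -
      k (u, v) * A (f (u, v)) (f (u, w) - f (u, v)) * g (u, w) +
      ∫ x in u₀..u, remainder A f f₁ g k v w x) := by
  have h1 := (h.lipDeriv_remainder ht hv hw).eq_add_integral hu
  have hu₀ : u₀ ∈ Icc u₀ u₁ := ⟨le_rfl, hu.1.trans hu.2⟩
  have h2 : k (u₀, v) * (g (u₀, w) - g (u₀, v)) +
      k (u₀, v) * A (f (u₀, v)) (f (u₀, w) - f (u₀, v)) * g (u₀, w) -
      k (u, v) * A (f (u, v)) (f (u, w) - f (u, v)) * g (u, w) +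
      ∫ x in u₀..u, remainder A f f₁ g k v w x = k (u, v) * g (u, w) - 1 := by
    rw [mul_sub, ht.kg u₀ hu₀ v hv, ← sub_eq_zero, ← sub_eq_zero.mpr h1.symm]
    abel
  rw [h2, mul_sub, ← mul_assoc, ht.gk u hu v hv, one_mul, mul_one]

/-- All terms in `g_sub_eq` are of order |w - v|, uniformly in u. Continuity of g in v is needed
before its derivative can be computed. -/
lemma exists_lipschitz (h : CellData A f f₁ f₂ a₁ a₂ Φ K u₀ u₁ v₀ v₁)
    (ht : TransportPair a₁ g k c u₀ u₁ v₀ v₁) {K₀ : NNReal}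
    (h0 : LipschitzOnWith K₀ (fun v => g (u₀, v)) (Icc v₀ v₁)) :
    ∃ K' : NNReal, ∀ u ∈ Icc u₀ u₁, LipschitzOnWith K' (fun v => g (u, v)) (Icc v₀ v₁) := by
  set C : ℝ := c * (K * K * K + K * K + 2 * (K * K * K * K)) * c with hC
  set C' : ℝ := |c| * (|c| * K₀ + |c| * (K * K) * |c| + |c| * (K * K) * |c| + |C| * (u₁ - u₀)) with hC'
  refine ⟨C'.toNNReal, fun u hu => LipschitzOnWith.of_dist_le_mul fun w hw v hv => ?_⟩
  have hu₀ : u₀ ∈ Icc u₀ u₁ := ⟨le_rfl, hu.1.trans hu.2⟩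
  have hc : 0 ≤ c := (norm_nonneg _).trans (ht.g_le u hu v hv)
  have hK : (0 : ℝ) ≤ K := K.2
  have hC0 : 0 ≤ C := by positivity
  have hC'0 : 0 ≤ C' := by
    have : 0 ≤ u₁ - u₀ := by linarith [hu₀.2]
    positivity
  rw [Real.coe_toNNReal _ hC'0, dist_eq_norm, Real.dist_eq, h.g_sub_eq ht hv hw hu]
  have hP : ∀ u ∈ Icc u₀ u₁, ‖k (u, v) * A (f (u, v)) (f (u, w) - f (u, v)) * g (u, w)‖ ≤
      c * (K * K) * c * |w - v| := by
    intro u hu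
    have hpv : (u, v) ∈ Icc u₀ u₁ ×ˢ Icc v₀ v₁ := ⟨hu, hv⟩
    have hpw : (u, w) ∈ Icc u₀ u₁ ×ˢ Icc v₀ v₁ := ⟨hu, hw⟩
    have hd : dist (u, w) (u, v) = |w - v| := by
      rw [Prod.dist_eq, dist_self, Real.dist_eq]; simp
    have hΔ : ‖f (u, w) - f (u, v)‖ ≤ K * |w - v| := by
      rw [← dist_eq_norm, ← hd]; exact h.f_lip.dist_le_mul _ hpw _ hpv
    have e4 : ‖A (f (u, v)) (f (u, w) - f (u, v))‖ ≤ K * (K * |w - v|) :=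
      (ContinuousLinearMap.le_opNorm _ _).trans
        (mul_le_mul (h.Af_le _ hpv) hΔ (norm_nonneg _) hK)
    refine (norm_mul_le _ _).trans (mul_le_mul ((norm_mul_le _ _).trans
      (mul_le_mul (ht.k_le u hu v hv) e4 (norm_nonneg _) hc)) (ht.g_le u hu w hw) (norm_nonneg _)
      (by positivity)) |>.trans (le_of_eq (by ring))
  have hI : ‖∫ x in u₀..u, remainder A f f₁ g k v w x‖ ≤ C * |w - v| * (u₁ - u₀) := by
    refine (intervalIntegral.norm_integral_le_of_norm_le_const (C := C * |w - v|) fun x hx => ?_).trans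
      ?_
    · rw [uIoc_of_le hu.1] at hx
      exact h.norm_remainder_le ht hv hw ⟨hx.1.le, hx.2.trans hu.2⟩
    · rw [abs_of_nonneg (sub_nonneg.mpr hu.1)]
      exact mul_le_mul_of_nonneg_left (by linarith [hu.2]) (by positivity)
  have h0' : ‖k (u₀, v) * (g (u₀, w) - g (u₀, v))‖ ≤ c * (K₀ * |w - v|) := by
    refine (norm_mul_le _ _).trans (mul_le_mul (ht.k_le u₀ hu₀ v hv) ?_ (norm_nonneg _) hc)
    rw [← dist_eq_norm, ← Real.dist_eq]
    exact h0.dist_le_mul _ hw _ hv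
  refine (norm_mul_le _ _).trans (mul_le_mul (ht.g_le u hu v hv) ((norm_add_le _ _).trans
    (add_le_add ((norm_sub_le _ _).trans (add_le_add ((norm_add_le _ _).trans
      (add_le_add h0' (hP u₀ hu₀))) (hP u hu))) hI)) (norm_nonneg _) hc) |>.trans (le_of_eq ?_)
  rw [hC', abs_of_nonneg hc, abs_of_nonneg hC0]
  ring

/-- At a zero of `F` the slope of the product is the slope of `F` times `G`, so continuity of `G`
suffices. It is applied with `G` equal to g(u, ·), whose differentiability is the point at issue. -/
lemma hasDerivAt_mul_of_eq_zero {F G : ℝ → 𝔄} {F' : 𝔄} {v : ℝ} (hF : HasDerivAt F F' v)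
    (h0 : F v = 0) (hG : ContinuousAt G v) : HasDerivAt (fun w => F w * G w) (F' * G v) v := by
  rw [hasDerivAt_iff_tendsto_slope] at hF ⊢
  refine (hF.mul (hG.tendsto.mono_left nhdsWithin_le_nhds)).congr fun w => ?_
  simp [slope, h0]

/-- The remainder is, to first order in w - v, the conjugated curvature: the dA terms give the
exterior derivative of A and the products give the commutator. -/
lemma tendsto_remainder {v u : ℝ}
    (hf₁ : Tendsto (fun w => f₁ (u, w)) (𝓝 v) (𝓝 (f₁ (u, v))))
    (hf : HasDerivAt (fun w => f (u, w)) (f₂ (u, v)) v)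
    (hA : DifferentiableAt ℝ A (f (u, v))) (hg : ContinuousAt (fun w => g (u, w)) v) :
    Tendsto (fun w => (w - v)⁻¹ • remainder A f f₁ g k v w u) (𝓝[≠] v)
      (𝓝 (k (u, v) * (fderiv ℝ A (f (u, v)) (f₁ (u, v)) (f₂ (u, v)) -
        fderiv ℝ A (f (u, v)) (f₂ (u, v)) (f₁ (u, v)) +
      (A (f (u, v)) (f₁ (u, v)) * A (f (u, v)) (f₂ (u, v)) -
        A (f (u, v)) (f₂ (u, v)) * A (f (u, v)) (f₁ (u, v)))) * g (u, v))) := by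
  have hAf : HasDerivAt (fun w => A (f (u, w))) (fderiv ℝ A (f (u, v)) (f₂ (u, v))) v :=
    hA.hasFDerivAt.comp_hasDerivAt v hf
  have hAc : Tendsto (fun w => A (f (u, w))) (𝓝[≠] v) (𝓝 (A (f (u, v)))) :=
    hAf.continuousAt.tendsto.mono_left nhdsWithin_le_nhds
  rw [hasDerivAt_iff_tendsto_slope] at hf hAf
  replace hf₁ := hf₁.mono_left (nhdsWithin_le_nhds (s := {v}ᶜ))
  have hg' := hg.tendsto.mono_left (nhdsWithin_le_nhds (s := {v}ᶜ))
  have happ := (isBoundedBilinearMap_apply (𝕜 := ℝ) (E := E) (F := 𝔄)).continuous.tendsto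
    (fderiv ℝ A (f (u, v)) (f₂ (u, v)), f₁ (u, v))
  have happ' := (isBoundedBilinearMap_apply (𝕜 := ℝ) (E := E) (F := 𝔄)).continuous.tendsto
    (A (f (u, v)), f₁ (u, v))
  have t1 := ((fderiv ℝ A (f (u, v)) (f₁ (u, v))).continuous.tendsto _).comp hf
  have t2 := happ.comp (hAf.prodMk_nhds hf₁)
  have t3 := (((A (f (u, v))).continuous.tendsto _).comp hf)
  have t4 := happ'.comp (hAc.prodMk_nhds hf₁)
  refine ((((t1.sub t2).add ((t3.const_mul (A (f (u, v)) (f₁ (u, v)))).sub (t3.mul t4))).const_mul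
    (k (u, v))).mul hg').congr fun w => ?_
  simp only [remainder, slope, vsub_eq_sub, Function.comp_apply, map_smul, mul_smul_comm,
    smul_mul_assoc, smul_apply, ← smul_sub, ← smul_add]

/-- Parallel transport along the horizontal lines varies along the vertical lines by the connection
and the integral of the curvature. -/
theorem lipDeriv_transport (h : CellData A f f₁ f₂ a₁ a₂ Φ K u₀ u₁ v₀ v₁)
    (ht : TransportPair a₁ g k c u₀ u₁ v₀ v₁) {κ : ℝ → 𝔄}
    (h0 : LipDeriv (fun v => g (u₀, v)) (fun v => -(a₂ (u₀, v) * g (u₀, v)) + g (u₀, v) * κ v) v₀ v₁)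
    {u : ℝ} (hu : u ∈ Icc u₀ u₁) :
    LipDeriv (fun v => g (u, v)) (fun v => -(a₂ (u, v) * g (u, v)) +
      g (u, v) * (κ v + ∫ x in u₀..u, k (x, v) * Φ (x, v) * g (x, v))) v₀ v₁ := by
  obtain ⟨K₀, hK₀⟩ := h0.lip
  obtain ⟨K', hK'⟩ := h.exists_lipschitz ht hK₀
  have hu₀ : u₀ ∈ Icc u₀ u₁ := ⟨le_rfl, hu.1.trans hu.2⟩
  refine ⟨⟨K', hK' u hu⟩, ?_⟩
  filter_upwards [h0.deriv, h.f₂_deriv u₀ hu₀, h.f₂_deriv u hu, h.a₂_eq u₀ hu₀, h.a₂_eq u hu,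
    ae_ae_of_ae_swap h.regular] with v d0 df0 df a0 au hreg hv
  have hv' := Ioo_subset_Icc_self hv
  have hnhds : Icc v₀ v₁ ∈ 𝓝 v := Icc_mem_nhds hv.1 hv.2
  have hgc : ∀ u ∈ Icc u₀ u₁, ContinuousAt (fun w => g (u, w)) v := fun u hu =>
    (hK' u hu).continuousOn.continuousAt hnhds
  have hP : ∀ u ∈ Icc u₀ u₁, HasDerivAt (fun w => f (u, w)) (f₂ (u, v)) v →
      HasDerivAt (fun w => k (u, v) * A (f (u, v)) (f (u, w) - f (u, v)) * g (u, w))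
        (k (u, v) * A (f (u, v)) (f₂ (u, v)) * g (u, v)) v := by
    intro u hu hd
    refine hasDerivAt_mul_of_eq_zero ?_ (by simp) (hgc u hu)
    refine HasDerivAt.const_mul _ ?_
    exact (A (f (u, v))).hasFDerivAt.comp_hasDerivAt v (hd.sub_const _)
  -- Differentiation under the integral by dominated convergence. For almost every v, almost every
  -- point of the horizontal line at height v is regular, and there the quotient tends to k Φ g.
  have hR : HasDerivAt (fun w => ∫ x in u₀..u, remainder A f f₁ g k v w x)
      (∫ x in u₀..u, k (x, v) * Φ (x, v) * g (x, v)) v := by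
    rw [hasDerivAt_iff_tendsto_slope]
    have hs : (slope (fun w => ∫ x in u₀..u, remainder A f f₁ g k v w x) v) = fun w =>
        ∫ x in u₀..u, (w - v)⁻¹ • remainder A f f₁ g k v w x := by
      funext w
      simp [slope, remainder_self, intervalIntegral.integral_smul]
    rw [hs]
    have hn' : ∀ᶠ w in 𝓝[≠] v, w ∈ Icc v₀ v₁ ∧ w ≠ v :=
      inter_mem (nhdsWithin_le_nhds hnhds) self_mem_nhdsWithin
    refine intervalIntegral.tendsto_integral_filter_of_dominated_convergence
      (fun _ => c * (K * K * K + K * K + 2 * (K * K * K * K)) * c) ?_ ?_ (by simp) ?_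
    · filter_upwards [hn'] with w hw
      refine AEStronglyMeasurable.const_smul ?_ _
      have := ((h.lipDeriv_remainder ht hv' hw.1).mono le_rfl hu.2).intervalIntegrable hu.1
      rw [uIoc_of_le hu.1]
      exact this.1.aestronglyMeasurable
    · filter_upwards [hn'] with w hw
      refine Eventually.of_forall fun x hx => ?_
      rw [uIoc_of_le hu.1] at hx
      have hx' : x ∈ Icc u₀ u₁ := ⟨hx.1.le, hx.2.trans hu.2⟩
      have hpos : 0 < |w - v| := abs_pos.mpr (sub_ne_zero.mpr hw.2)
      rw [norm_smul, norm_inv, Real.norm_eq_abs, inv_mul_le_iff₀ hpos, mul_comm |w - v|]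
      exact h.norm_remainder_le ht hv' hw.1 hx'
    · filter_upwards [hreg, ae_ne_real u] with x hx hxu hx'
      rw [uIoc_of_le hu.1] at hx'
      have hxI : x ∈ Ioo u₀ u₁ := ⟨hx'.1, (lt_of_le_of_ne hx'.2 hxu).trans_le hu.2⟩
      obtain ⟨r1, r2, r3⟩ := hx ⟨hxI, hv⟩
      have := tendsto_remainder (k := k) r1 r2 (h.A_diff (x, v) ⟨Ioo_subset_Icc_self hxI, hv'⟩)
        (hgc x (Ioo_subset_Icc_self hxI))
      rwa [r3] at this
  have hmain := ((((((d0 hv).sub_const (g (u₀, v))).const_mul (k (u₀, v))).add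
    (hP u₀ hu₀ (df0 hv))).sub (hP u hu (df hv))).add hR).const_mul (g (u, v)) |>.const_add (g (u, v))
  refine HasDerivAt.congr_of_eventuallyEq (hmain.congr_deriv ?_) ?_
  rotate_left
  · filter_upwards [hnhds] with w hw
    rw [← sub_eq_iff_eq_add']
    exact h.g_sub_eq ht hv' hw hu
  · have e1 := ht.kg u₀ hu₀ v hv'
    have e2 := ht.gk u hu v hv'
    rw [a0 hv, au hv] at *
    have e3 : k (u₀, v) * (-(A (f (u₀, v)) (f₂ (u₀, v)) * g (u₀, v)) + g (u₀, v) * κ v) =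
        -(k (u₀, v) * A (f (u₀, v)) (f₂ (u₀, v)) * g (u₀, v)) + κ v := by
      rw [mul_add, ← mul_assoc _ (g (u₀, v)), e1, one_mul, mul_neg, mul_assoc]
    rw [e3]
    have e4 : g (u, v) * (k (u, v) * A (f (u, v)) (f₂ (u, v)) * g (u, v)) =
        A (f (u, v)) (f₂ (u, v)) * g (u, v) := by
      rw [← mul_assoc, ← mul_assoc, e2, one_mul]
    rw [← e4]
    noncomm_ring

end CellData

end StokesCell

/-! ### Forms in charts and the curvature equation -/

section ChartForms

open Set Filter Topology

variable {E : Type*} [NormedAddCommGroup E] [NormedSpace ℝ E]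
  {M : Type*} [TopologicalSpace M] [ChartedSpace E M] [IsManifold 𝓘(ℝ, E) ∞ M]
  {N : Type*} [NormedAddCommGroup N] [NormedSpace ℝ N]
  {F : Type*} [NormedAddCommGroup F] [NormedSpace ℝ F]

lemma mdifferentiableAt_extChartAt_symm {x₀ : M} {y : E}
    (hy : y ∈ (extChartAt 𝓘(ℝ, E) x₀).target) :
    MDifferentiableAt 𝓘(ℝ, E) 𝓘(ℝ, E) (extChartAt 𝓘(ℝ, E) x₀).symm y :=
  ((contMDiffOn_extChartAt_symm (I := 𝓘(ℝ, E)) (n := ∞) x₀).contMDiffAt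
    ((isOpen_extChartAt_target x₀).mem_nhds hy)).mdifferentiableAt (by simp)

lemma differentiableAt_chart_comp {H : N → M} {z : N} {x₀ : M}
    (h : MDifferentiableAt 𝓘(ℝ, N) 𝓘(ℝ, E) H z) (hs : H z ∈ (extChartAt 𝓘(ℝ, E) x₀).source) :
    DifferentiableAt ℝ (fun q => extChartAt 𝓘(ℝ, E) x₀ (H q)) z := by
  have h1 : MDifferentiableAt 𝓘(ℝ, E) 𝓘(ℝ, E) (extChartAt 𝓘(ℝ, E) x₀) (H z) :=
    mdifferentiableAt_extChartAt (by simpa using hs)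
  exact (MDifferentiableAt.comp z h1 h).differentiableAt

lemma eventuallyEq_chart_symm_comp {H : N → M} {z : N} {x₀ : M} (hc : ContinuousAt H z)
    (hs : H z ∈ (extChartAt 𝓘(ℝ, E) x₀).source) :
    H =ᶠ[𝓝 z] (extChartAt 𝓘(ℝ, E) x₀).symm ∘ fun q => extChartAt 𝓘(ℝ, E) x₀ (H q) := by
  filter_upwards [hc.preimage_mem_nhds (extChartAt_source_mem_nhds' hs)] with q hq
  exact ((extChartAt 𝓘(ℝ, E) x₀).left_inv hq).symm

lemma form_congr_point {k : ℕ} (θ : ∀ x : M, TangentSpace 𝓘(ℝ, E) x [⋀^Fin k]→L[ℝ] F)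
    {x y : M} (h : x = y) (v : Fin k → E) : θ x v = θ y v := by
  subst h; rfl

/-- The derivative of a map into `M`, through a chart. -/
lemma mfderiv_eq_chart {H : N → M} {z : N} {x₀ : M} (hc : ContinuousAt H z)
    (hs : H z ∈ (extChartAt 𝓘(ℝ, E) x₀).source) (w : N) :
    (mfderiv 𝓘(ℝ, N) 𝓘(ℝ, E) H z w : E) =
      (mfderiv 𝓘(ℝ, E) 𝓘(ℝ, E) (extChartAt 𝓘(ℝ, E) x₀).symm (extChartAt 𝓘(ℝ, E) x₀ (H z))
        (fderiv ℝ (fun q => extChartAt 𝓘(ℝ, E) x₀ (H q)) z w) : E) := by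
  -- If the chart expression is not differentiable, neither is `H`, and both derivatives are zero by
  -- convention. The formula therefore needs only continuity.
  by_cases h : DifferentiableAt ℝ (fun q => extChartAt 𝓘(ℝ, E) x₀ (H q)) z
  · have h1 := (eventuallyEq_chart_symm_comp hc hs).mfderiv_eq (I := 𝓘(ℝ, N)) (I' := 𝓘(ℝ, E))
    have h2 := mfderiv_comp (I := 𝓘(ℝ, N)) (I' := 𝓘(ℝ, E)) (I'' := 𝓘(ℝ, E)) z
      (mdifferentiableAt_extChartAt_symm ((extChartAt 𝓘(ℝ, E) x₀).map_source hs))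
      h.mdifferentiableAt
    rw [h2, mfderiv_eq_fderiv] at h1
    exact congrArg (fun (L : N →L[ℝ] E) => L w) h1
  · have h1 : ¬ MDifferentiableAt 𝓘(ℝ, N) 𝓘(ℝ, E) H z := fun h1 =>
      h (differentiableAt_chart_comp h1 hs)
    rw [fderiv_zero_of_not_differentiableAt h, mfderiv_zero_of_not_mdifferentiableAt h1]
    exact (map_zero (mfderiv 𝓘(ℝ, E) 𝓘(ℝ, E) (extChartAt 𝓘(ℝ, E) x₀).symm
      (extChartAt 𝓘(ℝ, E) x₀ (H z)))).symm

/-- The pullback of a form, computed in a chart. -/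
lemma form_pullback_eq {k : ℕ} (θ : ∀ x : M, TangentSpace 𝓘(ℝ, E) x [⋀^Fin k]→L[ℝ] F)
    {H : N → M} {z : N} {x₀ : M} (hc : ContinuousAt H z)
    (hs : H z ∈ (extChartAt 𝓘(ℝ, E) x₀).source) (w : Fin k → N) :
    θ (H z) (fun i => mfderiv 𝓘(ℝ, N) 𝓘(ℝ, E) H z (w i)) =
      formInChart θ x₀ (extChartAt 𝓘(ℝ, E) x₀ (H z))
        (fun i => fderiv ℝ (fun q => extChartAt 𝓘(ℝ, E) x₀ (H q)) z (w i)) := by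
  refine (form_congr_point θ ((extChartAt 𝓘(ℝ, E) x₀).left_inv hs).symm _).trans ?_
  refine congrArg (θ ((extChartAt 𝓘(ℝ, E) x₀).symm (extChartAt 𝓘(ℝ, E) x₀ (H z))))
    (funext fun i => ?_)
  exact mfderiv_eq_chart hc hs (w i)

/-- A `1`-form as a field of linear maps. -/
def oneFormCLM (E F : Type*) [NormedAddCommGroup E] [NormedSpace ℝ E] [NormedAddCommGroup F]
    [NormedSpace ℝ F] : (E [⋀^Fin 1]→L[ℝ] F) →L[ℝ] (E →L[ℝ] F) :=
  LinearMap.mkContinuous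
    { toFun := fun f => (ContinuousAlternatingMap.ofSubsingleton ℝ E F (0 : Fin 1)).symm f
      map_add' := fun _ _ => rfl
      map_smul' := fun _ _ => rfl } 1 fun f => by
    rw [one_mul]
    change ‖(ContinuousAlternatingMap.ofSubsingleton ℝ E F (0 : Fin 1)).symm f‖ ≤ ‖f‖
    rw [← ContinuousAlternatingMap.norm_ofSubsingleton (𝕜 := ℝ) (0 : Fin 1),
      Equiv.apply_symm_apply]

lemma extDeriv_eq_oneFormCLM {θ : E → E [⋀^Fin 1]→L[ℝ] F} {y : E} (h : DifferentiableAt ℝ θ y)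
    (v : Fin 2 → E) :
    extDeriv θ y v = fderiv ℝ (fun q => oneFormCLM E F (θ q)) y (v 0) (v 1) -
      fderiv ℝ (fun q => oneFormCLM E F (θ q)) y (v 1) (v 0) := by
  have hL : ∀ X Y : E, fderiv ℝ (fun q => oneFormCLM E F (θ q)) y X Y =
      fderiv ℝ (fun q => θ q fun _ => Y) y X := by
    intro X Y
    have h1 : HasFDerivAt (fun q => oneFormCLM E F (θ q)) ((oneFormCLM E F).comp (fderiv ℝ θ y)) y :=
      (oneFormCLM E F).hasFDerivAt.comp y h.hasFDerivAt
    rw [h1.fderiv, fderiv_continuousAlternatingMap_apply_const_apply h]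
    rfl
  rw [extDeriv_apply h, Fin.sum_univ_two, hL, hL]
  have e0 : (0 : Fin 2).removeNth v = fun _ => v 1 := by
    ext i; fin_cases i; rfl
  have e1 : (1 : Fin 2).removeNth v = fun _ => v 0 := by
    ext i; fin_cases i; rfl
  rw [e0, e1]
  simp [sub_eq_add_neg]

/-- The exterior derivative can be computed in any chart. -/
lemma extDeriv_formInChart {k : ℕ} {θ : ∀ x : M, TangentSpace 𝓘(ℝ, E) x [⋀^Fin k]→L[ℝ] F}
    (hθ : IsSmoothForm θ) {x₀ : M} {y : E} (hy : y ∈ (extChartAt 𝓘(ℝ, E) x₀).target)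
    (v : Fin (k + 1) → E) :
    extDeriv (formInChart θ x₀) y v = formDeriv θ ((extChartAt 𝓘(ℝ, E) x₀).symm y)
      (fun i => mfderiv 𝓘(ℝ, E) 𝓘(ℝ, E) (extChartAt 𝓘(ℝ, E) x₀).symm y (v i)) := by
  set H : E → M := ⇑(extChartAt 𝓘(ℝ, E) x₀).symm with hH
  set x := H y with hx
  set τ : E → E := fun q => extChartAt 𝓘(ℝ, E) x (H q) with hτ
  have htgt : (extChartAt 𝓘(ℝ, E) x₀).target ∈ 𝓝 y := (isOpen_extChartAt_target x₀).mem_nhds hy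
  have hcont : ∀ q ∈ (extChartAt 𝓘(ℝ, E) x₀).target, ContinuousAt H q := fun q hq =>
    (mdifferentiableAt_extChartAt_symm hq).continuousAt
  have hsrc : H y ∈ (extChartAt 𝓘(ℝ, E) x).source := mem_extChartAt_source x
  have hτs : ContDiffAt ℝ ∞ τ y := by
    have h1 : ContMDiffAt 𝓘(ℝ, E) 𝓘(ℝ, E) ∞ H y :=
      (contMDiffOn_extChartAt_symm (I := 𝓘(ℝ, E)) (n := ∞) x₀).contMDiffAt htgt
    have h2 : ContMDiffAt 𝓘(ℝ, E) 𝓘(ℝ, E) ∞ (extChartAt 𝓘(ℝ, E) x) (H y) := contMDiffAt_extChartAt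
    exact (h2.comp y h1).contDiffAt
  -- Near y the expression in the chart at x₀ is the pullback, along the transition map, of the
  -- expression in the chart at x; the exterior derivative commutes with pullbacks.
  have hev : formInChart θ x₀ =ᶠ[𝓝 y] fun q =>
      (formInChart θ x (τ q)).compContinuousLinearMap (fderiv ℝ τ q) := by
    filter_upwards [htgt, (hcont y hy).preimage_mem_nhds (extChartAt_source_mem_nhds' hsrc)]
      with q hq hq'
    ext w
    exact form_pullback_eq θ (hcont q hq) hq' w
  have hd : DifferentiableAt ℝ (formInChart θ x) (τ y) :=
    ((hθ x).contDiffAt ((isOpen_extChartAt_target x).mem_nhds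
      ((extChartAt 𝓘(ℝ, E) x).map_source hsrc))).differentiableAt (by simp)
  rw [hev.extDeriv_eq, extDeriv_pullback hd hτs (by
    simpa using WithTop.coe_le_coe.mpr (le_top : (2 : ℕ∞) ≤ ⊤))]
  have hchain : fderiv ℝ τ y = (mfderiv 𝓘(ℝ, E) 𝓘(ℝ, E) (extChartAt 𝓘(ℝ, E) x) x).comp
      (mfderiv 𝓘(ℝ, E) 𝓘(ℝ, E) H y) := by
    rw [← mfderiv_eq_fderiv]
    exact mfderiv_comp y (mdifferentiableAt_extChartAt (by simpa using hsrc))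
      (mdifferentiableAt_extChartAt_symm hy)
  rw [hchain]
  rfl

variable {V : Type*} [NormedAddCommGroup V] [NormedSpace ℝ V] [FiniteDimensional ℝ V]
  {C : GradedComplex V}

/-- The component `α¹` in a chart. -/
def FlatSuperconnection.connForm (α : FlatSuperconnection E M C) (x₀ : M) (y : E) :
    E →L[ℝ] V →L[ℝ] V :=
  oneFormCLM E (V →L[ℝ] V) (formInChart (α.form 1) x₀ y)

lemma FlatSuperconnection.contDiffAt_connForm (α : FlatSuperconnection E M C) {x₀ : M} {y : E}
    (hy : y ∈ (extChartAt 𝓘(ℝ, E) x₀).target) : ContDiffAt ℝ ∞ (α.connForm x₀) y :=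
  (oneFormCLM E (V →L[ℝ] V)).contDiff.contDiffAt.comp y
    ((α.smooth 1 x₀).contDiffAt ((isOpen_extChartAt_target x₀).mem_nhds hy))

lemma FlatSuperconnection.formDeriv_zero (α : FlatSuperconnection E M C) (x : M)
    (v : Fin 1 → TangentSpace 𝓘(ℝ, E) x) : formDeriv (α.form 0) x v = 0 := by
  have h : formInChart (α.form 0) x = 0 := by
    funext y
    simp only [formInChart, α.form_zero]
    rfl
  have h1 : ∀ y, extDeriv (formInChart (α.form 0) x) y = 0 := by
    intro y
    rw [h]
    ext w
    refine congrFun (congrArg _ ?_) _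
    exact (extDeriv_apply (n := 0) (F := V →L[ℝ] V) (differentiableAt_const 0) w).trans (by simp)
  unfold formDeriv
  rw [h1]
  rfl

/-- The values of `α¹` are cochain maps. -/
lemma FlatSuperconnection.form_one_commute (α : FlatSuperconnection E M C) (x : M)
    (v : Fin 1 → TangentSpace 𝓘(ℝ, E) x) :
    C.diff * α.form 1 x v = α.form 1 x v * C.diff := by
  have h := α.flat 0 x v
  rw [α.formDeriv_zero] at h
  -- Each of the two products of total form degree 1 has a factor α⁰ = 0, so only [∂, α¹] remains.
  have h2 : ∀ i : Fin 2, superWedge (N := 0 + 1) ![(i : ℕ), 0 + 1 - i]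
      (by simp [Fin.sum_univ_two]; omega)
      (fun a u => α.form (![(i : ℕ), 0 + 1 - i] a) x u) v = 0 := by
    intro i
    have h3 : ∃ a : Fin 2, ![(i : ℕ), 0 + 1 - i] a = 0 := by
      fin_cases i
      · exact ⟨0, rfl⟩
      · exact ⟨1, rfl⟩
    obtain ⟨a, ha⟩ := h3
    have h4 : ∀ u, α.form (![(i : ℕ), 0 + 1 - i] a) x u = 0 := by
      rw [ha, α.form_zero]; intro u; rfl
    unfold superWedge
    rw [Finset.sum_eq_zero, smul_zero]
    intro σ _
    rw [List.prod_eq_zero, smul_zero]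
    rw [List.mem_ofFn]
    exact ⟨a, h4 _⟩
  rw [Finset.sum_eq_zero fun i _ => h2 i] at h
  simp only [GradedComplex.bracket] at h
  have h' : α.form 1 x v * C.diff = C.diff * α.form 1 x v := by simpa [sub_eq_zero] using h
  exact h'.symm

/-- Of the products of total form degree 2, those with a factor α⁰ vanish. In α¹α¹ the Koszul sign
is trivial because α¹ has endomorphism degree 0, and the bracket of ∂ with α², of degree -1, is an
anticommutator. -/
lemma FlatSuperconnection.flat_one (α : FlatSuperconnection E M C) (x : M)
    (v : Fin 2 → TangentSpace 𝓘(ℝ, E) x) :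
    C.diff * α.form 2 x v + α.form 2 x v * C.diff + formDeriv (α.form 1) x v +
      ((α.form 1 x fun _ => v 0) * (α.form 1 x fun _ => v 1) -
        (α.form 1 x fun _ => v 1) * (α.form 1 x fun _ => v 0)) = 0 := by
  have h := α.flat 1 x v
  have h0 : ∀ (i : Fin 3), i ≠ 1 → superWedge (N := 1 + 1) ![(i : ℕ), 1 + 1 - i]
      (by simp [Fin.sum_univ_two]; omega)
      (fun a u => α.form (![(i : ℕ), 1 + 1 - i] a) x u) v = 0 := by
    intro i hi
    have h3 : ∃ a : Fin 2, ![(i : ℕ), 1 + 1 - i] a = 0 := by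
      fin_cases i
      · exact ⟨0, rfl⟩
      · exact absurd rfl hi
      · exact ⟨1, rfl⟩
    obtain ⟨a, ha⟩ := h3
    have h4 : ∀ u, α.form (![(i : ℕ), 1 + 1 - i] a) x u = 0 := by
      rw [ha, α.form_zero]; intro u; rfl
    unfold superWedge
    rw [Finset.sum_eq_zero, smul_zero]
    intro σ _
    rw [List.prod_eq_zero, smul_zero]
    rw [List.mem_ofFn]
    exact ⟨a, h4 _⟩
  rw [Finset.sum_eq_single (1 : Fin 3) (fun i _ hi => h0 i hi) (by simp)] at h
  have h1 : superWedge (N := 1 + 1) ![((1 : Fin 3) : ℕ), 1 + 1 - (1 : Fin 3)]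
      (by simp [Fin.sum_univ_two])
      (fun a u => α.form (![((1 : Fin 3) : ℕ), 1 + 1 - (1 : Fin 3)] a) x u) v =
      (α.form 1 x fun _ => v 0) * (α.form 1 x fun _ => v 1) -
        (α.form 1 x fun _ => v 1) * (α.form 1 x fun _ => v 0) := by
    have hu : (Finset.univ : Finset (Equiv.Perm (Fin 2))) = {1, Equiv.swap 0 1} := by decide
    unfold superWedge
    change _ • ∑ σ ∈ (Finset.univ : Finset (Equiv.Perm (Fin 2))), _ = _
    rw [hu, Finset.sum_pair (by decide)]
    simp [Fin.prod_univ_two]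
    rw [← sub_eq_add_neg]
    refine congrArg₂ (· - ·) (congrArg₂ (· * ·) ?_ ?_) (congrArg₂ (· * ·) ?_ ?_)
    all_goals
      refine congrArg (α.form 1 x) (funext fun (a : Fin 1) => ?_)
      obtain rfl : a = 0 := Subsingleton.elim _ _
      rfl
  rw [h1] at h
  rw [← h]
  simp [GradedComplex.bracket]

/-- The curvature of `α¹` is exact. -/
lemma FlatSuperconnection.curvature_eq (α : FlatSuperconnection E M C) {x₀ : M} {y : E}
    (hy : y ∈ (extChartAt 𝓘(ℝ, E) x₀).target) (X Y : E) :
    fderiv ℝ (α.connForm x₀) y X Y - fderiv ℝ (α.connForm x₀) y Y X +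
      (α.connForm x₀ y X * α.connForm x₀ y Y - α.connForm x₀ y Y * α.connForm x₀ y X) =
      -(C.diff * formInChart (α.form 2) x₀ y ![X, Y] +
        formInChart (α.form 2) x₀ y ![X, Y] * C.diff) := by
  have h1 := extDeriv_formInChart (α.smooth 1) hy ![X, Y]
  rw [extDeriv_eq_oneFormCLM (((α.smooth 1 x₀).contDiffAt
    ((isOpen_extChartAt_target x₀).mem_nhds hy)).differentiableAt (by simp))] at h1
  have h2 := α.flat_one ((extChartAt 𝓘(ℝ, E) x₀).symm y)
    (fun i => mfderiv 𝓘(ℝ, E) 𝓘(ℝ, E) (extChartAt 𝓘(ℝ, E) x₀).symm y (![X, Y] i))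
  rw [← h1] at h2
  rw [eq_neg_iff_add_eq_zero, ← h2]
  change _ = C.diff * formInChart (α.form 2) x₀ y ![X, Y] +
    formInChart (α.form 2) x₀ y ![X, Y] * C.diff + _ + _
  rw [add_comm, ← add_assoc]
  rfl

end ChartForms

/-! ### Piecewise smooth maps are locally Lipschitz and almost everywhere smooth -/

section NiceMaps

open Set Filter Topology

/-- Along a segment in `S`, some piece is visited at parameters arbitrarily close to the right of
any given time, and being closed it also contains the point at that time. So the lower right slopes
of the distance from the starting value are bounded by L times the length of the segment, which
suffices for a continuous function. -/
lemma lipschitzOnWith_of_finite_cover {X Y ι : Type*} [NormedAddCommGroup X] [NormedSpace ℝ X]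
    [NormedAddCommGroup Y] [Finite ι] {f : X → Y} {S : Set X} {K : ι → Set X} {L : NNReal}
    (hS : Convex ℝ S) (hf : ContinuousOn f S) (hK : ∀ i, IsClosed (K i)) (hcov : S ⊆ ⋃ i, K i)
    (hL : ∀ i, LipschitzOnWith L f (S ∩ K i)) : LipschitzOnWith L f S := by
  refine LipschitzOnWith.of_dist_le_mul fun y hy x hx => ?_
  set γ : ℝ → X := fun t => AffineMap.lineMap x y t with hγ
  have hγc : Continuous γ := AffineMap.lineMap_continuous
  have hγS : ∀ t ∈ Icc (0 : ℝ) 1, γ t ∈ S := fun t ht => hS.lineMap_mem hx hy ht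
  have hfγ : ContinuousOn (fun t => f (γ t)) (Icc 0 1) := hf.comp hγc.continuousOn hγS
  have hdist : ∀ s t, dist (γ s) (γ t) = |s - t| * dist x y := by
    intro s t
    rw [hγ, dist_lineMap_lineMap, Real.dist_eq]
  have key := image_le_of_liminf_slope_right_le_deriv_boundary
    (f := fun t => ‖f (γ t) - f x‖) (a := 0) (b := 1) (B := fun t => L * dist x y * t)
    (B' := fun _ => L * dist x y) (hfγ.sub continuousOn_const).norm (by simp [hγ]) (by fun_prop)
    (fun t _ => by simpa using ((hasDerivAt_id t).const_mul (L * dist x y : ℝ)).hasDerivWithinAt)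
    ?_ (right_mem_Icc.mpr zero_le_one)
  · simpa [hγ, dist_eq_norm, norm_sub_rev x y] using key
  · intro t ht r hr
    have h1 : ∀ᶠ z in 𝓝[>] t, z ∈ Ioo t 1 := Ioo_mem_nhdsGT ht.2
    have h2 : ∃ i, ∃ᶠ z in 𝓝[>] t, γ z ∈ K i := by
      by_contra! hcon
      have h3 : ∀ᶠ z in 𝓝[>] t, ∀ i, ¬ γ z ∈ K i :=
        eventually_all.mpr fun i => by simpa using hcon i
      obtain ⟨z, hz, hz'⟩ := (h1.and h3).exists
      obtain ⟨i, hi⟩ := mem_iUnion.mp (hcov (hγS z ⟨(ht.1.trans_lt hz.1).le, hz.2.le⟩))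
      exact hz' i hi
    obtain ⟨i, hi⟩ := h2
    have hti : γ t ∈ K i := (hK i).mem_of_frequently_of_tendsto hi
      (hγc.continuousAt.tendsto.mono_left nhdsWithin_le_nhds)
    refine (hi.and_eventually h1).mono fun z hz => ?_
    have hz0 : 0 < z - t := sub_pos.mpr hz.2.1
    have h4 := (hL i).dist_le_mul (γ z)
      ⟨hγS z ⟨(ht.1.trans_lt hz.2.1).le, hz.2.2.le⟩, hz.1⟩ (γ t) ⟨hγS t ⟨ht.1, ht.2.le⟩, hti⟩
    rw [hdist, abs_of_pos hz0, dist_eq_norm] at h4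
    refine lt_of_le_of_lt ?_ hr
    rw [slope_def_field, div_le_iff₀ hz0]
    calc ‖f (γ z) - f x‖ - ‖f (γ t) - f x‖ ≤ ‖(f (γ z) - f x) - (f (γ t) - f x)‖ :=
          norm_sub_norm_le _ _
      _ = ‖f (γ z) - f (γ t)‖ := by congr 1; abel
      _ ≤ _ := h4.trans (le_of_eq (by ring))

variable (E : Type*) [NormedAddCommGroup E] [NormedSpace ℝ E]
  {M : Type*} [TopologicalSpace M] [ChartedSpace E M]

/-- The interior points of the square near which `G` is smooth. -/
def regularSet (G : ℝ × ℝ → M) : Set (ℝ × ℝ) :=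
  {p | p ∈ interior square ∧ ContMDiffAt 𝓘(ℝ, ℝ × ℝ) 𝓘(ℝ, E) 2 G p}

/-- A map of the square into `M` that is locally Lipschitz, and smooth near almost every point. -/
structure NiceMap (G : ℝ × ℝ → M) : Prop where
  cont : ContinuousOn G square
  lip : ∀ p ∈ square, ∃ K : NNReal, ∃ U ∈ 𝓝 p,
    LipschitzOnWith K (fun q => extChartAt 𝓘(ℝ, E) (G p) (G q)) (square ∩ U)
  smooth_ae : ∀ᵐ p, p ∈ square → p ∈ regularSet E G

lemma convex_square : Convex ℝ square := (convex_Icc 0 1).prod (convex_Icc 0 1)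

lemma isCompact_square : IsCompact square := isCompact_Icc.prod isCompact_Icc

lemma interior_square : interior square = Ioo (0 : ℝ) 1 ×ˢ Ioo (0 : ℝ) 1 := by
  rw [square, interior_prod_eq, interior_Icc]

variable {E} [IsManifold 𝓘(ℝ, E) ∞ M]

lemma isOpen_regularSet (G : ℝ × ℝ → M) : IsOpen (regularSet E G) := by
  have : IsManifold 𝓘(ℝ, E) 2 M := IsManifold.of_le (n := ∞) (WithTop.coe_le_coe.mpr le_top)
  rw [isOpen_iff_mem_nhds]
  intro p hp
  exact inter_mem (isOpen_interior.mem_nhds hp.1)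
    ((contMDiffAt_iff_contMDiffAt_nhds (by decide)).mp hp.2)

lemma contDiffWithinAt_chart_comp {G : ℝ × ℝ → M} {n : WithTop ℕ∞} (hn : n ≤ ∞) {s : Set (ℝ × ℝ)}
    {p : ℝ × ℝ} {x₀ : M}
    (h : ContMDiffWithinAt 𝓘(ℝ, ℝ × ℝ) 𝓘(ℝ, E) n G s p)
    (hs : G p ∈ (extChartAt 𝓘(ℝ, E) x₀).source) :
    ContDiffWithinAt ℝ n (fun q => extChartAt 𝓘(ℝ, E) x₀ (G q)) s p := by
  have h2 : ContMDiffAt 𝓘(ℝ, E) 𝓘(ℝ, E) n (extChartAt 𝓘(ℝ, E) x₀) (G p) :=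
    (contMDiffAt_extChartAt' (n := ∞) (by simpa using hs)).of_le hn
  exact (h2.comp_contMDiffWithinAt p h).contDiffWithinAt

/-- In a chart each piece is locally Lipschitz up to its boundary, because a map that is C¹ on a
convex set is so, and the finitely many pieces are combined by `lipschitzOnWith_of_finite_cover`.
The boundary of a convex set is null, so almost every point is interior to some piece. -/
theorem IsPiecewiseSmooth.niceMap {G : ℝ × ℝ → M} (h : IsPiecewiseSmooth E G) : NiceMap E G := by
  obtain ⟨hc, r, K, hKc, hKx, hKU, hKs⟩ := h
  refine ⟨hc, fun p hp => ?_, ?_⟩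
  · have h1 : ∀ i, ∃ L : NNReal, ∃ U ∈ 𝓝 p,
        LipschitzOnWith L (fun q => extChartAt 𝓘(ℝ, E) (G p) (G q)) (K i ∩ U) := by
      intro i
      by_cases hpi : p ∈ K i
      · have h2 := contDiffWithinAt_chart_comp (x₀ := G p) le_rfl (hKs i p hpi)
          (mem_extChartAt_source (G p))
        obtain ⟨L, t, ht, hL⟩ := (h2.of_le (m := 1)
          (WithTop.coe_le_coe.mpr le_top)).exists_lipschitzOnWith (hKx i)
        obtain ⟨U, hU, hUt⟩ := mem_nhdsWithin_iff_exists_mem_nhds_inter.mp ht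
        exact ⟨L, U, hU, hL.mono (by rwa [inter_comm])⟩
      · refine ⟨0, (K i)ᶜ, (hKc i).isOpen_compl.mem_nhds hpi, ?_⟩
        rw [inter_compl_self]
        exact LipschitzOnWith.of_dist_le_mul fun x hx => hx.elim
    choose L U hU hL using h1
    have h3 : ∃ V ∈ 𝓝 p, ∀ q ∈ square ∩ V, G q ∈ (extChartAt 𝓘(ℝ, E) (G p)).source := by
      have := (hc p hp).preimage_mem_nhdsWithin (extChartAt_source_mem_nhds (I := 𝓘(ℝ, E)) (G p))
      obtain ⟨V, hV, hV'⟩ := mem_nhdsWithin_iff_exists_mem_nhds_inter.mp this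
      exact ⟨V, hV, fun q hq => hV' ⟨hq.2, hq.1⟩⟩
    obtain ⟨V, hV, hV'⟩ := h3
    obtain ⟨ε, hε, hball⟩ := Metric.mem_nhds_iff.mp (inter_mem hV (iInter_mem.mpr hU))
    refine ⟨Finset.univ.sup L, Metric.ball p ε, Metric.ball_mem_nhds p hε, ?_⟩
    refine lipschitzOnWith_of_finite_cover (convex_square.inter (convex_ball p ε)) ?_ hKc
      (inter_subset_left.trans hKU.symm.subset) fun i => ?_
    · refine ContinuousOn.comp (continuousOn_extChartAt (G p)) (hc.mono inter_subset_left)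
        fun q hq => hV' q ⟨hq.1, (hball hq.2).1⟩
    · exact ((hL i).weaken (Finset.le_sup (Finset.mem_univ i))).mono fun q hq =>
        ⟨hq.2, mem_iInter.mp (hball hq.1.2).2 i⟩
  · have h1 : ∀ᵐ p : ℝ × ℝ, ∀ i, p ∉ frontier (K i) := by
      rw [ae_all_iff]
      intro i
      have := (hKx i).addHaar_frontier (volume : Measure (ℝ × ℝ))
      rwa [measure_eq_zero_iff_ae_notMem] at this
    filter_upwards [h1] with p hp hps
    rw [← hKU] at hps
    obtain ⟨i, hi⟩ := mem_iUnion.mp hps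
    have hint : p ∈ interior (K i) := by
      by_contra hcon
      exact hp i ⟨subset_closure hi, hcon⟩
    refine ⟨interior_mono (hKU ▸ subset_iUnion K i) hint, ?_⟩
    exact ((hKs i).contMDiffAt (mem_interior_iff_mem_nhds.mp hint)).of_le
      (WithTop.coe_le_coe.mpr le_top)

/-- A map that is given on two closed convex sets by precomposing a piecewise smooth map with
affine maps is piecewise smooth. -/
lemma IsPiecewiseSmooth.comp_affine {Γ G : ℝ × ℝ → M} (h : IsPiecewiseSmooth E Γ)
    {D D' : Set (ℝ × ℝ)} (hD : IsClosed D) (hD' : IsClosed D') (hDx : Convex ℝ D)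
    (hDx' : Convex ℝ D') (hU : D ∪ D' = square) (T T' : (ℝ × ℝ) →ᴬ[ℝ] (ℝ × ℝ))
    (hT : ∀ p ∈ D, T p ∈ square ∧ G p = Γ (T p))
    (hT' : ∀ p ∈ D', T' p ∈ square ∧ G p = Γ (T' p)) : IsPiecewiseSmooth E G := by
  obtain ⟨hc, r, K, hKc, hKx, hKU, hKs⟩ := h
  have hcont : ∀ {D : Set (ℝ × ℝ)} {T : (ℝ × ℝ) →ᴬ[ℝ] (ℝ × ℝ)},
      (∀ p ∈ D, T p ∈ square ∧ G p = Γ (T p)) → ContinuousOn G D := fun {D T} hT =>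
    (hc.comp T.continuous.continuousOn fun p hp => (hT p hp).1).congr fun p hp => (hT p hp).2
  have hsmooth : ∀ {D : Set (ℝ × ℝ)} {T : (ℝ × ℝ) →ᴬ[ℝ] (ℝ × ℝ)} (i : Fin r),
      (∀ p ∈ D, T p ∈ square ∧ G p = Γ (T p)) →
      ContMDiffOn 𝓘(ℝ, ℝ × ℝ) 𝓘(ℝ, E) ∞ G (D ∩ T ⁻¹' K i) := fun {D T} i hT =>
    ((hKs i).comp (T.contDiff.contMDiff.contMDiffOn) fun p hp => hp.2).congr
      fun p hp => (hT p hp.1).2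
  refine ⟨hU ▸ (hcont hT).union_of_isClosed (hcont hT') hD hD', r + r,
    fun i => Sum.elim (fun i => D ∩ T ⁻¹' K i) (fun i => D' ∩ T' ⁻¹' K i) (finSumFinEquiv.symm i),
    fun i => ?_, fun i => ?_, ?_, fun i => ?_⟩
  · dsimp only
    rcases finSumFinEquiv.symm i with i | i
    · exact hD.inter ((hKc i).preimage T.continuous)
    · exact hD'.inter ((hKc i).preimage T'.continuous)
  · dsimp only
    rcases finSumFinEquiv.symm i with i | i
    · exact hDx.inter ((hKx i).affine_preimage T.toAffineMap)
    · exact hDx'.inter ((hKx i).affine_preimage T'.toAffineMap)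
  · have h1 : ∀ {D : Set (ℝ × ℝ)} {T : (ℝ × ℝ) →ᴬ[ℝ] (ℝ × ℝ)},
        (∀ p ∈ D, T p ∈ square ∧ G p = Γ (T p)) → ⋃ i, D ∩ T ⁻¹' K i = D := fun {D T} hT => by
      rw [← inter_iUnion, ← preimage_iUnion, hKU]
      exact inter_eq_left.mpr fun p hp => (hT p hp).1
    rw [(finSumFinEquiv (m := r) (n := r)).symm.surjective.iUnion_comp
      (fun x => Sum.elim (fun i => D ∩ T ⁻¹' K i) (fun i => D' ∩ T' ⁻¹' K i) x), iUnion_sum]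
    simp only [Sum.elim_inl, Sum.elim_inr]
    rw [h1 hT, h1 hT', hU]
  · dsimp only
    rcases finSumFinEquiv.symm i with i | i
    · exact hsmooth i hT
    · exact hsmooth i hT'

end NiceMaps

/-! ### Pullbacks along almost everywhere smooth maps -/

section Pullbacks

set_option maxSynthPendingDepth 3

open Set Filter Topology

variable {E : Type*} [NormedAddCommGroup E] [NormedSpace ℝ E]
  {M : Type*} [TopologicalSpace M] [ChartedSpace E M] [IsManifold 𝓘(ℝ, E) ∞ M]
  {V : Type*} [NormedAddCommGroup V] [NormedSpace ℝ V] [FiniteDimensional ℝ V]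
  {C : GradedComplex V}

/-- On `S`, the map `G` takes values in a chart, and is Lipschitz there. -/
structure ChartCell (α : FlatSuperconnection E M C) (G : ℝ × ℝ → M) (x₀ : M) (K : NNReal)
    (S : Set (ℝ × ℝ)) : Prop where
  maps : ∀ p ∈ S, G p ∈ (extChartAt 𝓘(ℝ, E) x₀).source
  lip : LipschitzOnWith K (fun q => extChartAt 𝓘(ℝ, E) x₀ (G q)) S
  A_lip : LipschitzOnWith K (fun q => α.connForm x₀ (extChartAt 𝓘(ℝ, E) x₀ (G q))) S
  A_le : ∀ p ∈ S, ‖α.connForm x₀ (extChartAt 𝓘(ℝ, E) x₀ (G p))‖ ≤ K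
  dA_le : ∀ p ∈ S, ‖fderiv ℝ (α.connForm x₀) (extChartAt 𝓘(ℝ, E) x₀ (G p))‖ ≤ K
  B_le : ∀ p ∈ S, ‖formInChart (α.form 2) x₀ (extChartAt 𝓘(ℝ, E) x₀ (G p))‖ ≤ K

lemma ChartCell.mono {α : FlatSuperconnection E M C} {G : ℝ × ℝ → M} {x₀ : M} {K : NNReal}
    {S S' : Set (ℝ × ℝ)} (h : ChartCell α G x₀ K S) (hS : S' ⊆ S) : ChartCell α G x₀ K S' :=
  ⟨fun p hp => h.maps p (hS hp), h.lip.mono hS, h.A_lip.mono hS, fun p hp => h.A_le p (hS hp),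
    fun p hp => h.dA_le p (hS hp), fun p hp => h.B_le p (hS hp)⟩

lemma NiceMap.exists_chartCell {G : ℝ × ℝ → M} (hG : NiceMap E G) (α : FlatSuperconnection E M C)
    {p : ℝ × ℝ} (hp : p ∈ square) :
    ∃ x₀ K, ∃ U, IsOpen U ∧ p ∈ U ∧ ChartCell α G x₀ K (square ∩ U) := by
  obtain ⟨K₀, U₀, hU₀, hL⟩ := hG.lip p hp
  set φ := extChartAt 𝓘(ℝ, E) (G p) with hφ
  set y := φ (G p) with hy
  have hyt : y ∈ φ.target := φ.map_source (mem_extChartAt_source (G p))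
  have hA := α.contDiffAt_connForm hyt
  have hB : ContinuousAt (formInChart (α.form 2) (G p)) y :=
    ((α.smooth 2 (G p)).contDiffAt ((isOpen_extChartAt_target (G p)).mem_nhds hyt)).continuousAt
  obtain ⟨K₁, t, ht, hK₁⟩ := (hA.of_le (m := 1) (WithTop.coe_le_coe.mpr le_top)).exists_lipschitzOnWith
  have hdA := hA.continuousAt_fderiv (by simp)
  have hb : ∀ {X : Type _} [NormedAddCommGroup X] {F : E → X}, ContinuousAt F y →
      ∃ c : NNReal, ∀ᶠ z in 𝓝 y, ‖F z‖ ≤ c := fun {X} _ {F} hF =>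
    ⟨‖F y‖₊ + 1, (hF.norm.eventually_lt continuousAt_const (lt_add_one _)).mono fun z hz => hz.le⟩
  obtain ⟨c₁, hc₁⟩ := hb hA.continuousAt
  obtain ⟨c₂, hc₂⟩ := hb hdA
  obtain ⟨c₃, hc₃⟩ := hb hB
  have hfc : ContinuousWithinAt (fun q => φ (G q)) square p :=
    (continuousAt_extChartAt (G p)).comp_continuousWithinAt (hG.cont p hp)
  have hev : ∀ᶠ q in 𝓝[square] p, G q ∈ φ.source ∧ φ (G q) ∈ t ∧
      ‖α.connForm (G p) (φ (G q))‖ ≤ c₁ ∧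
      ‖fderiv ℝ (α.connForm (G p)) (φ (G q))‖ ≤ c₂ ∧
      ‖formInChart (α.form 2) (G p) (φ (G q))‖ ≤ c₃ := by
    filter_upwards [(hG.cont p hp).preimage_mem_nhdsWithin
      (extChartAt_source_mem_nhds (I := 𝓘(ℝ, E)) (G p)), hfc.eventually ht,
      hfc.eventually hc₁, hfc.eventually hc₂, hfc.eventually hc₃]
      with q h1 h2 h3 h4 h5 using ⟨h1, h2, h3, h4, h5⟩
  obtain ⟨U₁, hU₁, hU₁'⟩ := mem_nhdsWithin_iff_exists_mem_nhds_inter.mp hev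
  obtain ⟨U, hUs, hUo, hpU⟩ := mem_nhds_iff.mp (inter_mem hU₀ hU₁)
  have hS : ∀ q ∈ square ∩ U, _ := fun q hq => hU₁' ⟨(hUs hq.2).2, hq.1⟩
  have hL' : LipschitzOnWith K₀ (fun q => φ (G q)) (square ∩ U) :=
    hL.mono fun q hq => ⟨hq.1, (hUs hq.2).1⟩
  refine ⟨G p, K₀ + K₁ * K₀ + (c₁ + c₂ + c₃), U, hUo, hpU, fun q hq => (hS q hq).1, hL'.weaken ?_,
    (hK₁.comp hL' fun q hq => (hS q hq).2.1).weaken ?_, fun q hq => ?_, fun q hq => ?_,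
    fun q hq => ?_⟩
  · rw [add_assoc]; exact le_self_add
  · rw [add_comm K₀, add_assoc]; exact le_self_add
  · exact (hS q hq).2.2.1.trans (NNReal.coe_le_coe.mpr ((le_self_add.trans le_self_add).trans
      le_add_self))
  · exact (hS q hq).2.2.2.1.trans (NNReal.coe_le_coe.mpr ((le_add_self.trans le_self_add).trans
      le_add_self))
  · exact (hS q hq).2.2.2.2.trans (NNReal.coe_le_coe.mpr (le_add_self.trans le_add_self))

/-- A fine enough grid subdivides the square into chart cells. -/
lemma NiceMap.exists_grid {G : ℝ × ℝ → M} (hG : NiceMap E G) (α : FlatSuperconnection E M C) :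
    ∃ δ > 0, ∀ u₀ u₁ v₀ v₁ : ℝ, 0 ≤ u₀ → u₀ ≤ u₁ → u₁ ≤ 1 → 0 ≤ v₀ → v₀ ≤ v₁ → v₁ ≤ 1 →
      u₁ - u₀ < δ → v₁ - v₀ < δ → ∃ x₀ K, ChartCell α G x₀ K (Icc u₀ u₁ ×ˢ Icc v₀ v₁) := by
  have h1 : ∀ p : square, ∃ x₀ K, ∃ U, IsOpen U ∧ (p : ℝ × ℝ) ∈ U ∧
      ChartCell α G x₀ K (square ∩ U) := fun p => hG.exists_chartCell α p.2
  choose x₀ K U hUo hpU hcell using h1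
  obtain ⟨δ, hδ, hδ'⟩ := lebesgue_number_lemma_of_metric isCompact_square hUo
    (fun p hp => mem_iUnion.mpr ⟨⟨p, hp⟩, hpU _⟩)
  refine ⟨δ, hδ, fun u₀ u₁ v₀ v₁ h0 h1 h2 h3 h4 h5 h6 h7 => ?_⟩
  obtain ⟨i, hi⟩ := hδ' (u₀, v₀) ⟨⟨h0, h1.trans h2⟩, ⟨h3, h4.trans h5⟩⟩
  refine ⟨x₀ i, K i, (hcell i).mono fun p hp => ⟨⟨⟨h0.trans hp.1.1, hp.1.2.trans h2⟩,
    ⟨h3.trans hp.2.1, hp.2.2.trans h5⟩⟩, hi ?_⟩⟩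
  rw [Metric.mem_ball, Prod.dist_eq, Real.dist_eq, Real.dist_eq]
  refine max_lt ?_ ?_ <;> rw [abs_lt] <;> constructor <;>
    linarith [hp.1.1, hp.1.2, hp.2.1, hp.2.2]

/-- The pullback of `α¹` along the horizontal line through `p`, evaluated on the unit vector. -/
def hor (α : FlatSuperconnection E M C) (G : ℝ × ℝ → M) (p : ℝ × ℝ) : V →L[ℝ] V :=
  open Classical in
  if p.1 ∈ Ioo (0 : ℝ) 1 ∧ p.2 ∈ Icc (0 : ℝ) 1 then
    α.form 1 (G (p.1, p.2)) fun _ => mfderiv 𝓘(ℝ, ℝ) 𝓘(ℝ, E) (fun x => G (x, p.2)) p.1 (1 : ℝ)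
  else 0

/-- The pullback of `α¹` along the vertical line through `p`, evaluated on the unit vector. -/
def ver (α : FlatSuperconnection E M C) (G : ℝ × ℝ → M) (p : ℝ × ℝ) : V →L[ℝ] V :=
  hor α (G ∘ Prod.swap) p.swap

/-- The pullback of `α²`, set to zero at the points where the map is not smooth. -/
def area (α : FlatSuperconnection E M C) (G : ℝ × ℝ → M) : ℝ × ℝ → V →L[ℝ] V :=
  (regularSet E G).indicator (pullTwo α G)

lemma continuousAt_slice {G : ℝ × ℝ → M} (hG : ContinuousOn G square) {u v : ℝ}
    (hu : u ∈ Ioo (0 : ℝ) 1) (hv : v ∈ Icc (0 : ℝ) 1) : ContinuousAt (fun x => G (x, v)) u :=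
  (hG.comp (f := fun x => (x, v)) (by fun_prop) fun _ hx => ⟨hx, hv⟩).continuousAt
    (Icc_mem_nhds hu.1 hu.2)

/-- Since `hor` differentiates the restriction of G to the line, this holds on every horizontal
line, including the edges, where G need not be differentiable in two variables. Where the
restriction has no derivative, both sides vanish by convention. -/
lemma hor_eq_chart (α : FlatSuperconnection E M C) {G : ℝ × ℝ → M} (hG : ContinuousOn G square)
    {u v : ℝ} (hu : u ∈ Ioo (0 : ℝ) 1) (hv : v ∈ Icc (0 : ℝ) 1) {x₀ : M}
    (hs : G (u, v) ∈ (extChartAt 𝓘(ℝ, E) x₀).source) :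
    hor α G (u, v) = α.connForm x₀ (extChartAt 𝓘(ℝ, E) x₀ (G (u, v)))
      (deriv (fun x => extChartAt 𝓘(ℝ, E) x₀ (G (x, v))) u) := by
  rw [hor, if_pos ⟨hu, hv⟩]
  exact form_pullback_eq (α.form 1) (H := fun x => G (x, v)) (continuousAt_slice hG hu hv) hs
    fun _ => (1 : ℝ)

/-- In a chart cell the derivative is bounded by the Lipschitz constant; compactness of the square
makes the bound global. -/
lemma NiceMap.exists_hor_le {G : ℝ × ℝ → M} (hG : NiceMap E G) (α : FlatSuperconnection E M C) :
    ∃ c, ∀ p, ‖hor α G p‖ ≤ c := by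
  have h : ∃ c, ∀ p ∈ square, ‖hor α G p‖ ≤ c := by
    refine isCompact_square.induction_on (p := fun S => ∃ c, ∀ p ∈ S, ‖hor α G p‖ ≤ c)
      ⟨0, by simp⟩ (fun s t hst ⟨c, hc⟩ => ⟨c, fun p hp => hc p (hst hp)⟩)
      (fun s t ⟨c, hc⟩ ⟨d, hd⟩ => ⟨max c d, fun p hp => hp.elim
        (fun h => (hc p h).trans (le_max_left _ _)) (fun h => (hd p h).trans (le_max_right _ _))⟩) ?_
    intro p hp
    obtain ⟨x₀, K, U, hU, hpU, hcell⟩ := hG.exists_chartCell α hp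
    refine ⟨square ∩ U, inter_mem self_mem_nhdsWithin (nhdsWithin_le_nhds (hU.mem_nhds hpU)),
      K * K, fun q hq => ?_⟩
    by_cases hq1 : q.1 ∈ Ioo (0 : ℝ) 1
    · have := hor_eq_chart α hG.cont hq1 hq.1.2 (hcell.maps q hq)
      rw [Prod.mk.eta] at this
      rw [this]
      refine (ContinuousLinearMap.le_opNorm _ _).trans
        (mul_le_mul (hcell.A_le q hq) ?_ (norm_nonneg _) K.2)
      refine norm_deriv_le_of_lipschitzOn (s := {x | (x, q.2) ∈ square ∩ U}) ?_ ?_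
      · have h1 : {x : ℝ | (x, q.2) ∈ U} ∈ 𝓝 q.1 :=
          (hU.preimage (f := fun x : ℝ => (x, q.2)) (by fun_prop)).mem_nhds hq.2
        filter_upwards [h1, Icc_mem_nhds hq1.1 hq1.2] with x hx hx'
        exact ⟨⟨hx', hq.1.2⟩, hx⟩
      · have := hcell.lip.comp (f := fun x : ℝ => (x, q.2))
          (LipschitzWith.prodMk_right q.2).lipschitzOnWith (s := {x | (x, q.2) ∈ square ∩ U})
          (fun x hx => hx)
        rwa [mul_one] at this
    · rw [hor, if_neg fun h => hq1 h.1, norm_zero]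
      positivity
  obtain ⟨c, hc⟩ := h
  refine ⟨max c 0, fun p => ?_⟩
  by_cases hp : p ∈ square
  · exact (hc p hp).trans (le_max_left _ _)
  · rw [hor, if_neg fun h => hp ⟨Ioo_subset_Icc_self h.1, h.2⟩, norm_zero]
    exact le_max_right _ _

/-- Locally `hor` is a continuous field of linear maps applied to a derivative, and `deriv` is
always measurable. The result concerns each line and not just almost every one, since the edges are
used later. -/
lemma NiceMap.aestronglyMeasurable_hor {G : ℝ × ℝ → M} (hG : NiceMap E G)
    [FiniteDimensional ℝ E] (α : FlatSuperconnection E M C) (v : ℝ) :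
    AEStronglyMeasurable (fun u => hor α G (u, v)) (volume.restrict (Icc 0 1)) := by
  by_cases hv : v ∈ Icc (0 : ℝ) 1
  swap
  · have : (fun u => hor α G (u, v)) = fun _ => 0 := by
      funext u; rw [hor, if_neg fun h => hv h.2]
    rw [this]
    exact aestronglyMeasurable_const
  refine isCompact_Icc.induction_on
    (p := fun S => AEStronglyMeasurable (fun u => hor α G (u, v)) (volume.restrict S))
    (by simp) (fun s t hst h => h.mono_set hst)
    (fun s t hs ht => aestronglyMeasurable_union_iff.mpr ⟨hs, ht⟩) ?_
  intro u hu
  obtain ⟨x₀, K, U, hU, hpU, hcell⟩ := hG.exists_chartCell α (p := (u, v)) ⟨hu, hv⟩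
  have hUo : IsOpen {x : ℝ | (x, v) ∈ U} := hU.preimage (f := fun x : ℝ => (x, v)) (by fun_prop)
  refine ⟨Icc 0 1 ∩ {x | (x, v) ∈ U}, inter_mem self_mem_nhdsWithin
    (nhdsWithin_le_nhds (hUo.mem_nhds hpU)), ?_⟩
  have hmeas : MeasurableSet (Icc (0 : ℝ) 1 ∩ {x | (x, v) ∈ U}) :=
    measurableSet_Icc.inter hUo.measurableSet
  have h1 : ContinuousOn (fun x => α.connForm x₀ (extChartAt 𝓘(ℝ, E) x₀ (G (x, v))))
      (Icc (0 : ℝ) 1 ∩ {x | (x, v) ∈ U}) :=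
    hcell.A_lip.continuousOn.comp (f := fun x : ℝ => (x, v)) (by fun_prop)
      fun x hx => ⟨⟨hx.1, hv⟩, hx.2⟩
  have h2 := (isBoundedBilinearMap_apply (𝕜 := ℝ) (E := E) (F := V →L[ℝ] V)).continuous.comp_aestronglyMeasurable
    ((h1.aestronglyMeasurable (μ := volume) hmeas).prodMk (stronglyMeasurable_deriv
      (fun x => extChartAt 𝓘(ℝ, E) x₀ (G (x, v)))).aestronglyMeasurable)
  refine h2.congr ?_
  rw [EventuallyEq, ae_restrict_iff' hmeas]
  filter_upwards [ae_ne_real 0, ae_ne_real 1] with x hx0 hx1 hx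
  exact (hor_eq_chart α hG.cont ⟨lt_of_le_of_ne hx.1.1 hx0.symm, lt_of_le_of_ne hx.1.2 hx1⟩ hv
    (hcell.maps (x, v) ⟨⟨hx.1, hv⟩, hx.2⟩)).symm

/-! #### Points of smoothness -/

lemma pullOne_eq_chart (α : FlatSuperconnection E M C) {G : ℝ × ℝ → M} {p : ℝ × ℝ}
    (hG : ContinuousAt G p) {x₀ : M} (hs : G p ∈ (extChartAt 𝓘(ℝ, E) x₀).source) (w : ℝ × ℝ) :
    pullOne α G p w = α.connForm x₀ (extChartAt 𝓘(ℝ, E) x₀ (G p))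
      (fderiv ℝ (fun q => extChartAt 𝓘(ℝ, E) x₀ (G q)) p w) :=
  form_pullback_eq (α.form 1) hG hs fun _ => w

lemma pullTwo_eq_chart (α : FlatSuperconnection E M C) {G : ℝ × ℝ → M} {p : ℝ × ℝ}
    (hG : ContinuousAt G p) {x₀ : M} (hs : G p ∈ (extChartAt 𝓘(ℝ, E) x₀).source) :
    pullTwo α G p = formInChart (α.form 2) x₀ (extChartAt 𝓘(ℝ, E) x₀ (G p))
      ![fderiv ℝ (fun q => extChartAt 𝓘(ℝ, E) x₀ (G q)) p (1, 0),
        fderiv ℝ (fun q => extChartAt 𝓘(ℝ, E) x₀ (G q)) p (0, 1)] := by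
  have h := form_pullback_eq (α.form 2) hG hs ![((1 : ℝ), (0 : ℝ)), (0, 1)]
  refine Eq.trans ?_ (h.trans ?_)
  · refine congrArg (α.form 2 (G p)) (funext fun i => ?_)
    fin_cases i <;> rfl
  · refine congrArg (formInChart (α.form 2) x₀ _) (funext fun i => ?_)
    fin_cases i <;> rfl

lemma mdifferentiableAt_of_mem_regularSet {G : ℝ × ℝ → M} {p : ℝ × ℝ} (hp : p ∈ regularSet E G) :
    MDifferentiableAt 𝓘(ℝ, ℝ × ℝ) 𝓘(ℝ, E) G p :=
  hp.2.mdifferentiableAt (by simp)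

lemma hor_eq_pullOne_of_mdifferentiableAt (α : FlatSuperconnection E M C) {G : ℝ × ℝ → M} {u v : ℝ}
    (hu : u ∈ Ioo (0 : ℝ) 1) (hv : v ∈ Icc (0 : ℝ) 1)
    (hG : MDifferentiableAt 𝓘(ℝ, ℝ × ℝ) 𝓘(ℝ, E) G (u, v)) :
    hor α G (u, v) = pullOne α G (u, v) (1, 0) := by
  rw [hor, if_pos ⟨hu, hv⟩]
  have h1 : HasFDerivAt (fun x : ℝ => (x, v)) (ContinuousLinearMap.inl ℝ ℝ ℝ) u :=
    (hasFDerivAt_prodMk_left u v)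
  have h2 := mfderiv_comp (I := 𝓘(ℝ, ℝ)) (I' := 𝓘(ℝ, ℝ × ℝ)) (I'' := 𝓘(ℝ, E)) u
    (g := G) (f := fun x => (x, v)) hG h1.differentiableAt.mdifferentiableAt
  rw [mfderiv_eq_fderiv (f := fun x : ℝ => (x, v)), h1.fderiv] at h2
  refine congrArg (α.form 1 (G (u, v))) (funext fun _ => ?_)
  exact congrArg (fun (L : ℝ →L[ℝ] E) => L (1 : ℝ)) h2

lemma mem_regularSet_swap {G : ℝ × ℝ → M} {p : ℝ × ℝ} (hp : p ∈ regularSet E G) :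
    p.swap ∈ regularSet E (G ∘ Prod.swap) := by
  refine ⟨?_, ?_⟩
  · have := hp.1
    rw [interior_square] at this ⊢
    exact ⟨this.2, this.1⟩
  · have h1 : ContMDiffAt 𝓘(ℝ, ℝ × ℝ) 𝓘(ℝ, ℝ × ℝ) 2 (Prod.swap : ℝ × ℝ → ℝ × ℝ) p.swap :=
      (contDiff_snd.prodMk contDiff_fst).contMDiff.contMDiffAt
    refine ContMDiffAt.comp p.swap ?_ h1
    simpa using hp.2

lemma hor_eq_pullOne (α : FlatSuperconnection E M C) {G : ℝ × ℝ → M} {p : ℝ × ℝ}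
    (hp : p ∈ regularSet E G) : hor α G p = pullOne α G p (1, 0) := by
  have := hp.1
  rw [interior_square] at this
  exact hor_eq_pullOne_of_mdifferentiableAt α this.1 (Ioo_subset_Icc_self this.2)
    (mdifferentiableAt_of_mem_regularSet hp)

/-- Being C² near a regular point, the map has continuous first derivatives there. As the regular
set is open, this makes the pullbacks, extended by zero, measurable. -/
lemma continuousAt_pull (α : FlatSuperconnection E M C) {G : ℝ × ℝ → M} {p : ℝ × ℝ}
    (hp : p ∈ regularSet E G) (w : ℝ × ℝ) :
    ContinuousAt (fun q => pullOne α G q w) p ∧ ContinuousAt (pullTwo α G) p := by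
  set φ := extChartAt 𝓘(ℝ, E) (G p) with hφ
  have hf : ContDiffAt ℝ 2 (fun q => φ (G q)) p := by
    rw [← contDiffWithinAt_univ]
    exact contDiffWithinAt_chart_comp (WithTop.coe_le_coe.mpr le_top) hp.2.contMDiffWithinAt
      (mem_extChartAt_source (G p))
  have hft : φ (G p) ∈ φ.target := φ.map_source (mem_extChartAt_source (G p))
  have hfd := hf.continuousAt_fderiv (by simp)
  have hev : ∀ᶠ q in 𝓝 p, ContinuousAt G q ∧ G q ∈ φ.source := by
    filter_upwards [(isOpen_regularSet (E := E) G).mem_nhds hp, hp.2.continuousAt.preimage_mem_nhds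
      (extChartAt_source_mem_nhds (I := 𝓘(ℝ, E)) (G p))] with q hq hq'
    exact ⟨hq.2.continuousAt, hq'⟩
  constructor
  · have h1 : (fun q => pullOne α G q w) =ᶠ[𝓝 p] fun q => α.connForm (G p) (φ (G q))
        (fderiv ℝ (fun q => φ (G q)) q w) := by
      filter_upwards [hev] with q hq
      exact pullOne_eq_chart α hq.1 hq.2 w
    refine ContinuousAt.congr ?_ h1.symm
    have hA : ContinuousAt (fun q => α.connForm (G p) (φ (G q))) p :=
      ContinuousAt.comp (f := fun q => φ (G q)) (α.contDiffAt_connForm hft).continuousAt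
        hf.continuousAt
    exact hA.clm_apply (hfd.clm_apply continuousAt_const)
  · have h1 : pullTwo α G =ᶠ[𝓝 p] fun q => formInChart (α.form 2) (G p) (φ (G q))
        ![fderiv ℝ (fun q => φ (G q)) q (1, 0), fderiv ℝ (fun q => φ (G q)) q (0, 1)] := by
      filter_upwards [hev] with q hq
      exact pullTwo_eq_chart α hq.1 hq.2
    refine ContinuousAt.congr ?_ h1.symm
    have hB : ContinuousAt (fun q => formInChart (α.form 2) (G p) (φ (G q))) p :=
      ContinuousAt.comp (f := fun q => φ (G q)) ((α.smooth 2 (G p)).contDiffAt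
        ((isOpen_extChartAt_target (G p)).mem_nhds hft)).continuousAt hf.continuousAt
    have hv : ContinuousAt (fun q => ![fderiv ℝ (fun q => φ (G q)) q ((1 : ℝ), (0 : ℝ)),
        fderiv ℝ (fun q => φ (G q)) q (0, 1)]) p := by
      rw [continuousAt_pi]
      intro i
      fin_cases i
      · exact hfd.clm_apply continuousAt_const
      · exact hfd.clm_apply continuousAt_const
    exact (ContinuousAlternatingMap.continuous_toContinuousMultilinearMap.continuousAt.comp
      (f := fun q => formInChart (α.form 2) (G p) (φ (G q))) hB).eval hv

lemma stronglyMeasurable_indicator_of_continuousOn {X : Type*} [NormedAddCommGroup X]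
    [NormedSpace ℝ X] [FiniteDimensional ℝ X] {S : Set (ℝ × ℝ)} (hS : MeasurableSet S) {f : ℝ × ℝ → X}
    (hf : ContinuousOn f S) : StronglyMeasurable (S.indicator f) := by
  borelize X
  have : Measurable (S.indicator f) := by
    classical
    rw [← piecewise_eq_indicator]
    exact hf.measurable_piecewise continuousOn_const hS
  exact this.stronglyMeasurable

lemma stronglyMeasurable_area (α : FlatSuperconnection E M C) (G : ℝ × ℝ → M) :
    StronglyMeasurable (area α G) :=
  stronglyMeasurable_indicator_of_continuousOn (isOpen_regularSet G).measurableSet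
    fun _ hp => (continuousAt_pull α hp 0).2.continuousWithinAt

lemma stronglyMeasurable_indicator_pullOne (α : FlatSuperconnection E M C) (G : ℝ × ℝ → M)
    (w : ℝ × ℝ) : StronglyMeasurable ((regularSet E G).indicator fun p => pullOne α G p w) :=
  stronglyMeasurable_indicator_of_continuousOn (isOpen_regularSet G).measurableSet
    fun _ hp => (continuousAt_pull α hp w).1.continuousWithinAt

lemma NiceMap.exists_area_le {G : ℝ × ℝ → M} (hG : NiceMap E G) (α : FlatSuperconnection E M C) :
    ∃ c, ∀ p, ‖area α G p‖ ≤ c := by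
  have h : ∃ c, ∀ p ∈ square, ‖area α G p‖ ≤ c := by
    refine isCompact_square.induction_on (p := fun S => ∃ c, ∀ p ∈ S, ‖area α G p‖ ≤ c)
      ⟨0, by simp⟩ (fun s t hst ⟨c, hc⟩ => ⟨c, fun p hp => hc p (hst hp)⟩)
      (fun s t ⟨c, hc⟩ ⟨d, hd⟩ => ⟨max c d, fun p hp => hp.elim
        (fun h => (hc p h).trans (le_max_left _ _)) (fun h => (hd p h).trans (le_max_right _ _))⟩) ?_
    intro p hp
    obtain ⟨x₀, K, U, hU, hpU, hcell⟩ := hG.exists_chartCell α hp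
    refine ⟨square ∩ U, inter_mem self_mem_nhdsWithin (nhdsWithin_le_nhds (hU.mem_nhds hpU)),
      K * (K * K), fun q hq => ?_⟩
    by_cases hqr : q ∈ regularSet E G
    · have hd : ‖fderiv ℝ (fun q => extChartAt 𝓘(ℝ, E) x₀ (G q)) q‖ ≤ K :=
        norm_fderiv_le_of_lipschitzOn ℝ (inter_mem (mem_interior_iff_mem_nhds.mp hqr.1)
          (hU.mem_nhds hq.2)) hcell.lip
      have hw : ∀ w : ℝ × ℝ, ‖w‖ = 1 → ‖fderiv ℝ (fun q => extChartAt 𝓘(ℝ, E) x₀ (G q)) q w‖ ≤ K :=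
        fun w hw => (ContinuousLinearMap.le_opNorm _ _).trans (by rw [hw, mul_one]; exact hd)
      rw [area, indicator_of_mem hqr, pullTwo_eq_chart α hqr.2.continuousAt (hcell.maps q hq)]
      refine (ContinuousAlternatingMap.le_opNorm _ _).trans
        (mul_le_mul (hcell.B_le q hq) ?_ (Finset.prod_nonneg fun _ _ => norm_nonneg _) K.2)
      rw [Fin.prod_univ_two]
      exact mul_le_mul (hw _ (by simp [Prod.norm_def])) (hw _ (by simp [Prod.norm_def]))
        (norm_nonneg _) K.2
    · rw [area, indicator_of_notMem hqr, norm_zero]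
      positivity
  obtain ⟨c, hc⟩ := h
  refine ⟨max c 0, fun p => ?_⟩
  by_cases hp : p ∈ square
  · exact (hc p hp).trans (le_max_left _ _)
  · rw [area, indicator_of_notMem fun h => hp (interior_subset h.1), norm_zero]
    exact le_max_right _ _

end Pullbacks

/-! ### Graded endomorphisms -/

section GradedEnd

variable {V : Type*} [NormedAddCommGroup V] [NormedSpace ℝ V] [FiniteDimensional ℝ V]

namespace GradedComplex

variable (C : GradedComplex V)

lemma mul_mem_endDeg {e e' e'' : ℤ} {f g : V →L[ℝ] V} (hf : f ∈ C.endDeg e) (hg : g ∈ C.endDeg e')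
    (h : e + e' = e'') : f * g ∈ C.endDeg e'' := by
  intro p v hv
  have h1 := hf _ _ (hg p v hv)
  rwa [add_assoc, add_comm e', h] at h1

lemma isClosed_submodule (S : Submodule ℝ (V →L[ℝ] V)) : IsClosed (S : Set (V →L[ℝ] V)) :=
  S.closed_of_finiteDimensional

/-- The cochain maps of degree zero. -/
def cochainMaps : Submodule ℝ (V →L[ℝ] V) where
  carrier := {f | f ∈ C.endDeg 0 ∧ C.diff * f = f * C.diff}
  add_mem' hf hg := ⟨add_mem hf.1 hg.1, by rw [mul_add, add_mul, hf.2, hg.2]⟩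
  zero_mem' := ⟨zero_mem _, by simp⟩
  smul_mem' c f hf := ⟨Submodule.smul_mem _ c hf.1, by
    rw [mul_smul_comm, smul_mul_assoc, hf.2]⟩

lemma one_mem_cochainMaps : (1 : V →L[ℝ] V) ∈ C.cochainMaps :=
  ⟨fun p v hv => by simpa using hv, by simp⟩

lemma mul_mem_cochainMaps {f g : V →L[ℝ] V} (hf : f ∈ C.cochainMaps) (hg : g ∈ C.cochainMaps) :
    f * g ∈ C.cochainMaps :=
  ⟨C.mul_mem_endDeg hf.1 hg.1 (add_zero 0), by
    rw [← mul_assoc, hf.2, mul_assoc, hg.2, mul_assoc]⟩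

/-- The graded commutator with `∂` on endomorphisms of odd degree. -/
def oddBracket : (V →L[ℝ] V) →L[ℝ] (V →L[ℝ] V) :=
  ContinuousLinearMap.mul ℝ (V →L[ℝ] V) C.diff + (ContinuousLinearMap.mul ℝ (V →L[ℝ] V)).flip C.diff

/-- The commutator with `∂`, i.e. the graded commutator on endomorphisms of even degree. -/
def evenBracket : (V →L[ℝ] V) →L[ℝ] (V →L[ℝ] V) :=
  ContinuousLinearMap.mul ℝ (V →L[ℝ] V) C.diff - (ContinuousLinearMap.mul ℝ (V →L[ℝ] V)).flip C.diff

lemma evenBracket_apply (f : V →L[ℝ] V) : C.evenBracket f = C.diff * f - f * C.diff := rfl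

/-- Graded Leibniz rule for two odd factors. As an identity in the algebra it needs no degrees: the
cross terms f ∂ g cancel. -/
lemma evenBracket_mul (f g : V →L[ℝ] V) :
    C.evenBracket (f * g) = C.oddBracket f * g - f * C.oddBracket g := by
  change C.diff * (f * g) - f * g * C.diff =
    (C.diff * f + f * C.diff) * g - f * (C.diff * g + g * C.diff)
  noncomm_ring

lemma evenBracket_mem_boundaries {f : V →L[ℝ] V} (hf : f ∈ C.endDeg (-2)) :
    C.evenBracket f ∈ C.boundaries (-2) := by
  refine ⟨f, hf, ?_⟩
  change C.diff * f - ((-1 : ℝ) ^ (-2 : ℤ)) • (f * C.diff) = C.diff * f - f * C.diff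
  norm_num

/-- Brackets with ∂ are linear over cochain maps. This lets parallel transports, which are cochain
maps, pass through all brackets. -/
lemma mul_evenBracket {k f : V →L[ℝ] V} (hk : k ∈ C.cochainMaps) :
    C.evenBracket (k * f) = k * C.evenBracket f := by
  rw [evenBracket_apply, evenBracket_apply, ← mul_assoc, hk.2, mul_sub, mul_assoc, mul_assoc]

lemma oddBracket_apply (f : V →L[ℝ] V) : C.oddBracket f = C.diff * f + f * C.diff := rfl

lemma mul_oddBracket {k f : V →L[ℝ] V} (hk : k ∈ C.cochainMaps) :
    C.oddBracket (k * f) = k * C.oddBracket f := by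
  rw [oddBracket_apply, oddBracket_apply, ← mul_assoc, hk.2, mul_add, mul_assoc, mul_assoc]

lemma oddBracket_mul {g f : V →L[ℝ] V} (hg : g ∈ C.cochainMaps) :
    C.oddBracket (f * g) = C.oddBracket f * g := by
  rw [oddBracket_apply, oddBracket_apply, add_mul, mul_assoc, mul_assoc, mul_assoc, hg.2]

end GradedComplex

end GradedEnd

/-! ### Parallel transport along the horizontal lines -/

section HorTransport

set_option maxSynthPendingDepth 3

open Set Filter Topology

lemma LipDeriv.lipschitzOnWith {X : Type*} [NormedAddCommGroup X] [NormedSpace ℝ X] [CompleteSpace X]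
    {F f : ℝ → X} {a b C : ℝ} (h : LipDeriv F f a b) (hC : ∀ x ∈ Icc a b, ‖f x‖ ≤ C) :
    LipschitzOnWith C.toNNReal F (Icc a b) := by
  have key : ∀ x ∈ Icc a b, ∀ y ∈ Icc a b, x ≤ y → dist (F x) (F y) ≤ C.toNNReal * dist x y := by
    intro x hx y hy hxy
    have h1 := (h.mono hx.1 hy.2).integral_eq hxy
    rw [dist_comm, dist_eq_norm, ← h1, dist_comm, Real.dist_eq]
    refine intervalIntegral.norm_integral_le_of_norm_le_const fun t ht => ?_
    rw [uIoc_of_le hxy] at ht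
    exact (hC t ⟨hx.1.trans ht.1.le, ht.2.trans hy.2⟩).trans (Real.le_coe_toNNReal C)
  refine LipschitzOnWith.of_dist_le_mul fun x hx y hy => ?_
  rcases le_total x y with hxy | hxy
  · exact key x hx y hy hxy
  · rw [dist_comm (F x), dist_comm x]; exact key y hy x hx hxy

/-- A property that propagates along intervals of length less than `δ` holds on all of `[0, 1]`. -/
lemma unitInterval_induction {P : ℝ → Prop} {δ : ℝ} (hδ : 0 < δ) (h0 : P 0)
    (h : ∀ x y, 0 ≤ x → x ≤ y → y ≤ 1 → y - x < δ → P x → P y) : ∀ x ∈ Icc (0 : ℝ) 1, P x := by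
  have h1 : ∀ n : ℕ, ∀ x ∈ Icc (0 : ℝ) 1, x ≤ n * (δ / 2) → P x := by
    intro n
    induction n with
    | zero => intro x hx hxn; simp at hxn; rwa [le_antisymm hxn hx.1]
    | succ n ih =>
      intro x hx hxn
      push_cast at hxn
      have hm : 0 ≤ max (x - δ / 2) 0 := le_max_right _ _
      have hmx : max (x - δ / 2) 0 ≤ x := max_le (by linarith) hx.1
      refine h (max (x - δ / 2) 0) x hm hmx hx.2 ?_ (ih _ ⟨hm, hmx.trans hx.2⟩ ?_)
      · linarith [le_max_left (x - δ / 2) 0]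
      · exact max_le (by linarith) (by positivity)
  intro x hx
  obtain ⟨n, hn⟩ := exists_nat_gt (x / (δ / 2))
  exact h1 n x hx ((div_lt_iff₀ (by positivity)).mp hn).le

variable {E : Type*} [NormedAddCommGroup E] [NormedSpace ℝ E] [FiniteDimensional ℝ E]
  {M : Type*} [TopologicalSpace M] [ChartedSpace E M] [IsManifold 𝓘(ℝ, E) ∞ M]
  {V : Type*} [NormedAddCommGroup V] [NormedSpace ℝ V] [FiniteDimensional ℝ V]
  {C : GradedComplex V}

lemma hor_mem (α : FlatSuperconnection E M C) (G : ℝ × ℝ → M) (p : ℝ × ℝ) :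
    hor α G p ∈ C.cochainMaps := by
  rw [hor]
  split_ifs
  · exact ⟨by simpa using α.degree 1 (G (p.1, p.2)) _, α.form_one_commute _ _⟩
  · exact zero_mem _

lemma area_mem (α : FlatSuperconnection E M C) (G : ℝ × ℝ → M) (p : ℝ × ℝ) :
    area α G p ∈ C.endDeg (-1) := by
  by_cases hp : p ∈ regularSet E G
  · rw [area, indicator_of_mem hp, pullTwo]
    simpa using α.degree 2 (G p) ![partialDeriv E G p (1, 0), partialDeriv E G p (0, 1)]
  · rw [area, indicator_of_notMem hp]
    exact zero_mem _

/-- Parallel transport along the horizontal line from `(0, v)` to `(u, v)`. -/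
def horTransport (α : FlatSuperconnection E M C) (G : ℝ × ℝ → M) (p : ℝ × ℝ) : V →L[ℝ] V :=
  transport (fun x => -hor α G (x, p.2)) p.1

/-- The inverse of parallel transport along the horizontal line from `(0, v)` to `(u, v)`. -/
def horInv (α : FlatSuperconnection E M C) (G : ℝ × ℝ → M) (p : ℝ × ℝ) : V →L[ℝ] V :=
  transportInv (fun x => -hor α G (x, p.2)) p.1

lemma horTransport_zero (α : FlatSuperconnection E M C) (G : ℝ × ℝ → M) (v : ℝ) :
    horTransport α G (0, v) = 1 := transport_zero _

lemma horInv_zero (α : FlatSuperconnection E M C) (G : ℝ × ℝ → M) (v : ℝ) :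
    horInv α G (0, v) = 1 := transportInv_zero _

lemma horTransport_mem (α : FlatSuperconnection E M C) (G : ℝ × ℝ → M) {u : ℝ}
    (hu : u ∈ Icc (0 : ℝ) 1) (v : ℝ) :
    horTransport α G (u, v) ∈ C.cochainMaps ∧ horInv α G (u, v) ∈ C.cochainMaps :=
  transport_mem (GradedComplex.isClosed_submodule _) C.one_mem_cochainMaps
    (fun _ hx _ hy => C.mul_mem_cochainMaps hx hy)
    (fun _ _ => neg_mem (hor_mem α G _)) hu

variable {α : FlatSuperconnection E M C} {G : ℝ × ℝ → M}

lemma NiceMap.coeff_hor (hG : NiceMap E G) {c : ℝ} (hc : ∀ p, ‖hor α G p‖ ≤ c) (v : ℝ) :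
    Coeff c fun x => -hor α G (x, v) :=
  ⟨(hG.aestronglyMeasurable_hor α v).neg, fun t _ => by rw [norm_neg]; exact hc _⟩

lemma NiceMap.transportPair (hG : NiceMap E G) {c : ℝ} (hc : ∀ p, ‖hor α G p‖ ≤ c) :
    TransportPair (hor α G) (horTransport α G) (horInv α G) (‖(1 : V →L[ℝ] V)‖ * Real.exp c)
      0 1 0 1 where
  g_eq v _ := by simpa using! lipDeriv_transport (hG.coeff_hor hc v)
  k_eq v _ := by simpa using! lipDeriv_transportInv (hG.coeff_hor hc v)
  kg u hu v _ := transportInv_mul (hG.coeff_hor hc v) hu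
  gk u hu v _ := transport_mul_inv (hG.coeff_hor hc v) hu
  g_le u hu v _ := norm_flow_le (hG.coeff_hor hc v).opCoeff_left 1 hu
  k_le u hu v _ := norm_flow_le (hG.coeff_hor hc v).opCoeff_right 1 hu

lemma TransportPair.mono {𝔄 : Type*} [NormedRing 𝔄] [NormedAlgebra ℝ 𝔄] {a g k : ℝ × ℝ → 𝔄}
    {c u₀ u₁ v₀ v₁ : ℝ} (h : TransportPair a g k c 0 1 0 1)
    (hu₀ : 0 ≤ u₀) (hu₁ : u₁ ≤ 1) (hv₀ : 0 ≤ v₀) (hv₁ : v₁ ≤ 1) :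
    TransportPair a g k c u₀ u₁ v₀ v₁ :=
  have hu : Icc u₀ u₁ ⊆ Icc 0 1 := Icc_subset_Icc hu₀ hu₁
  have hv : Icc v₀ v₁ ⊆ Icc 0 1 := Icc_subset_Icc hv₀ hv₁
  ⟨fun v hv' => (h.g_eq v (hv hv')).mono hu₀ hu₁, fun v hv' => (h.k_eq v (hv hv')).mono hu₀ hu₁,
    fun u hu' v hv' => h.kg u (hu hu') v (hv hv'), fun u hu' v hv' => h.gk u (hu hu') v (hv hv'),
    fun u hu' v hv' => h.g_le u (hu hu') v (hv hv'), fun u hu' v hv' => h.k_le u (hu hu') v (hv hv')⟩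

-- The partial derivatives are cut off outside the open sides, because at the ends of a side the
-- Lipschitz bound on the cell does not control them. Along lines they exist almost everywhere by
-- the one-dimensional Rademacher theorem. At regular points they are continuous, and flatness
-- identifies the curvature as minus the bracket of ∂ with `area`.
open Classical in
lemma ChartCell.cellData {x₀ : M} {K : NNReal} {u₀ u₁ v₀ v₁ : ℝ} (hG : NiceMap E G)
    (h : ChartCell α G x₀ K (Icc u₀ u₁ ×ˢ Icc v₀ v₁))
    (hu₀ : 0 ≤ u₀) (hu₁ : u₁ ≤ 1) (hv₀ : 0 ≤ v₀) (hv₁ : v₁ ≤ 1) :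
    CellData (α.connForm x₀) (fun p => extChartAt 𝓘(ℝ, E) x₀ (G p))
      (fun p => if p.1 ∈ Ioo u₀ u₁ then
        deriv (fun x => extChartAt 𝓘(ℝ, E) x₀ (G (x, p.2))) p.1 else 0)
      (fun p => if p.2 ∈ Ioo v₀ v₁ then
        deriv (fun y => extChartAt 𝓘(ℝ, E) x₀ (G (p.1, y))) p.2 else 0)
      (hor α G) (ver α G) (fun p => -C.oddBracket (area α G p)) K u₀ u₁ v₀ v₁ := by
  have hu : Icc u₀ u₁ ⊆ Icc 0 1 := Icc_subset_Icc hu₀ hu₁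
  have hv : Icc v₀ v₁ ⊆ Icc 0 1 := Icc_subset_Icc hv₀ hv₁
  have hu' : Ioo u₀ u₁ ⊆ Ioo 0 1 := Ioo_subset_Ioo hu₀ hu₁
  have hv' : Ioo v₀ v₁ ⊆ Ioo 0 1 := Ioo_subset_Ioo hv₀ hv₁
  have hswap : ContinuousOn (G ∘ Prod.swap) square :=
    hG.cont.comp continuous_swap.continuousOn fun p hp => ⟨hp.2, hp.1⟩
  have hl₁ : ∀ v ∈ Icc v₀ v₁, LipschitzOnWith K (fun x => extChartAt 𝓘(ℝ, E) x₀ (G (x, v)))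
      (Icc u₀ u₁) := fun v hv => by
    have := h.lip.comp (f := fun x : ℝ => (x, v)) (s := Icc u₀ u₁)
      (LipschitzWith.prodMk_right v).lipschitzOnWith fun x hx => ⟨hx, hv⟩
    rwa [mul_one] at this
  have hl₂ : ∀ u ∈ Icc u₀ u₁, LipschitzOnWith K (fun y => extChartAt 𝓘(ℝ, E) x₀ (G (u, y)))
      (Icc v₀ v₁) := fun u hu => by
    have := h.lip.comp (f := fun y : ℝ => (u, y)) (s := Icc v₀ v₁)
      (LipschitzWith.prodMk_left u).lipschitzOnWith fun x hx => ⟨hu, hx⟩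
    rwa [mul_one] at this
  have hae : ∀ {a b : ℝ} {f : ℝ → E}, LipschitzOnWith K f (Icc a b) →
      ∀ᵐ x, x ∈ Ioo a b → HasDerivAt f (if x ∈ Ioo a b then deriv f x else 0) x := by
    intro a b f hf
    have h1 := hf.ae_differentiableWithinAt_real measurableSet_Icc
    rw [ae_restrict_iff' measurableSet_Icc] at h1
    filter_upwards [h1] with x hx hx'
    rw [if_pos hx']
    exact ((hx (Ioo_subset_Icc_self hx')).differentiableAt
      (Icc_mem_nhds hx'.1 hx'.2)).hasDerivAt
  refine ⟨h.lip, h.A_lip, h.A_le, fun p hp => ?_, h.dA_le, fun p hp => ?_, fun v hv => hae (hl₁ v hv),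
    fun v hvI => ?_, fun u hu => hae (hl₂ u hu), fun u huI => ?_, ?_⟩
  · exact (α.contDiffAt_connForm ((extChartAt 𝓘(ℝ, E) x₀).map_source (h.maps p hp))).differentiableAt
      (by simp)
  · split_ifs with hp1
    · exact norm_deriv_le_of_lipschitzOn (Icc_mem_nhds hp1.1 hp1.2) (hl₁ p.2 hp.2)
    · simp
  · refine Eventually.of_forall fun u huI => ?_
    rw [if_pos huI]
    exact hor_eq_chart α hG.cont (hu' huI) (hv hvI) (h.maps (u, v) ⟨Ioo_subset_Icc_self huI, hvI⟩)
  · refine Eventually.of_forall fun v hvI => ?_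
    rw [if_pos hvI]
    exact hor_eq_chart α hswap (hv' hvI) (hu huI) (h.maps (u, v) ⟨huI, Ioo_subset_Icc_self hvI⟩)
  · filter_upwards [hG.smooth_ae] with p hp hpI
    have hpc : p ∈ Icc u₀ u₁ ×ˢ Icc v₀ v₁ :=
      ⟨Ioo_subset_Icc_self hpI.1, Ioo_subset_Icc_self hpI.2⟩
    have hpr : p ∈ regularSet E G := hp ⟨hu hpc.1, hv hpc.2⟩
    have hs := h.maps p hpc
    have hf : ContDiffAt ℝ 2 (fun q => extChartAt 𝓘(ℝ, E) x₀ (G q)) p := by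
      rw [← contDiffWithinAt_univ]
      exact contDiffWithinAt_chart_comp (WithTop.coe_le_coe.mpr le_top) hpr.2.contMDiffWithinAt hs
    have hfd := hf.continuousAt_fderiv (by simp)
    have hd1 : ∀ q : ℝ × ℝ, DifferentiableAt ℝ (fun q => extChartAt 𝓘(ℝ, E) x₀ (G q)) q →
        HasDerivAt (fun x => extChartAt 𝓘(ℝ, E) x₀ (G (x, q.2)))
          (fderiv ℝ (fun q => extChartAt 𝓘(ℝ, E) x₀ (G q)) q (1, 0)) q.1 := fun q hq =>
      HasFDerivAt.comp_hasDerivAt (f := fun x : ℝ => (x, q.2)) q.1 hq.hasFDerivAt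
        ((hasDerivAt_id q.1).prodMk (hasDerivAt_const q.1 q.2))
    have hd2 : HasDerivAt (fun y => extChartAt 𝓘(ℝ, E) x₀ (G (p.1, y)))
          (fderiv ℝ (fun q => extChartAt 𝓘(ℝ, E) x₀ (G q)) p (0, 1)) p.2 :=
      HasFDerivAt.comp_hasDerivAt (f := fun y : ℝ => (p.1, y)) p.2
        (hf.differentiableAt (by simp)).hasFDerivAt
        ((hasDerivAt_const p.2 p.1).prodMk (hasDerivAt_id p.2))
    have hev : ∀ᶠ q in 𝓝 p, DifferentiableAt ℝ (fun q => extChartAt 𝓘(ℝ, E) x₀ (G q)) q := by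
      filter_upwards [hf.eventually (by decide)] with q hq
      exact hq.differentiableAt (by simp)
    have hc : Tendsto (fun w : ℝ => (p.1, w)) (𝓝 p.2) (𝓝 p) :=
      Continuous.tendsto (by fun_prop : Continuous fun w : ℝ => (p.1, w)) p.2
    simp only [if_pos hpI.1, if_pos hpI.2, (hd1 p hev.self_of_nhds).deriv, hd2.deriv]
    refine ⟨?_, hd2, ?_⟩
    · have h1 : Tendsto (fun w => fderiv ℝ (fun q => extChartAt 𝓘(ℝ, E) x₀ (G q)) (p.1, w) (1, 0))
          (𝓝 p.2) (𝓝 (fderiv ℝ (fun q => extChartAt 𝓘(ℝ, E) x₀ (G q)) p (1, 0))) :=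
        (hfd.clm_apply continuousAt_const).tendsto.comp hc
      refine h1.congr' ?_
      filter_upwards [hc.eventually hev] with w hw
      exact ((hd1 (p.1, w) hw).deriv).symm
    · rw [α.curvature_eq ((extChartAt 𝓘(ℝ, E) x₀).map_source hs), area, indicator_of_mem hpr,
        pullTwo_eq_chart α hpr.2.continuousAt hs]
      rfl

end HorTransport

/-! ### The non-abelian Stokes formula on the square -/

section Stokes

set_option maxSynthPendingDepth 3

open Set Filter Topology

variable {E : Type*} [NormedAddCommGroup E] [NormedSpace ℝ E] [FiniteDimensional ℝ E]
  {M : Type*} [TopologicalSpace M] [ChartedSpace E M] [IsManifold 𝓘(ℝ, E) ∞ M]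
  {V : Type*} [NormedAddCommGroup V] [NormedSpace ℝ V] [FiniteDimensional ℝ V]
  {C : GradedComplex V} {α : FlatSuperconnection E M C} {G : ℝ × ℝ → M}

lemma hor_eq_zero {u v : ℝ} {x : M} (h : (fun x => G (x, v)) =ᶠ[𝓝 u] fun _ => x) :
    hor α G (u, v) = 0 := by
  rw [hor]
  split_ifs
  · have h1 : ∀ w : ℝ, (mfderiv 𝓘(ℝ, ℝ) 𝓘(ℝ, E) (fun x => G (x, v)) u w : E) = 0 := by
      intro w
      have h2 := h.mfderiv_eq (I := 𝓘(ℝ, ℝ)) (I' := 𝓘(ℝ, E))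
      rw [mfderiv_const] at h2
      exact congrArg (fun (L : ℝ →L[ℝ] E) => L w) h2
    exact (α.form 1 (G (u, v))).map_coord_zero 0 (h1 1)
  · rfl

/-- The integral of `α²`, transported back to the left end, along a horizontal line. -/
def horBeta (α : FlatSuperconnection E M C) (G : ℝ × ℝ → M) (p : ℝ × ℝ) : V →L[ℝ] V :=
  ∫ x in (0 : ℝ)..p.1, horInv α G (x, p.2) * area α G (x, p.2) * horTransport α G (x, p.2)

lemma NiceMap.exists_coeff_beta (hG : NiceMap E G) (α : FlatSuperconnection E M C) :
    ∃ c, ∀ v ∈ Icc (0 : ℝ) 1,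
      Coeff c fun x => horInv α G (x, v) * area α G (x, v) * horTransport α G (x, v) := by
  obtain ⟨c, hc⟩ := hG.exists_hor_le α
  obtain ⟨d, hd⟩ := hG.exists_area_le α
  have ht := hG.transportPair hc
  set e := ‖(1 : V →L[ℝ] V)‖ * Real.exp c with he
  have he0 : 0 ≤ e := by positivity
  have hd0 : 0 ≤ d := (norm_nonneg _).trans (hd 0)
  refine ⟨e * d * e, fun v hv => ⟨?_, fun x hx => ?_⟩⟩
  · have h1 := (ht.k_eq v hv).continuousOn.aestronglyMeasurable (μ := volume) measurableSet_Icc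
    have h2 := (ht.g_eq v hv).continuousOn.aestronglyMeasurable (μ := volume) measurableSet_Icc
    have h3 : StronglyMeasurable fun x => area α G (x, v) :=
      (stronglyMeasurable_area α G).comp_measurable (by fun_prop)
    exact (h1.mul h3.aestronglyMeasurable).mul h2
  · exact (norm_mul_le _ _).trans (mul_le_mul ((norm_mul_le _ _).trans
      (mul_le_mul (ht.k_le x hx v hv) (hd _) (norm_nonneg _) he0)) (ht.g_le x hx v hv)
      (norm_nonneg _) (by positivity))

lemma Coeff.intervalIntegrable {X : Type*} [NormedAddCommGroup X] {f : ℝ → X} {c a b : ℝ}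
    (h : Coeff c f) (ha : a ∈ Icc (0 : ℝ) 1) (hb : b ∈ Icc (0 : ℝ) 1) :
    IntervalIntegrable f volume a b := by
  have h1 : IntervalIntegrable f volume 0 1 := by
    rw [intervalIntegrable_iff_integrableOn_Icc_of_le zero_le_one]
    refine Integrable.of_bound h.meas c ?_
    rw [ae_restrict_iff' measurableSet_Icc]
    exact Eventually.of_forall h.bound
  refine h1.mono_set ?_
  rw [uIcc_of_le zero_le_one]
  exact uIcc_subset_Icc ha hb

/-- Variation of the horizontal parallel transport in the vertical direction. -/
theorem NiceMap.stokes (hG : NiceMap E G)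
    (hleft : ∀ v ∈ Icc (0 : ℝ) 1, G (0, v) = G (0, 0)) {u : ℝ} (hu : u ∈ Icc (0 : ℝ) 1) :
    LipDeriv (fun v => horTransport α G (u, v))
      (fun v => -(ver α G (u, v) * horTransport α G (u, v)) +
        horTransport α G (u, v) * -C.oddBracket (horBeta α G (u, v))) 0 1 := by
  obtain ⟨c, hc⟩ := hG.exists_hor_le α
  obtain ⟨d, hd⟩ := hG.exists_coeff_beta α
  obtain ⟨δ, hδ, hgrid⟩ := hG.exists_grid α
  have ht := hG.transportPair hc
  -- In a strip of height less than δ the formula is carried from the left edge to the right, cell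
  -- by cell; the curvature collected so far is the datum κ at the left side of the next cell. The
  -- strips are then glued.
  have hstrip : ∀ v₀ v₁, 0 ≤ v₀ → v₀ ≤ v₁ → v₁ ≤ 1 → v₁ - v₀ < δ → ∀ u ∈ Icc (0 : ℝ) 1,
      LipDeriv (fun v => horTransport α G (u, v))
      (fun v => -(ver α G (u, v) * horTransport α G (u, v)) +
        horTransport α G (u, v) * -C.oddBracket (horBeta α G (u, v))) v₀ v₁ := by
    intro v₀ v₁ h0 h01 h1 hlt
    have hv : Icc v₀ v₁ ⊆ Icc 0 1 := Icc_subset_Icc h0 h1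
    refine unitInterval_induction hδ ?_ ?_
    · simp only [horTransport_zero]
      refine (LipDeriv.const (1 : V →L[ℝ] V) v₀ v₁).congr_deriv (Eventually.of_forall fun v hvI => ?_)
      -- The left edge is mapped to a point, so α¹ pulls back to zero along it and the formula
      -- starts with 0 = 0.
      have h2 : ver α G (0, v) = 0 := by
        refine hor_eq_zero (x := G (0, 0)) ?_
        filter_upwards [Ioo_mem_nhds (h0.trans_lt hvI.1) (hvI.2.trans_le h1)] with y hy
        exact hleft y (Ioo_subset_Icc_self hy)
      simp [h2, horBeta]
    · intro x y hx hxy hy hlt' hP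
      obtain ⟨x₀, K, hcell⟩ := hgrid x y v₀ v₁ hx hxy hy h0 h01 h1 hlt' hlt
      have h2 := (hcell.cellData hG hx hy h0 h1).lipDeriv_transport (ht.mono hx hy h0 h1)
        (κ := fun v => -C.oddBracket (horBeta α G (x, v))) hP (right_mem_Icc.mpr hxy)
      refine h2.congr_deriv (Eventually.of_forall fun v hvI => ?_)
      have hvc := hv (Ioo_subset_Icc_self hvI)
      have hx01 : x ∈ Icc (0 : ℝ) 1 := ⟨hx, hxy.trans hy⟩
      have hy01 : y ∈ Icc (0 : ℝ) 1 := ⟨hx.trans hxy, hy⟩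
      -- Transports are cochain maps, so ∂ commutes with conjugation by them and with the integral:
      -- the accumulated curvature is the bracket of ∂ with the accumulated integral of α².
      have h3 : ∫ t in x..y, horInv α G (t, v) * -C.oddBracket (area α G (t, v)) *
          horTransport α G (t, v) = -C.oddBracket
            (∫ t in x..y, horInv α G (t, v) * area α G (t, v) * horTransport α G (t, v)) := by
        rw [← ContinuousLinearMap.intervalIntegral_comp_comm C.oddBracket
          ((hd v hvc).intervalIntegrable hx01 hy01), ← intervalIntegral.integral_neg]
        refine intervalIntegral.integral_congr fun t ht => ?_
        rw [uIcc_of_le hxy] at ht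
        have hm := horTransport_mem α G ⟨hx.trans ht.1, ht.2.trans hy⟩ v
        rw [C.oddBracket_mul hm.1, C.mul_oddBracket hm.2, mul_neg, neg_mul]
      have h4 : horBeta α G (y, v) = horBeta α G (x, v) +
          ∫ t in x..y, horInv α G (t, v) * area α G (t, v) * horTransport α G (t, v) :=
        (intervalIntegral.integral_add_adjacent_intervals
          ((hd v hvc).intervalIntegrable (by simp) hx01)
          ((hd v hvc).intervalIntegrable hx01 hy01)).symm
      rw [h3, h4, map_add, neg_add]
  have hall : ∀ v ∈ Icc (0 : ℝ) 1, ∀ u ∈ Icc (0 : ℝ) 1,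
      LipDeriv (fun v => horTransport α G (u, v))
      (fun v => -(ver α G (u, v) * horTransport α G (u, v)) +
        horTransport α G (u, v) * -C.oddBracket (horBeta α G (u, v))) 0 v := by
    refine unitInterval_induction hδ (hstrip 0 0 le_rfl le_rfl zero_le_one (by simpa)) ?_
    intro x y hx hxy hy hlt hP u hu
    exact (hP u hu).glue hx hxy (hstrip x y hx hxy hy hlt u hu)
  exact hall 1 (by simp) u hu

/-- Everything follows from k_y - k_x = -k_y (g_y - g_x) k_x: first the Lipschitz bound, hence
continuity of k, and then the derivative. -/
lemma LipDeriv.inverse {𝔄 : Type*} [NormedRing 𝔄] [NormedAlgebra ℝ 𝔄] {g g' k : ℝ → 𝔄} {a b c : ℝ}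
    (h : LipDeriv g g' a b) (hkg : ∀ x ∈ Icc a b, k x * g x = 1) (hgk : ∀ x ∈ Icc a b, g x * k x = 1)
    (hk : ∀ x ∈ Icc a b, ‖k x‖ ≤ c) : LipDeriv k (fun x => -(k x * g' x * k x)) a b := by
  obtain ⟨K, hK⟩ := h.lip
  have hsub : ∀ x ∈ Icc a b, ∀ y ∈ Icc a b, k y - k x = -(k y * (g y - g x) * k x) := by
    intro x hx y hy
    rw [mul_sub, sub_mul, hkg y hy, one_mul, mul_assoc, hgk x hx, mul_one, neg_sub]
  have hlip : LipschitzOnWith (c * K * c).toNNReal k (Icc a b) := by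
    refine LipschitzOnWith.of_dist_le_mul fun y hy x hx => ?_
    have hc : 0 ≤ c := (norm_nonneg _).trans (hk x hx)
    have hd := hK.dist_le_mul y hy x hx
    rw [dist_eq_norm] at hd
    rw [dist_eq_norm, hsub x hx y hy, norm_neg, Real.coe_toNNReal _ (by positivity)]
    refine (norm_mul_le _ _).trans ((mul_le_mul ((norm_mul_le _ _).trans
      (mul_le_mul (hk y hy) hd (norm_nonneg _) hc)) (hk x hx) (norm_nonneg _) (by positivity)).trans
      (le_of_eq (by ring)))
  refine ⟨⟨_, hlip⟩, ?_⟩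
  filter_upwards [h.deriv] with x hx hxI
  have hI := Icc_mem_nhds hxI.1 hxI.2
  have hxc := Ioo_subset_Icc_self hxI
  have hkc : ContinuousAt k x := hlip.continuousOn.continuousAt hI
  have hd := hx hxI
  rw [hasDerivAt_iff_tendsto_slope] at hd ⊢
  have h1 := (((hkc.tendsto.mono_left nhdsWithin_le_nhds).mul hd).mul_const (k x)).neg
  refine h1.congr' ?_
  filter_upwards [nhdsWithin_le_nhds hI] with y hy
  rw [slope_def_module, slope_def_module, hsub x hxc y hy]
  simp

lemma NiceMap.lipDeriv_horInv (hG : NiceMap E G)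
    (hleft : ∀ v ∈ Icc (0 : ℝ) 1, G (0, v) = G (0, 0)) {u : ℝ} (hu : u ∈ Icc (0 : ℝ) 1) :
    LipDeriv (fun v => horInv α G (u, v))
      (fun v => horInv α G (u, v) * ver α G (u, v) +
        C.oddBracket (horBeta α G (u, v)) * horInv α G (u, v)) 0 1 := by
  obtain ⟨c, hc⟩ := hG.exists_hor_le α
  have ht := hG.transportPair hc
  refine ((hG.stokes (α := α) hleft hu).inverse (ht.kg u hu) (ht.gk u hu) (ht.k_le u hu)).congr_deriv
    (Eventually.of_forall fun v hv => ?_)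
  have e1 := ht.kg u hu v (Ioo_subset_Icc_self hv)
  have e2 := ht.gk u hu v (Ioo_subset_Icc_self hv)
  generalize horTransport α G (u, v) = g at *
  generalize horInv α G (u, v) = k at *
  generalize C.oddBracket (horBeta α G (u, v)) = D
  calc -(k * (-(ver α G (u, v) * g) + g * -D) * k)
      = k * ver α G (u, v) * (g * k) + (k * g) * D * k := by noncomm_ring
    _ = _ := by rw [e1, e2, one_mul, mul_one]

/-- Joint continuity from continuity in v for each u and a Lipschitz constant in u that does not
depend on v. -/
lemma NiceMap.continuousOn_horTransport (hG : NiceMap E G) (α : FlatSuperconnection E M C)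
    (hleft : ∀ v ∈ Icc (0 : ℝ) 1, G (0, v) = G (0, 0)) :
    ContinuousOn (horTransport α G) square ∧ ContinuousOn (horInv α G) square := by
  obtain ⟨c, hc⟩ := hG.exists_hor_le α
  have ht := hG.transportPair hc
  set e := ‖(1 : V →L[ℝ] V)‖ * Real.exp c with he
  have hc0 : 0 ≤ c := (norm_nonneg _).trans (hc 0)
  refine ⟨continuousOn_prod_of_continuousOn_lipschitzOnWith _ (c * e).toNNReal
      (fun u hu => (hG.stokes hleft hu).continuousOn)
      (fun v hv => (ht.g_eq v hv).lipschitzOnWith fun x hx => ?_),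
    continuousOn_prod_of_continuousOn_lipschitzOnWith _ (e * c).toNNReal
      (fun u hu => (hG.lipDeriv_horInv hleft hu).continuousOn)
      (fun v hv => (ht.k_eq v hv).lipschitzOnWith fun x hx => ?_)⟩
  · rw [norm_neg]
    exact (norm_mul_le _ _).trans (mul_le_mul (hc _) (ht.g_le x hx v hv) (norm_nonneg _) hc0)
  · exact (norm_mul_le _ _).trans (mul_le_mul (ht.k_le x hx v hv) (hc _) (norm_nonneg _)
      (by positivity))

end Stokes

/-! ### Integration over the square -/

section SquareIntegrals

open Set Filter Topology

/-- `f` is measurable and bounded on the square. -/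
structure SquareBdd {X : Type*} [NormedAddCommGroup X] (f : ℝ × ℝ → X) : Prop where
  meas : AEStronglyMeasurable f (volume.restrict square)
  bound : ∃ c, ∀ p ∈ square, ‖f p‖ ≤ c

lemma measurableSet_square : MeasurableSet square := measurableSet_Icc.prod measurableSet_Icc

namespace SquareBdd

variable {X : Type*} [NormedAddCommGroup X]

lemma integrableOn {f : ℝ × ℝ → X} (hf : SquareBdd f) : IntegrableOn f square := by
  obtain ⟨c, hc⟩ := hf.bound
  have : IsFiniteMeasure (volume.restrict square) :=
    ⟨by rw [Measure.restrict_apply_univ]; exact isCompact_square.measure_lt_top⟩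
  refine Integrable.of_bound hf.meas c ?_
  rw [ae_restrict_iff' measurableSet_square]
  exact Eventually.of_forall hc

lemma add {f g : ℝ × ℝ → X} (hf : SquareBdd f) (hg : SquareBdd g) :
    SquareBdd fun p => f p + g p := by
  obtain ⟨c, hc⟩ := hf.bound
  obtain ⟨d, hd⟩ := hg.bound
  exact ⟨hf.meas.add hg.meas, c + d, fun p hp =>
    (norm_add_le _ _).trans (add_le_add (hc p hp) (hd p hp))⟩

lemma clm {Y : Type*} [NormedAddCommGroup Y] [NormedSpace ℝ X] [NormedSpace ℝ Y] {f : ℝ × ℝ → X}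
    (hf : SquareBdd f) (L : X →L[ℝ] Y) : SquareBdd fun p => L (f p) := by
  obtain ⟨c, hc⟩ := hf.bound
  exact ⟨L.continuous.comp_aestronglyMeasurable hf.meas, ‖L‖ * c, fun p hp =>
    (L.le_opNorm _).trans (mul_le_mul_of_nonneg_left (hc p hp) (norm_nonneg _))⟩

lemma mul {𝔄 : Type*} [NormedRing 𝔄] {f g : ℝ × ℝ → 𝔄} (hf : SquareBdd f) (hg : SquareBdd g) :
    SquareBdd fun p => f p * g p := by
  obtain ⟨c, hc⟩ := hf.bound
  obtain ⟨d, hd⟩ := hg.bound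
  exact ⟨hf.meas.mul hg.meas, c * d, fun p hp => (norm_mul_le _ _).trans
    (mul_le_mul (hc p hp) (hd p hp) (norm_nonneg _) ((norm_nonneg _).trans (hc p hp)))⟩

lemma of_continuousOn [NormedSpace ℝ X] {f : ℝ × ℝ → X} (hf : ContinuousOn f square) :
    SquareBdd f :=
  ⟨hf.aestronglyMeasurable_of_isCompact isCompact_square measurableSet_square,
    isCompact_square.exists_bound_of_continuousOn hf⟩

lemma swap {f : ℝ × ℝ → X} (hf : SquareBdd f) : SquareBdd fun p => f p.swap := by
  obtain ⟨c, hc⟩ := hf.bound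
  refine ⟨?_, c, fun p hp => hc _ ⟨hp.2, hp.1⟩⟩
  have h1 : MeasurePreserving (Prod.swap : ℝ × ℝ → ℝ × ℝ) (volume.restrict square)
      (volume.restrict square) := by
    have h2 : (Prod.swap : ℝ × ℝ → ℝ × ℝ) ⁻¹' square = square := by
      ext p; exact ⟨fun h => ⟨h.2, h.1⟩, fun h => ⟨h.2, h.1⟩⟩
    have := (Measure.measurePreserving_swap (μ := (volume : Measure ℝ))
      (ν := (volume : Measure ℝ))).restrict_preimage measurableSet_square
    rwa [h2] at this
  exact hf.meas.comp_measurePreserving h1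

variable [NormedSpace ℝ X]

lemma integral_eq {f : ℝ × ℝ → X} (hf : SquareBdd f) :
    ∫ z in square, f z = ∫ x in (0 : ℝ)..1, ∫ y in (0 : ℝ)..1, f (x, y) := by
  simp only [intervalIntegral.integral_of_le zero_le_one, ← integral_Icc_eq_integral_Ioc]
  exact setIntegral_prod f hf.integrableOn

lemma integral_eq_swap {f : ℝ × ℝ → X} (hf : SquareBdd f) :
    ∫ z in square, f z = ∫ y in (0 : ℝ)..1, ∫ x in (0 : ℝ)..1, f (x, y) := by
  rw [hf.integral_eq]
  refine intervalIntegral_intervalIntegral_swap (F := fun x y => f (x, y)) ?_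
  rw [uIoc_of_le zero_le_one]
  exact hf.integrableOn.mono_set (prod_mono Ioc_subset_Icc_self Ioc_subset_Icc_self)

end SquareBdd

/-- The variable endpoint becomes the indicator of a measurable set in three variables, and
integrating out one variable preserves joint measurability. -/
lemma stronglyMeasurable_primitive {X : Type*} [NormedAddCommGroup X] [NormedSpace ℝ X]
    {f : ℝ × ℝ → X} (hf : StronglyMeasurable f) :
    StronglyMeasurable fun p : ℝ × ℝ => ∫ t in Ioc 0 p.1, f (t, p.2) := by
  have hS : MeasurableSet {q : (ℝ × ℝ) × ℝ | 0 < q.2 ∧ q.2 ≤ q.1.1} :=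
    (measurableSet_lt measurable_const measurable_snd).inter
      (measurableSet_le measurable_snd (measurable_fst.comp measurable_fst))
  have h1 : StronglyMeasurable
      ({q : (ℝ × ℝ) × ℝ | 0 < q.2 ∧ q.2 ≤ q.1.1}.indicator fun q => f (q.2, q.1.2)) :=
    (hf.comp_measurable (g := fun q : (ℝ × ℝ) × ℝ => (q.2, q.1.2)) (by fun_prop)).indicator hS
  have h2 := h1.integral_prod_right' (ν := (volume : Measure ℝ))
  convert h2 using 2 with p
  rw [← integral_indicator measurableSet_Ioc]
  rfl

end SquareIntegrals

/-! ### Comparison of the two ways to integrate -/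

section Comparison

set_option maxSynthPendingDepth 3

open Set Filter Topology

variable {V : Type*} [NormedAddCommGroup V] [NormedSpace ℝ V] [FiniteDimensional ℝ V]

/-- By the Leibniz rule `evenBracket_mul`, the two derivatives satisfy ∂_y W - ∂_x (β h) = [∂, β] W
- β [∂, W] = [∂, β W]. Fubini integrates the left-hand side first in the direction of its
derivative, leaving the boundary values on the top and right edges. -/
lemma GradedComplex.integral_eq_evenBracket_add (C : GradedComplex V)
    {β W b h : ℝ × ℝ → V →L[ℝ] V} (hβ : SquareBdd β) (hW : SquareBdd W) (hb : SquareBdd b)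
    (hh : SquareBdd h)
    (hWy : ∀ x ∈ Icc (0 : ℝ) 1, LipDeriv (fun y => W (x, y))
      (fun y => C.oddBracket (β (x, y)) * W (x, y) + b (x, y) * h (x, y)) 0 1)
    (hW0 : ∀ x ∈ Icc (0 : ℝ) 1, W (x, 0) = 0)
    (hβx : ∀ y ∈ Icc (0 : ℝ) 1, LipDeriv (fun x => β (x, y) * h (x, y))
      (fun x => b (x, y) * h (x, y) + β (x, y) * C.oddBracket (W (x, y))) 0 1)
    (hβ0 : ∀ y ∈ Icc (0 : ℝ) 1, β (0, y) = 0) :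
    ∫ x in (0 : ℝ)..1, W (x, 1) =
      C.evenBracket (∫ z in square, β z * W z) + ∫ y in (0 : ℝ)..1, β (1, y) * h (1, y) := by
  have h1 : ∫ x in (0 : ℝ)..1, W (x, 1) =
      ∫ z in square, (C.oddBracket (β z) * W z + b z * h z) := by
    rw [(((hβ.clm C.oddBracket).mul hW).add (hb.mul hh)).integral_eq]
    refine intervalIntegral.integral_congr fun x hx => ?_
    rw [uIcc_of_le zero_le_one] at hx
    have := (hWy x hx).integral_eq zero_le_one
    rw [hW0 x hx, sub_zero] at this
    exact this.symm
  have h2 : ∫ y in (0 : ℝ)..1, β (1, y) * h (1, y) =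
      ∫ z in square, (b z * h z + β z * C.oddBracket (W z)) := by
    rw [((hb.mul hh).add (hβ.mul (hW.clm C.oddBracket))).integral_eq_swap]
    refine intervalIntegral.integral_congr fun y hy => ?_
    rw [uIcc_of_le zero_le_one] at hy
    have := (hβx y hy).integral_eq zero_le_one
    rw [hβ0 y hy, zero_mul, sub_zero] at this
    exact this.symm
  rw [h1, h2, ← ContinuousLinearMap.integral_comp_comm _ (hβ.mul hW).integrableOn,
    ← integral_add ((hβ.mul hW).clm C.evenBracket).integrableOn
      ((hb.mul hh).add (hβ.mul (hW.clm C.oddBracket))).integrableOn]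
  refine integral_congr_ae (Eventually.of_forall fun z => ?_)
  change C.oddBracket (β z) * W z + b z * h z = C.evenBracket (β z * W z) +
    (b z * h z + β z * C.oddBracket (W z))
  rw [C.evenBracket_mul]
  abel

-- Put R(y) = ∫₀ʸ e' β. Since e' is inverse to e and starts at 1, [∂, R] = 1 - e' and [∂, e R] = e -
-- 1. Moreover (e R)' = [∂, β] e R + β. Subtracting β e from this derivative leaves [∂, β] e R - β
-- [∂, e R] = [∂, β e R], so η = ∫ β e R does it.
set_option maxHeartbeats 1000000 in
lemma GradedComplex.exists_evenBracket_eq (C : GradedComplex V) {β e e' : ℝ → V →L[ℝ] V} {c : ℝ}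
    (hβ : Coeff c β) (hβm : ∀ y ∈ Icc (0 : ℝ) 1, β y ∈ C.endDeg (-1))
    (he : LipDeriv e (fun y => C.oddBracket (β y) * e y) 0 1)
    (he' : LipDeriv e' (fun y => -(e' y * C.oddBracket (β y))) 0 1)
    (hem : ∀ y ∈ Icc (0 : ℝ) 1, e y ∈ C.cochainMaps ∧ e' y ∈ C.cochainMaps)
    (hee' : ∀ y ∈ Icc (0 : ℝ) 1, e y * e' y = 1) (he0 : e' 0 = 1) :
    ∃ η ∈ C.endDeg (-2), e 1 * (∫ y in (0 : ℝ)..1, e' y * β y) - ∫ y in (0 : ℝ)..1, β y * e y =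
      C.evenBracket η := by
  obtain ⟨d, hd⟩ := he'.bounded
  obtain ⟨d', hd'⟩ := he.bounded
  have hc0 : 0 ≤ c := (norm_nonneg _).trans (hβ.bound 0 (by simp))
  have hd0 : 0 ≤ d := (norm_nonneg _).trans (hd 0 (by simp))
  have hd0' : 0 ≤ d' := (norm_nonneg _).trans (hd' 0 (by simp))
  have hco : Coeff (d * c) fun y => e' y * β y :=
    ⟨(he'.continuousOn.aestronglyMeasurable measurableSet_Icc).mul hβ.meas, fun y hy =>
      (norm_mul_le _ _).trans (mul_le_mul (hd y hy) (hβ.bound y hy) (norm_nonneg _) hd0)⟩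
  have hco2 : Coeff (c * d') fun y => β y * e y :=
    ⟨hβ.meas.mul (he.continuousOn.aestronglyMeasurable measurableSet_Icc), fun y hy =>
      (norm_mul_le _ _).trans (mul_le_mul (hβ.bound y hy) (hd' y hy) (norm_nonneg _) hc0)⟩
  have h01 : ∀ y ∈ Icc (0 : ℝ) 1, IntervalIntegrable (fun y => e' y * β y) volume 0 y :=
    fun y hy => hco.intervalIntegrable (by simp) hy
  set R : ℝ → V →L[ℝ] V := fun y => ∫ t in (0 : ℝ)..y, e' t * β t with hR
  have hRd : LipDeriv R (fun y => e' y * β y) 0 1 :=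
    LipDeriv.primitive zero_le_one hco.bound hco.meas
  have hDR : ∀ y ∈ Icc (0 : ℝ) 1, C.oddBracket (R y) = 1 - e' y := by
    intro y hy
    have h1 := (he'.mono le_rfl hy.2).integral_eq hy.1
    rw [he0] at h1
    rw [← neg_sub, ← h1, ← intervalIntegral.integral_neg, hR,
      ← ContinuousLinearMap.intervalIntegral_comp_comm C.oddBracket (h01 y hy)]
    refine intervalIntegral.integral_congr fun t ht => ?_
    rw [uIcc_of_le hy.1] at ht
    simp only [neg_neg]
    exact C.mul_oddBracket (hem t ⟨ht.1, ht.2.trans hy.2⟩).2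
  have hDeR : ∀ y ∈ Icc (0 : ℝ) 1, C.oddBracket (e y * R y) = e y - 1 := by
    intro y hy
    rw [C.mul_oddBracket (hem y hy).1, hDR y hy, mul_sub, mul_one, hee' y hy]
  have heR : LipDeriv (fun y => e y * R y) (fun y => C.oddBracket (β y) * (e y * R y) + β y) 0 1 := by
    refine (he.mul hRd).congr_deriv (Eventually.of_forall fun y hy => ?_)
    rw [← mul_assoc (e y), hee' y (Ioo_subset_Icc_self hy), one_mul, mul_assoc]
  obtain ⟨r, hr⟩ := heR.bounded
  have hco3 : Coeff (c * r) fun y => β y * (e y * R y) :=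
    ⟨hβ.meas.mul (heR.continuousOn.aestronglyMeasurable measurableSet_Icc), fun y hy =>
      (norm_mul_le _ _).trans (mul_le_mul (hβ.bound y hy) (hr y hy) (norm_nonneg _) hc0)⟩
  refine ⟨∫ y in (0 : ℝ)..1, β y * (e y * R y), ?_, ?_⟩
  · refine intervalIntegral_mem (GradedComplex.isClosed_submodule _) zero_le_one fun y hy => ?_
    have hRm : R y ∈ C.endDeg (-1) :=
      intervalIntegral_mem (GradedComplex.isClosed_submodule _) hy.1 fun t ht =>
        C.mul_mem_endDeg (hem t ⟨ht.1, ht.2.trans hy.2⟩).2.1 (hβm t ⟨ht.1, ht.2.trans hy.2⟩)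
          (zero_add (-1))
    exact C.mul_mem_endDeg (hβm y hy) (C.mul_mem_endDeg (hem y hy).1.1 hRm (zero_add (-1)))
      (by norm_num)
  · have h1 := heR.integral_eq zero_le_one
    have hR0 : R 0 = 0 := by simp [hR]
    rw [hR0, mul_zero, sub_zero] at h1
    change e 1 * R 1 - _ = _
    rw [← ContinuousLinearMap.intervalIntegral_comp_comm C.evenBracket
      (hco3.intervalIntegrable (by simp) (by simp)), ← h1,
      ← intervalIntegral.integral_sub (heR.intervalIntegrable zero_le_one)
      (hco2.intervalIntegrable (by simp) (by simp))]
    refine intervalIntegral.integral_congr fun y hy => ?_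
    rw [uIcc_of_le zero_le_one] at hy
    change C.oddBracket (β y) * (e y * R y) + β y - β y * e y = C.evenBracket (β y * (e y * R y))
    rw [C.evenBracket_mul, hDeR y hy]
    noncomm_ring

end Comparison

/-! ### Horizontal against vertical transport -/

section HorVer

set_option maxSynthPendingDepth 3

open Set Filter Topology

variable {E : Type*} [NormedAddCommGroup E] [NormedSpace ℝ E] [FiniteDimensional ℝ E]
  {M : Type*} [TopologicalSpace M] [ChartedSpace E M] [IsManifold 𝓘(ℝ, E) ∞ M]
  {V : Type*} [NormedAddCommGroup V] [NormedSpace ℝ V] [FiniteDimensional ℝ V]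
  {C : GradedComplex V} {α : FlatSuperconnection E M C} {G : ℝ × ℝ → M}

lemma partialDeriv_comp {T : ℝ × ℝ → ℝ × ℝ} {p : ℝ × ℝ} {L : ℝ × ℝ →L[ℝ] ℝ × ℝ}
    (hG : MDifferentiableAt 𝓘(ℝ, ℝ × ℝ) 𝓘(ℝ, E) G (T p)) (hT : HasFDerivAt T L p) (w : ℝ × ℝ) :
    partialDeriv E (G ∘ T) p w = partialDeriv E G (T p) (L w) := by
  have h2 := mfderiv_comp (I := 𝓘(ℝ, ℝ × ℝ)) (I' := 𝓘(ℝ, ℝ × ℝ)) (I'' := 𝓘(ℝ, E)) p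
    (g := G) (f := T) hG hT.differentiableAt.mdifferentiableAt
  rw [mfderiv_eq_fderiv (f := T), hT.fderiv] at h2
  exact congrArg (fun (L : ℝ × ℝ →L[ℝ] E) => L w) h2

lemma area_swap (α : FlatSuperconnection E M C) (G : ℝ × ℝ → M) (p : ℝ × ℝ) :
    area α (G ∘ Prod.swap) p.swap = -area α G p := by
  by_cases hp : p ∈ regularSet E G
  · rw [area, area, indicator_of_mem hp, indicator_of_mem (mem_regularSet_swap hp)]
    have h1 : HasFDerivAt (Prod.swap : ℝ × ℝ → ℝ × ℝ)
        ((ContinuousLinearMap.snd ℝ ℝ ℝ).prod (ContinuousLinearMap.fst ℝ ℝ ℝ)) p.swap :=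
      hasFDerivAt_snd.prodMk hasFDerivAt_fst
    have hd : MDifferentiableAt 𝓘(ℝ, ℝ × ℝ) 𝓘(ℝ, E) G (Prod.swap p.swap) := by
      simpa using mdifferentiableAt_of_mem_regularSet hp
    have e1 := partialDeriv_comp hd h1 (1, 0)
    have e2 := partialDeriv_comp hd h1 (0, 1)
    have h3 := form_of_degree_two_swap α (G p) (partialDeriv E G p (1, 0))
      (partialDeriv E G p (0, 1)) rfl
    rw [form_of_degree_two α _ _ _ rfl, form_of_degree_two α _ _ _ rfl] at h3
    rw [pullTwo, pullTwo, e1, e2]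
    exact h3
  · have hp' : p.swap ∉ regularSet E (G ∘ Prod.swap) := fun h => hp (mem_regularSet_swap h)
    rw [area, area, indicator_of_notMem hp, indicator_of_notMem hp', neg_zero]

lemma horBeta_zero (v : ℝ) : horBeta α G (0, v) = 0 := by simp [horBeta]

lemma horBeta_mem {u : ℝ} (hu : u ∈ Icc (0 : ℝ) 1) (v : ℝ) : horBeta α G (u, v) ∈ C.endDeg (-1) :=
  intervalIntegral_mem (GradedComplex.isClosed_submodule _) hu.1 fun t ht => by
    have hm := horTransport_mem α G ⟨ht.1, ht.2.trans hu.2⟩ v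
    exact C.mul_mem_endDeg (C.mul_mem_endDeg hm.2.1 (area_mem α G _) (zero_add (-1))) hm.1.1
      (add_zero _)

lemma NiceMap.squareBdd_area (hG : NiceMap E G) : SquareBdd (area α G) :=
  ⟨(stronglyMeasurable_area α G).aestronglyMeasurable,
    let ⟨c, hc⟩ := hG.exists_area_le α; ⟨c, fun p _ => hc p⟩⟩

lemma NiceMap.lipDeriv_horBeta (hG : NiceMap E G) {v : ℝ} (hv : v ∈ Icc (0 : ℝ) 1) :
    LipDeriv (fun u => horBeta α G (u, v))
      (fun u => horInv α G (u, v) * area α G (u, v) * horTransport α G (u, v)) 0 1 := by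
  obtain ⟨c, hc⟩ := hG.exists_coeff_beta α
  exact LipDeriv.primitive zero_le_one (hc v hv).bound (hc v hv).meas

lemma NiceMap.exists_horBeta_le (hG : NiceMap E G) (α : FlatSuperconnection E M C) :
    ∃ c, ∀ p ∈ square, ‖horBeta α G p‖ ≤ c := by
  obtain ⟨c, hc⟩ := hG.exists_coeff_beta α
  refine ⟨c, fun p hp => ?_⟩
  have hc0 : 0 ≤ c := (norm_nonneg _).trans ((hc p.2 hp.2).bound 0 (by simp))
  refine (intervalIntegral.norm_integral_le_of_norm_le_const (C := c) fun x hx => ?_).trans ?_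
  · rw [uIoc_of_le hp.1.1] at hx
    exact (hc p.2 hp.2).bound x ⟨hx.1.le, hx.2.trans hp.1.2⟩
  · rw [sub_zero, abs_of_nonneg hp.1.1]
    exact mul_le_of_le_one_right hc0 hp.1.2

lemma NiceMap.exists_stronglyMeasurable_horBeta (hG : NiceMap E G) (α : FlatSuperconnection E M C)
    (hleft : ∀ v ∈ Icc (0 : ℝ) 1, G (0, v) = G (0, 0)) :
    ∃ β : ℝ × ℝ → V →L[ℝ] V, StronglyMeasurable β ∧ ∀ p ∈ square, horBeta α G p = β p := by
  obtain ⟨hg, hk⟩ := hG.continuousOn_horTransport α hleft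
  have h1 := stronglyMeasurable_indicator_of_continuousOn measurableSet_square hg
  have h2 := stronglyMeasurable_indicator_of_continuousOn measurableSet_square hk
  refine ⟨_, stronglyMeasurable_primitive ((h2.mul (stronglyMeasurable_area α G)).mul h1),
    fun p hp => ?_⟩
  rw [horBeta, intervalIntegral.integral_of_le hp.1.1]
  refine setIntegral_congr_fun measurableSet_Ioc fun t ht => ?_
  have : (t, p.2) ∈ square := ⟨⟨ht.1.le, ht.2.trans hp.1.2⟩, hp.2⟩
  simp only [Pi.mul_apply, indicator_of_mem this]

lemma NiceMap.squareBdd_horBeta (hG : NiceMap E G)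
    (hleft : ∀ v ∈ Icc (0 : ℝ) 1, G (0, v) = G (0, 0)) : SquareBdd (horBeta α G) := by
  obtain ⟨β, hβ, hβ'⟩ := hG.exists_stronglyMeasurable_horBeta α hleft
  refine ⟨hβ.aestronglyMeasurable.congr ?_, hG.exists_horBeta_le α⟩
  rw [EventuallyEq, ae_restrict_iff' measurableSet_square]
  exact Eventually.of_forall fun p hp => (hβ' p hp).symm

lemma NiceMap.coeff_horBeta (hG : NiceMap E G) (α : FlatSuperconnection E M C)
    (hleft : ∀ v ∈ Icc (0 : ℝ) 1, G (0, v) = G (0, 0)) :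
    ∃ c, Coeff c fun y => horBeta α G (1, y) := by
  obtain ⟨β, hβ, hβ'⟩ := hG.exists_stronglyMeasurable_horBeta α hleft
  obtain ⟨c, hc⟩ := hG.exists_horBeta_le α
  refine ⟨c, ?_, fun y hy => hc (1, y) ⟨by simp, hy⟩⟩
  have h1 : StronglyMeasurable fun y => β (1, y) := hβ.comp_measurable (by fun_prop)
  refine h1.aestronglyMeasurable.congr ?_
  rw [EventuallyEq, ae_restrict_iff' measurableSet_Icc]
  exact Eventually.of_forall fun y hy => (hβ' (1, y) ⟨by simp, hy⟩).symm

lemma NiceMap.horTransport_bottom (hG : NiceMap E G)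
    (hbot : ∀ x ∈ Icc (0 : ℝ) 1, G (x, 0) = G (0, 0)) {u : ℝ} (hu : u ∈ Icc (0 : ℝ) 1) :
    horTransport α G (u, 0) = 1 := by
  obtain ⟨c, hc⟩ := hG.exists_hor_le α
  have h := ((hG.transportPair hc).g_eq 0 (by simp)).eq_const
    (Eventually.of_forall fun x hx => ?_) hu
  · rw [h, horTransport_zero]
  · have h0 : hor α G (x, 0) = 0 := by
      refine hor_eq_zero (x := G (0, 0)) ?_
      filter_upwards [Ioo_mem_nhds hx.1 hx.2] with y hy
      exact hbot y (Ioo_subset_Icc_self hy)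
    rw [h0, zero_mul, neg_zero]

set_option maxHeartbeats 2000000 in
/-- Up to a boundary, the integral of `α²` may be computed with the vertical transports instead of
the horizontal ones. -/
theorem NiceMap.exists_evenBracket_eq (hG : NiceMap E G) (hG' : NiceMap E (G ∘ Prod.swap))
    (α : FlatSuperconnection E M C)
    (hleft : ∀ v ∈ Icc (0 : ℝ) 1, G (0, v) = G (0, 0))
    (hbot : ∀ x ∈ Icc (0 : ℝ) 1, G (x, 0) = G (0, 0)) :
    ∃ η ∈ C.endDeg (-2),
      horInv α G (1, 1) * horTransport α (G ∘ Prod.swap) (1, 1) *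
        (∫ y in (0 : ℝ)..1, horInv α (G ∘ Prod.swap) (y, 1) * horTransport α G (1, y) *
          horBeta α G (1, y)) -
      ∫ x in (0 : ℝ)..1, horInv α G (x, 1) * horTransport α (G ∘ Prod.swap) (1, x) *
        -horBeta α (G ∘ Prod.swap) (1, x) = C.evenBracket η := by
  obtain ⟨c, hc⟩ := hG.exists_hor_le α
  obtain ⟨c', hc'⟩ := hG'.exists_hor_le α
  have ht := hG.transportPair hc
  have ht' := hG'.transportPair hc'
  obtain ⟨hgc, hkc⟩ := hG.continuousOn_horTransport α hleft
  obtain ⟨hhc, hlc⟩ := hG'.continuousOn_horTransport α hbot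
  set g := horTransport α G with hg
  set k := horInv α G with hk
  set β := horBeta α G with hβ
  set b := area α G with hb
  set h : ℝ × ℝ → V →L[ℝ] V := fun p => horTransport α (G ∘ Prod.swap) p.swap with hh
  set l : ℝ × ℝ → V →L[ℝ] V := fun p => horInv α (G ∘ Prod.swap) p.swap with hl
  set γ : ℝ × ℝ → V →L[ℝ] V := fun p => -horBeta α (G ∘ Prod.swap) p.swap with hγ
  have hgm : ∀ p ∈ square, g p ∈ C.cochainMaps ∧ k p ∈ C.cochainMaps := fun p hp =>
    horTransport_mem α G hp.1 p.2
  have hhm : ∀ p ∈ square, h p ∈ C.cochainMaps ∧ l p ∈ C.cochainMaps := fun p hp =>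
    horTransport_mem α _ hp.2 p.1
  have hβm : ∀ p ∈ square, β p ∈ C.endDeg (-1) := fun p hp => horBeta_mem hp.1 p.2
  have hγm : ∀ p ∈ square, γ p ∈ C.endDeg (-1) := fun p hp => neg_mem (horBeta_mem hp.2 p.1)
  have hgk : ∀ p ∈ square, g p * k p = 1 := fun p hp => ht.gk p.1 hp.1 p.2 hp.2
  have hkg : ∀ p ∈ square, k p * g p = 1 := fun p hp => ht.kg p.1 hp.1 p.2 hp.2
  have hhl : ∀ p ∈ square, h p * l p = 1 := fun p hp => ht'.gk p.2 hp.2 p.1 hp.1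
  have hlh : ∀ p ∈ square, l p * h p = 1 := fun p hp => ht'.kg p.2 hp.2 p.1 hp.1
  have hHm : ∀ p ∈ square, k p * h p ∈ C.cochainMaps := fun p hp =>
    C.mul_mem_cochainMaps (hgm p hp).2 (hhm p hp).1
  have hhx : ∀ y ∈ Icc (0 : ℝ) 1, LipDeriv (fun x => h (x, y))
      (fun x => -(hor α G (x, y) * h (x, y)) + h (x, y) * C.oddBracket (γ (x, y))) 0 1 := by
    intro y hy
    refine (hG'.stokes (α := α) hbot hy).congr_deriv (Eventually.of_forall fun x _ => ?_)
    rw [← map_neg]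
    rfl
  have hhy : ∀ x ∈ Icc (0 : ℝ) 1, LipDeriv (fun y => h (x, y))
      (fun y => -(ver α G (x, y) * h (x, y))) 0 1 := fun x hx => ht'.g_eq x hx
  have hly : ∀ x ∈ Icc (0 : ℝ) 1, LipDeriv (fun y => l (x, y))
      (fun y => l (x, y) * ver α G (x, y)) 0 1 := fun x hx => ht'.k_eq x hx
  have hγy : ∀ x ∈ Icc (0 : ℝ) 1, LipDeriv (fun y => γ (x, y))
      (fun y => l (x, y) * b (x, y) * h (x, y)) 0 1 := by
    intro x hx
    have h1 := (LipDeriv.const (0 : V →L[ℝ] V) 0 1).sub (hG'.lipDeriv_horBeta (α := α) hx)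
    refine (h1.congr_deriv (Eventually.of_forall fun y _ => ?_)).congr
      (fun y _ => by simp [hγ])
    have h2 : area α (G ∘ Prod.swap) (y, x) = -b (x, y) := area_swap α G (x, y)
    rw [h2, mul_neg, neg_mul, zero_sub, neg_neg]
    rfl
  -- k h is the holonomy of a loop at the common corner, so the connection terms of its two factors
  -- cancel in both directions and only the exact curvature terms are left.
  have hHx : ∀ y ∈ Icc (0 : ℝ) 1, LipDeriv (fun x => k (x, y) * h (x, y))
      (fun x => C.oddBracket (k (x, y) * h (x, y) * γ (x, y))) 0 1 := by
    intro y hy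
    refine ((ht.k_eq y hy).mul (hhx y hy)).congr_deriv (Eventually.of_forall fun x hx => ?_)
    rw [C.mul_oddBracket (hHm (x, y) ⟨Ioo_subset_Icc_self hx, hy⟩)]
    noncomm_ring
  have hHy : ∀ x ∈ Icc (0 : ℝ) 1, LipDeriv (fun y => k (x, y) * h (x, y))
      (fun y => C.oddBracket (β (x, y)) * (k (x, y) * h (x, y))) 0 1 := by
    intro x hx
    refine ((hG.lipDeriv_horInv hleft hx).mul (hhy x hx)).congr_deriv
      (Eventually.of_forall fun y _ => ?_)
    noncomm_ring
  have hWy : ∀ x ∈ Icc (0 : ℝ) 1, LipDeriv (fun y => k (x, y) * h (x, y) * γ (x, y))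
      (fun y => C.oddBracket (β (x, y)) * (k (x, y) * h (x, y) * γ (x, y)) +
        k (x, y) * b (x, y) * g (x, y) * (k (x, y) * h (x, y))) 0 1 := by
    intro x hx
    refine ((hHy x hx).mul (hγy x hx)).congr_deriv (Eventually.of_forall fun y hy => ?_)
    have hp : (x, y) ∈ square := ⟨hx, Ioo_subset_Icc_self hy⟩
    have e1 : k (x, y) * h (x, y) * (l (x, y) * b (x, y) * h (x, y)) =
        k (x, y) * b (x, y) * h (x, y) := by
      calc _ = k (x, y) * (h (x, y) * l (x, y)) * b (x, y) * h (x, y) := by noncomm_ring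
        _ = _ := by rw [hhl _ hp, mul_one]
    have e2 : k (x, y) * b (x, y) * g (x, y) * (k (x, y) * h (x, y)) =
        k (x, y) * b (x, y) * h (x, y) := by
      calc _ = k (x, y) * b (x, y) * (g (x, y) * k (x, y)) * h (x, y) := by noncomm_ring
        _ = _ := by rw [hgk _ hp, mul_one]
    rw [e1, e2, mul_assoc]
  have hβx : ∀ y ∈ Icc (0 : ℝ) 1, LipDeriv (fun x => β (x, y) * (k (x, y) * h (x, y)))
      (fun x => k (x, y) * b (x, y) * g (x, y) * (k (x, y) * h (x, y)) +
        β (x, y) * C.oddBracket (k (x, y) * h (x, y) * γ (x, y))) 0 1 := fun y hy =>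
    (hG.lipDeriv_horBeta hy).mul (hHx y hy)
  have sk := SquareBdd.of_continuousOn hkc
  have sg := SquareBdd.of_continuousOn hgc
  have sh : SquareBdd h := (SquareBdd.of_continuousOn hhc).swap
  have sβ : SquareBdd β := hG.squareBdd_horBeta hleft
  have sγ : SquareBdd γ := by
    have := ((hG'.squareBdd_horBeta (α := α) hbot).swap).clm
      (-ContinuousLinearMap.id ℝ (V →L[ℝ] V))
    exact this
  have sb : SquareBdd b := hG.squareBdd_area
  -- First comparison: from W = k h γ on the top edge to β k h on the right edge.
  have hA := C.integral_eq_evenBracket_add (β := β) (W := fun p => k p * h p * γ p)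
    (b := fun p => k p * b p * g p) (h := fun p => k p * h p) sβ ((sk.mul sh).mul sγ)
    ((sk.mul sb).mul sg) (sk.mul sh) hWy
    (fun x _ => by
      have : γ (x, 0) = 0 := by
        change -horBeta α (G ∘ Prod.swap) (0, x) = 0
        rw [horBeta_zero, neg_zero]
      rw [this, mul_zero])
    hβx (fun y _ => horBeta_zero y)
  obtain ⟨d, hd⟩ := hG.coeff_horBeta α hleft
  have h1 : (1 : ℝ) ∈ Icc (0 : ℝ) 1 := by simp
  -- Second comparison, on the right edge: the holonomy k h to the right of β is traded for its
  -- inverse l g to the left. The inverse starts at 1 because the bottom edge is mapped to a point.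
  obtain ⟨η, hη, hη'⟩ := C.exists_evenBracket_eq (β := fun y => β (1, y))
    (e := fun y => k (1, y) * h (1, y)) (e' := fun y => l (1, y) * g (1, y)) hd
    (fun y hy => hβm (1, y) ⟨h1, hy⟩) (hHy 1 h1)
    (((hly 1 h1).mul (hG.stokes hleft h1)).congr_deriv
      (Eventually.of_forall fun y _ => by noncomm_ring))
    (fun y hy => ⟨hHm (1, y) ⟨h1, hy⟩,
      C.mul_mem_cochainMaps (hhm (1, y) ⟨h1, hy⟩).2 (hgm (1, y) ⟨h1, hy⟩).1⟩)
    (fun y hy => by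
      have hp : ((1 : ℝ), y) ∈ square := ⟨h1, hy⟩
      calc k (1, y) * h (1, y) * (l (1, y) * g (1, y))
          = k (1, y) * (h (1, y) * l (1, y)) * g (1, y) := by noncomm_ring
        _ = 1 := by rw [hhl _ hp, mul_one, hkg _ hp])
    (by
      have e1 : l (1, 0) = 1 := horInv_zero α _ 1
      have e2 : g (1, 0) = 1 := hG.horTransport_bottom hbot h1
      rw [e1, e2, one_mul])
  refine ⟨η - ∫ z in square, β z * (k z * h z * γ z), sub_mem hη ?_, ?_⟩
  · rw [((sβ.mul ((sk.mul sh).mul sγ))).integral_eq]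
    refine intervalIntegral_mem (GradedComplex.isClosed_submodule _) zero_le_one fun x hx =>
      intervalIntegral_mem (GradedComplex.isClosed_submodule _) zero_le_one fun y hy => ?_
    have hp : (x, y) ∈ square := ⟨hx, hy⟩
    exact C.mul_mem_endDeg (hβm _ hp) (C.mul_mem_endDeg (hHm _ hp).1 (hγm _ hp) (zero_add (-1)))
      (by norm_num)
  · rw [map_sub, ← hη']
    have hA' : ∫ x in (0 : ℝ)..1, k (x, 1) * horTransport α (G ∘ Prod.swap) (1, x) *
        -horBeta α (G ∘ Prod.swap) (1, x) = _ := hA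
    rw [hA']
    change k (1, 1) * h (1, 1) * (∫ y in (0 : ℝ)..1, l (1, y) * g (1, y) * β (1, y)) - _ = _
    abel

end HorVer

/-! ### Evaluation of the series of iterated integrals -/

section SeriesEval

set_option maxSynthPendingDepth 3

open Set Filter Topology

/-- By uniqueness any explicit solution of the transport equation may be used, together with any
left inverse of it. -/
lemma insertedHol_eq {𝔄 : Type*} [NormedRing 𝔄] [NormedAlgebra ℝ 𝔄] [CompleteSpace 𝔄]
    [FiniteDimensional ℝ 𝔄] {c : ℝ} {a U K : ℝ → 𝔄} (B : ℝ → 𝔄) (ha : Coeff c a)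
    (hU : LipDeriv U (fun t => a t * U t) 0 1) (hU0 : U 0 = 1)
    (hK : ∀ t ∈ Icc (0 : ℝ) 1, K t * U t = 1) :
    insertedHol a B = U 1 * ∫ t in (0 : ℝ)..1, K t * B t * U t := by
  have h1 : ∀ t ∈ Icc (0 : ℝ) 1, U t = transport a t := fun t ht => by
    rw [eq_transport_mul ha hU ht, hU0, mul_one]
  have h2 : ∀ t ∈ Icc (0 : ℝ) 1, K t = transportInv a t := fun t ht => by
    have h3 := transport_mul_inv ha ht
    rw [← h1 t ht] at h3
    rw [← mul_one (K t), ← h3, ← mul_assoc, hK t ht, one_mul]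
  rw [insertedHol, h1 1 (by simp)]
  congr 1
  refine intervalIntegral.integral_congr fun t ht => ?_
  rw [uIcc_of_le zero_le_one] at ht
  simp only [h1 t ht, h2 t ht]

lemma ae_mem_Ioo_of_mem_uIoc : ∀ᵐ t : ℝ, t ∈ Set.uIoc (0 : ℝ) 1 → t ∈ Ioo (0 : ℝ) 1 := by
  filter_upwards [ae_ne_real 1] with t ht htI
  rw [uIoc_of_le zero_le_one] at htI
  exact ⟨htI.1, lt_of_le_of_ne htI.2 ht⟩

variable {E : Type*} [NormedAddCommGroup E] [NormedSpace ℝ E] [FiniteDimensional ℝ E]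
  {M : Type*} [TopologicalSpace M] [ChartedSpace E M] [IsManifold 𝓘(ℝ, E) ∞ M]
  {V : Type*} [NormedAddCommGroup V] [NormedSpace ℝ V] [FiniteDimensional ℝ V]
  {C : GradedComplex V}

/-- The series of iterated integrals converges absolutely, and is computed by solving the equation
of parallel transport on the lines `s = const`. -/
theorem omegaIntegral_series_eq (α : FlatSuperconnection E M C) {H : ℝ × ℝ → M}
    {a B : ℝ × ℝ → V →L[ℝ] V} {W : ℝ → V →L[ℝ] V} {c : ℝ} (hc : 0 ≤ c)
    (hreg : ∀ᵐ p, p ∈ square → p ∈ regularSet E H)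
    (hae : ∀ᵐ p, p ∈ square → (pullOne α H p (1, 0) = a p ∧ ‖a p‖ ≤ c) ∧
      pullTwo α H p = B p ∧ ‖B p‖ ≤ c)
    (hW : ∀ᵐ s, s ∈ Ioo (0 : ℝ) 1 →
      (W s = 0 ∧ ∀ᵐ t, t ∈ Ioo (0 : ℝ) 1 → B (t, s) = 0) ∨
      ∃ U K : ℝ → V →L[ℝ] V, LipDeriv U (fun t => -(a (t, s) * U t)) 0 1 ∧ U 0 = 1 ∧
        (∀ t ∈ Icc (0 : ℝ) 1, K t * U t = 1) ∧
        W s = U 1 * ∫ t in (0 : ℝ)..1, K t * B (t, s) * U t) :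
    (∀ m n, IntegrableOn (omegaDensity α H m n) (simplexTimesInterval (m + n + 1))) ∧
    (Summable fun p : ℕ × ℕ => ‖omegaIntegral α H p.1 p.2‖) ∧
    ∑' p : ℕ × ℕ, (-1 : ℝ) ^ (p.1 + p.2) • omegaIntegral α H p.1 p.2 =
      ∫ s in (0 : ℝ)..1, W s := by
  -- The pullbacks are known and bounded only almost everywhere; truncating them at norm c gives
  -- strongly measurable versions bounded everywhere.
  have htr : ∀ f : ℝ × ℝ → V →L[ℝ] V, StronglyMeasurable f →
      StronglyMeasurable ({p | ‖f p‖ ≤ c}.indicator f) ∧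
      ∀ p, ‖{p | ‖f p‖ ≤ c}.indicator f p‖ ≤ c := by
    intro f hf
    refine ⟨hf.indicator (hf.norm.measurable measurableSet_Iic), fun p => ?_⟩
    by_cases hp : ‖f p‖ ≤ c
    · rwa [indicator_of_mem (show p ∈ {p | ‖f p‖ ≤ c} from hp)]
    · rwa [indicator_of_notMem (show p ∉ {p | ‖f p‖ ≤ c} from hp), norm_zero]
  obtain ⟨ha1, ha2⟩ := htr _ (stronglyMeasurable_indicator_pullOne α H (1, 0))
  obtain ⟨hB1, hB2⟩ := htr _ (stronglyMeasurable_area α H)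
  set a' := {p | ‖(regularSet E H).indicator (fun p => pullOne α H p (1, 0)) p‖ ≤ c}.indicator
    ((regularSet E H).indicator fun p => pullOne α H p (1, 0)) with ha'
  set B' := {p | ‖area α H p‖ ≤ c}.indicator (area α H) with hB'
  have hae' : ∀ᵐ p, p ∈ square → MDifferentiableAt 𝓘(ℝ, ℝ × ℝ) 𝓘(ℝ, E) H p ∧
      (pullOne α H p (1, 0) = a' p ∧ a' p = a p) ∧ pullTwo α H p = B' p ∧ B' p = B p := by
    filter_upwards [hreg, hae] with p h1 h2 hp
    obtain ⟨⟨e1, e2⟩, e3, e4⟩ := h2 hp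
    have hr := h1 hp
    have i1 : a' p = pullOne α H p (1, 0) := by
      rw [ha', indicator_of_mem, indicator_of_mem hr]
      rw [mem_ofPred_eq, indicator_of_mem hr, e1]
      exact e2
    have i2 : B' p = pullTwo α H p := by
      rw [hB', indicator_of_mem, area, indicator_of_mem hr]
      rw [mem_ofPred_eq, area, indicator_of_mem hr, e3]
      exact e4
    exact ⟨mdifferentiableAt_of_mem_regularSet hr, ⟨i1.symm, i1.trans e1⟩, i2.symm, i2.trans e3⟩
  obtain ⟨h1, h2, h3⟩ := omegaIntegral_series α H ha1 hB1 ha2 hB2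
    (hae'.mono fun p hp hps => ⟨(hp hps).1, (hp hps).2.1.1, (hp hps).2.2.1⟩)
  refine ⟨h1, h2, h3.trans ?_⟩
  refine intervalIntegral.integral_congr_ae ?_
  filter_upwards [ae_ae_of_ae_swap hae', hW, ae_ne_real 1] with s hs hWs hs1 hsI
  rw [uIoc_of_le zero_le_one] at hsI
  have hsI' : s ∈ Ioo (0 : ℝ) 1 := ⟨hsI.1, lt_of_le_of_ne hsI.2 hs1⟩
  have hs' : ∀ᵐ t, t ∈ Ioo (0 : ℝ) 1 → a' (t, s) = a (t, s) ∧ B' (t, s) = B (t, s) := by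
    filter_upwards [hs] with t ht htI
    have := ht ⟨Ioo_subset_Icc_self htI, Ioo_subset_Icc_self hsI'⟩
    exact ⟨this.2.1.2, this.2.2.2⟩
  have hIoc := ae_mem_Ioo_of_mem_uIoc
  rcases hWs hsI' with ⟨hW0, hB0⟩ | ⟨U, K, hU, hU0, hK, hWU⟩
  -- On a line that carries no α² the contribution is zero whatever the transport is, so no
  -- description of the connection is needed there.
  · rw [hW0, insertedHol, intervalIntegral.integral_zero_ae, mul_zero]
    filter_upwards [hs', hB0, hIoc] with t e1 e2 e3 e4
    rw [(e1 (e3 e4)).2, e2 (e3 e4), mul_zero, zero_mul]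
  · have hco : Coeff c fun t => -a' (t, s) :=
      ⟨(ha1.comp_measurable (measurable_id.prodMk measurable_const)).aestronglyMeasurable.neg,
        fun t _ => by rw [norm_neg]; exact ha2 _⟩
    rw [insertedHol_eq _ hco (hU.congr_deriv ?_) hU0 hK, hWU]
    · congr 1
      refine intervalIntegral.integral_congr_ae ?_
      filter_upwards [hs', hIoc] with t e1 e3 e4
      rw [(e1 (e3 e4)).2]
    · filter_upwards [hs'] with t e1 e2
      rw [(e1 e2).1, neg_mul]

end SeriesEval

/-! ### Reparametrizations -/

section Reparam

set_option maxSynthPendingDepth 3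

open Set Filter Topology

lemma quasiMeasurePreserving_affine {c : ℝ} (hc : c ≠ 0) (d : ℝ) :
    Measure.QuasiMeasurePreserving (fun x : ℝ => d + c * x) volume volume := by
  have h1 : Measure.QuasiMeasurePreserving (fun x : ℝ => c * x) volume volume := by
    refine ⟨measurable_const_mul c, Measure.AbsolutelyContinuous.mk fun s hs h0 => ?_⟩
    rw [Measure.map_apply (measurable_const_mul c) hs, Real.volume_preimage_mul_left hc, h0,
      mul_zero]
  exact (measurePreserving_add_left volume d).quasiMeasurePreserving.comp h1

lemma quasiMeasurePreserving_one_sub :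
    Measure.QuasiMeasurePreserving (fun x : ℝ => 1 - x) volume volume := by
  have := quasiMeasurePreserving_affine (c := -1) (by norm_num) 1
  simpa [sub_eq_add_neg] using this

/-- For every t ≠ 1 the map is affine in s with nonzero slope, so preimages of null sets are null by
Fubini. The second half of Θ has this form along the top edge. -/
lemma ae_comp_bilinear {P : ℝ → Prop} (h : ∀ᵐ x, P x) :
    ∀ᵐ p : ℝ × ℝ, P (1 - (2 - 2 * p.1) * p.2) := by
  have h0 : volume (toMeasurable volume {x | ¬ P x}) = 0 := by
    rw [measure_toMeasurable]; exact h
  set N := toMeasurable volume {x | ¬ P x} with hN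
  have hρ : Measurable fun p : ℝ × ℝ => 1 - (2 - 2 * p.1) * p.2 := by fun_prop
  have h1 : volume ((fun p : ℝ × ℝ => 1 - (2 - 2 * p.1) * p.2) ⁻¹' N) = 0 := by
    rw [Measure.volume_eq_prod, Measure.measure_prod_null (hρ (measurableSet_toMeasurable _ _))]
    filter_upwards [ae_ne_real 1] with t ht
    have hq := quasiMeasurePreserving_affine (c := -(2 - 2 * t))
      (by intro h; apply ht; linarith) 1
    have := hq.preimage_null h0
    rw [Pi.zero_apply, ← this]
    congr 1
    ext s
    simp only [mem_preimage]
    rw [show 1 - (2 - 2 * t) * s = 1 + -(2 - 2 * t) * s by ring]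
  rw [measure_eq_zero_iff_ae_notMem] at h1
  filter_upwards [h1] with p hp
  by_contra hcon
  exact hp (subset_toMeasurable volume {x | ¬ P x} hcon)

variable {E : Type*} [NormedAddCommGroup E] [NormedSpace ℝ E] [FiniteDimensional ℝ E]
  {M : Type*} [TopologicalSpace M] [ChartedSpace E M] [IsManifold 𝓘(ℝ, E) ∞ M]
  {V : Type*} [NormedAddCommGroup V] [NormedSpace ℝ V] [FiniteDimensional ℝ V]
  {C : GradedComplex V}

lemma form_two_swap (α : FlatSuperconnection E M C) (x : M) (v w : TangentSpace 𝓘(ℝ, E) x) :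
    α.form 2 x ![w, v] = -α.form 2 x ![v, w] := by
  have h := form_of_degree_two_swap α x v w rfl
  rwa [form_of_degree_two α _ _ _ rfl, form_of_degree_two α _ _ _ rfl] at h

lemma form_two_lin (α : FlatSuperconnection E M C) (x : M) (v w : TangentSpace 𝓘(ℝ, E) x)
    (a b c d : ℝ) :
    α.form 2 x ![a • v + b • w, c • v + d • w] = (a * d - b * c) • α.form 2 x ![v, w] := by
  have h0 : ∀ u, α.form 2 x ![u, u] = 0 := fun u => by
    have h := form_two_swap α x u u
    rw [eq_neg_iff_add_eq_zero, ← two_smul ℝ] at h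
    exact (smul_eq_zero.mp h).resolve_left two_ne_zero
  have hl : ∀ (a b : ℝ) u u' z, α.form 2 x ![a • u + b • u', z] =
      a • α.form 2 x ![u, z] + b • α.form 2 x ![u', z] := fun a b u u' z => by
    have e1 := (α.form 2 x).toAlternatingMap.toMultilinearMap.cons_add ![z] (a • u) (b • u')
    have e2 := (α.form 2 x).toAlternatingMap.toMultilinearMap.cons_smul ![z] a u
    have e3 := (α.form 2 x).toAlternatingMap.toMultilinearMap.cons_smul ![z] b u'
    exact e1.trans (congrArg₂ (· + ·) e2 e3)
  have hr : ∀ z, α.form 2 x ![z, c • v + d • w] =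
      c • α.form 2 x ![z, v] + d • α.form 2 x ![z, w] := fun z => by
    rw [form_two_swap, hl, form_two_swap α x z v, form_two_swap α x z w]
    simp only [smul_neg, neg_add, neg_neg]
  rw [hl, hr, hr, h0, h0, form_two_swap α x v w]
  module

variable {G H : ℝ × ℝ → M} {p : ℝ × ℝ}

lemma partialDeriv_lin (G : ℝ × ℝ → M) (p w : ℝ × ℝ) :
    partialDeriv E G p w = w.1 • partialDeriv E G p (1, 0) + w.2 • partialDeriv E G p (0, 1) := by
  have h : w = w.1 • ((1 : ℝ), (0 : ℝ)) + w.2 • ((0 : ℝ), (1 : ℝ)) := by ext <;> simp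
  have key : ∀ L : ℝ × ℝ →L[ℝ] E, L w = w.1 • L (1, 0) + w.2 • L (0, 1) := fun L => by
    conv_lhs => rw [h, map_add, map_smul, map_smul]
  exact key (mfderiv 𝓘(ℝ, ℝ × ℝ) 𝓘(ℝ, E) G p)

lemma pull_congr (α : FlatSuperconnection E M C) (h : H =ᶠ[𝓝 p] G) (w : ℝ × ℝ) :
    pullOne α H p w = pullOne α G p w ∧ pullTwo α H p = pullTwo α G p := by
  have hd : ∀ w, (partialDeriv E H p w : E) = (partialDeriv E G p w : E) := fun w =>
    congrArg (fun L : ℝ × ℝ →L[ℝ] E => L w) (h.mfderiv_eq (I := 𝓘(ℝ, ℝ × ℝ)) (I' := 𝓘(ℝ, E)))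
  constructor
  · refine Eq.trans ?_ (form_congr_point (α.form 1) h.self_of_nhds _)
    exact congrArg (α.form 1 (H p)) (funext fun _ => hd w)
  · refine Eq.trans ?_ (form_congr_point (α.form 2) h.self_of_nhds _)
    refine congrArg (α.form 2 (H p)) (funext fun i => ?_)
    fin_cases i
    · exact hd _
    · exact hd _

/-- Pullbacks along a reparametrized map. -/
lemma pull_comp (α : FlatSuperconnection E M C) {T : ℝ × ℝ → ℝ × ℝ} {L : ℝ × ℝ →L[ℝ] ℝ × ℝ}
    (h : H =ᶠ[𝓝 p] G ∘ T) (hG : MDifferentiableAt 𝓘(ℝ, ℝ × ℝ) 𝓘(ℝ, E) G (T p))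
    (hT : HasFDerivAt T L p) :
    (∀ w, pullOne α H p w = (L w).1 • pullOne α G (T p) (1, 0) +
      (L w).2 • pullOne α G (T p) (0, 1)) ∧
    pullTwo α H p = ((L (1, 0)).1 * (L (0, 1)).2 - (L (1, 0)).2 * (L (0, 1)).1) •
      pullTwo α G (T p) := by
  have hd : ∀ w, partialDeriv E (G ∘ T) p w = (L w).1 • partialDeriv E G (T p) (1, 0) +
      (L w).2 • partialDeriv E G (T p) (0, 1) := fun w =>
    (partialDeriv_comp hG hT w).trans (partialDeriv_lin G (T p) (L w))
  refine ⟨fun w => ?_, ?_⟩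
  · rw [(pull_congr α h w).1]
    have key : ∀ (f : E →L[ℝ] V →L[ℝ] V) (a b : ℝ) (u v : E),
        f (a • u + b • v) = a • f u + b • f v := fun f a b u v => by
      rw [map_add, map_smul, map_smul]
    unfold pullOne
    rw [hd]
    exact key (oneFormCLM E (V →L[ℝ] V) (α.form 1 (G (T p)))) _ _ _ _
  · rw [(pull_congr α h 0).2]
    unfold pullTwo
    rw [hd, hd]
    exact form_two_lin α (G (T p)) _ _ _ _ _ _

lemma mem_regularSet_of_comp {T : ℝ × ℝ → ℝ × ℝ} (h : H =ᶠ[𝓝 p] G ∘ T)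
    (hG : ContMDiffAt 𝓘(ℝ, ℝ × ℝ) 𝓘(ℝ, E) 2 G (T p)) (hT : ContDiffAt ℝ 2 T p)
    (hp : p ∈ interior square) : p ∈ regularSet E H :=
  ⟨hp, (ContMDiffAt.comp p hG hT.contMDiffAt).congr_of_eventuallyEq h⟩

lemma eq_zero_of_finrank_range {L : ℝ × ℝ →L[ℝ] E}
    (h : Module.finrank ℝ (LinearMap.range L.toLinearMap) = 0) : L = 0 := by
  have h1 : LinearMap.range L.toLinearMap = ⊥ := Submodule.finrank_eq_zero.mp h
  rw [LinearMap.range_eq_bot] at h1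
  exact ContinuousLinearMap.coe_injective h1

lemma not_linearIndependent_of_finrank_range {L : ℝ × ℝ →L[ℝ] E}
    (h : Module.finrank ℝ (LinearMap.range L.toLinearMap) ≤ 1) :
    ¬ LinearIndependent ℝ ![L (1, 0), L (0, 1)] := fun hli => by
  have h2 : LinearIndependent ℝ (fun i => (⟨![L (1, 0), L (0, 1)] i, by
      fin_cases i <;> exact ⟨_, rfl⟩⟩ : LinearMap.range L.toLinearMap)) :=
    LinearIndependent.of_comp (Submodule.subtype _) hli
  have h3 := h2.fintype_card_le_finrank
  rw [Fintype.card_fin] at h3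
  omega

lemma pullOne_eq_zero_of_rankAt (α : FlatSuperconnection E M C) (h : rankAt E G p = 0)
    (w : ℝ × ℝ) : pullOne α G p w = 0 := by
  have h0 : partialDeriv E G p w = 0 := congrArg (fun L : ℝ × ℝ →L[ℝ] E => L w)
    (eq_zero_of_finrank_range (E := E) (L := mfderiv 𝓘(ℝ, ℝ × ℝ) 𝓘(ℝ, E) G p) h)
  unfold pullOne
  rw [h0]
  exact (α.form 1 (G p)).map_coord_zero 0 rfl

lemma pullTwo_eq_zero_of_rankAt (α : FlatSuperconnection E M C) (h : rankAt E G p ≤ 1) :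
    pullTwo α G p = 0 :=
  (α.form 2 (G p)).toAlternatingMap.map_linearDependent _
    (not_linearIndependent_of_finrank_range (E := E) (L := mfderiv 𝓘(ℝ, ℝ × ℝ) 𝓘(ℝ, E) G p) h)

/-- A piecewise smooth map is smooth at almost every point of every horizontal line. -/
lemma IsPiecewiseSmooth.ae_contMDiffAt_slice (h : IsPiecewiseSmooth E G) {v : ℝ}
    (hv : v ∈ Icc (0 : ℝ) 1) : ∀ᵐ u, u ∈ Icc (0 : ℝ) 1 → u ∈ Ioo (0 : ℝ) 1 ∧
      ContMDiffAt 𝓘(ℝ, ℝ) 𝓘(ℝ, E) 2 (fun x => G (x, v)) u := by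
  obtain ⟨-, r, K, -, hKx, hKU, hKs⟩ := h
  set A : ℝ →ᴬ[ℝ] ℝ × ℝ := (ContinuousAffineMap.id ℝ ℝ).prod (ContinuousAffineMap.const ℝ ℝ v) with hA
  have hAx : ∀ x, A x = (x, v) := fun _ => rfl
  have h1 : ∀ᵐ u : ℝ, ∀ i, u ∉ frontier (A ⁻¹' K i) := by
    rw [ae_all_iff]
    intro i
    have := ((hKx i).affine_preimage A.toAffineMap).addHaar_frontier (volume : Measure ℝ)
    rwa [measure_eq_zero_iff_ae_notMem] at this
  filter_upwards [h1, ae_ne_real 0, ae_ne_real 1] with u hu h0 h1 huI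
  refine ⟨⟨lt_of_le_of_ne huI.1 h0.symm, lt_of_le_of_ne huI.2 h1⟩, ?_⟩
  have hs : (u, v) ∈ square := ⟨huI, hv⟩
  rw [← hKU] at hs
  obtain ⟨i, hi⟩ := mem_iUnion.mp hs
  have hint : u ∈ interior (A ⁻¹' K i) := by
    by_contra hcon
    exact hu i ⟨subset_closure hi, hcon⟩
  have h2 : ContMDiffOn 𝓘(ℝ, ℝ) 𝓘(ℝ, E) ∞ (G ∘ A) (A ⁻¹' K i) :=
    (hKs i).comp A.contDiff.contMDiff.contMDiffOn fun _ hx => hx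
  exact (h2.contMDiffAt (mem_interior_iff_mem_nhds.mp hint)).of_le
    (WithTop.coe_le_coe.mpr le_top)

end Reparam

/-! ### Maps of rank zero are locally constant -/

section LocallyConstant

set_option maxSynthPendingDepth 3

open Set Filter Topology

/-- By Fubini the derivative vanishes almost everywhere on almost every horizontal line, where the
Lipschitz function is then constant. Continuity in v extends the conclusion to every line. -/
lemma eq_left_of_ae_hasFDerivAt_zero {X : Type*} [NormedAddCommGroup X] [NormedSpace ℝ X]
    {f : ℝ × ℝ → X} {K : NNReal} {a b c d : ℝ} (hf : LipschitzOnWith K f (Icc a b ×ˢ Icc c d))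
    (h : ∀ᵐ q, q ∈ Ioo a b ×ˢ Ioo c d → HasFDerivAt f (0 : ℝ × ℝ →L[ℝ] X) q)
    {u v : ℝ} (hu : u ∈ Icc a b) (hv : v ∈ Ioo c d) : f (u, v) = f (a, v) := by
  have hline : ∀ v ∈ Icc c d, LipschitzOnWith K (fun x => f (x, v)) (Icc a b) := fun v hv => by
    have := hf.comp (f := fun x : ℝ => (x, v)) (s := Icc a b)
      (LipschitzWith.prodMk_right v).lipschitzOnWith fun x hx => ⟨hx, hv⟩
    rwa [mul_one] at this
  have h1 : ∀ᵐ v, v ∈ Ioo c d → f (u, v) = f (a, v) := by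
    filter_upwards [ae_ae_of_ae_swap h] with v hv hvI
    have hL : LipDeriv (fun x => f (x, v)) (fun _ => 0) a b := by
      refine ⟨⟨K, hline v (Ioo_subset_Icc_self hvI)⟩, ?_⟩
      filter_upwards [hv] with x hx hxI
      have h2 := HasFDerivAt.comp_hasDerivAt (f := fun x : ℝ => (x, v)) x (hx ⟨hxI, hvI⟩)
        ((hasDerivAt_id x).prodMk (hasDerivAt_const x v))
      rwa [zero_apply] at h2
    exact hL.eq_const (Eventually.of_forall fun _ _ => rfl) hu
  have hc : ∀ u ∈ Icc a b, ContinuousOn (fun v => f (u, v)) (Ioo c d) := fun u hu =>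
    hf.continuousOn.comp (f := fun v : ℝ => (u, v)) (by fun_prop)
      fun v hv => ⟨hu, Ioo_subset_Icc_self hv⟩
  refine Measure.eqOn_open_of_ae_eq (μ := volume) (U := Ioo c d) (f := fun v => f (u, v))
    (g := fun v => f (a, v)) ?_ isOpen_Ioo (hc u hu) (hc a ⟨le_rfl, hu.1.trans hu.2⟩) hv
  rw [EventuallyEq, ae_restrict_iff' measurableSet_Ioo]
  exact h1

lemma eq_of_ae_hasFDerivAt_zero {X : Type*} [NormedAddCommGroup X] [NormedSpace ℝ X]
    {f : ℝ × ℝ → X} {K : NNReal} {a b c d : ℝ} (hf : LipschitzOnWith K f (Icc a b ×ˢ Icc c d))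
    (h : ∀ᵐ q, q ∈ Ioo a b ×ˢ Ioo c d → HasFDerivAt f (0 : ℝ × ℝ →L[ℝ] X) q)
    {p q : ℝ × ℝ} (hp : p ∈ Ioo a b ×ˢ Ioo c d) (hq : q ∈ Ioo a b ×ˢ Ioo c d) : f p = f q := by
  have h1 : f p = f (q.1, p.2) :=
    (eq_left_of_ae_hasFDerivAt_zero hf h (Ioo_subset_Icc_self hp.1) hp.2).trans
      (eq_left_of_ae_hasFDerivAt_zero hf h (Ioo_subset_Icc_self hq.1) hp.2).symm
  have hf' : LipschitzOnWith K (f ∘ Prod.swap) (Icc c d ×ˢ Icc a b) := by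
    refine LipschitzOnWith.of_dist_le_mul fun x hx y hy => ?_
    have := hf.dist_le_mul x.swap ⟨hx.2, hx.1⟩ y.swap ⟨hy.2, hy.1⟩
    rwa [Prod.dist_eq, Prod.fst_swap, Prod.fst_swap, Prod.snd_swap, Prod.snd_swap, max_comm,
      ← Prod.dist_eq] at this
  have h' : ∀ᵐ q, q ∈ Ioo c d ×ˢ Ioo a b →
      HasFDerivAt (f ∘ Prod.swap) (0 : ℝ × ℝ →L[ℝ] X) q := by
    have := (Measure.measurePreserving_swap (μ := (volume : Measure ℝ))
      (ν := (volume : Measure ℝ))).quasiMeasurePreserving.ae h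
    filter_upwards [this] with q hq hqI
    have h1 : HasFDerivAt (Prod.swap : ℝ × ℝ → ℝ × ℝ)
        ((ContinuousLinearMap.snd ℝ ℝ ℝ).prod (ContinuousLinearMap.fst ℝ ℝ ℝ)) q :=
      hasFDerivAt_snd.prodMk hasFDerivAt_fst
    have h2 := (hq ⟨hqI.2, hqI.1⟩).comp q h1
    rwa [ContinuousLinearMap.zero_comp] at h2
  have h2 : f (q.1, p.2) = f q :=
    (eq_left_of_ae_hasFDerivAt_zero hf' h' (Ioo_subset_Icc_self hp.2) hq.1).trans
      (eq_left_of_ae_hasFDerivAt_zero hf' h' (Ioo_subset_Icc_self hq.2) hq.1).symm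
  exact h1.trans h2

variable {E : Type*} [NormedAddCommGroup E] [NormedSpace ℝ E] [FiniteDimensional ℝ E]
  {M : Type*} [TopologicalSpace M] [ChartedSpace E M] [IsManifold 𝓘(ℝ, E) ∞ M]

/-- The rank condition says something only where Γ is differentiable, which is almost everywhere. In
a chart Γ is Lipschitz with derivative zero almost everywhere, hence constant on a small box. -/
lemma NiceMap.eventuallyEq_const {Γ : ℝ × ℝ → M} (hΓ : NiceMap E Γ) {U : Set (ℝ × ℝ)}
    (hU : IsOpen U) (hUs : U ⊆ square) (hr : ∀ p ∈ U, rankAt E Γ p = 0) {p : ℝ × ℝ} (hp : p ∈ U) :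
    Γ =ᶠ[𝓝 p] fun _ => Γ p := by
  obtain ⟨K, N, hN, hL⟩ := hΓ.lip p (hUs hp)
  have hs : ∀ᶠ q in 𝓝 p, Γ q ∈ (extChartAt 𝓘(ℝ, E) (Γ p)).source :=
    (hΓ.cont.continuousAt (mem_of_superset (hU.mem_nhds hp) hUs)).preimage_mem_nhds
      (extChartAt_source_mem_nhds (Γ p))
  obtain ⟨ε, hε, hball⟩ := Metric.mem_nhds_iff.mp (inter_mem (inter_mem hN hs) (hU.mem_nhds hp))
  set δ := ε / 2 with hδ
  have hδ0 : 0 < δ := by positivity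
  have hbox : Icc (p.1 - δ) (p.1 + δ) ×ˢ Icc (p.2 - δ) (p.2 + δ) ⊆ Metric.ball p ε := by
    rintro q ⟨⟨h1, h2⟩, h3, h4⟩
    rw [Metric.mem_ball, Prod.dist_eq, Real.dist_eq, Real.dist_eq]
    refine max_lt ?_ ?_ <;> rw [abs_lt] <;> constructor <;> linarith
  have hpI : p ∈ Ioo (p.1 - δ) (p.1 + δ) ×ˢ Ioo (p.2 - δ) (p.2 + δ) :=
    ⟨⟨by linarith, by linarith⟩, by linarith, by linarith⟩
  have hsub : Ioo (p.1 - δ) (p.1 + δ) ×ˢ Ioo (p.2 - δ) (p.2 + δ) ⊆ Metric.ball p ε :=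
    (Set.prod_mono Ioo_subset_Icc_self Ioo_subset_Icc_self).trans hbox
  have hae : ∀ᵐ q, q ∈ Ioo (p.1 - δ) (p.1 + δ) ×ˢ Ioo (p.2 - δ) (p.2 + δ) →
      HasFDerivAt (fun q => extChartAt 𝓘(ℝ, E) (Γ p) (Γ q)) (0 : ℝ × ℝ →L[ℝ] E) q := by
    filter_upwards [hΓ.smooth_ae] with q hq hqI
    obtain ⟨⟨hqN, hqs⟩, hqU⟩ := hball (hsub hqI)
    have h1 := mdifferentiableAt_of_mem_regularSet (hq (hUs hqU))
    have h2 : MDifferentiableAt 𝓘(ℝ, E) 𝓘(ℝ, E) (extChartAt 𝓘(ℝ, E) (Γ p)) (Γ q) :=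
      mdifferentiableAt_extChartAt (by simpa using hqs)
    have h3 := mfderiv_comp q h2 h1
    have h4 := (MDifferentiableAt.comp q h2 h1).differentiableAt.hasFDerivAt
    rw [mfderiv_eq_fderiv] at h3
    have h5 : mfderiv 𝓘(ℝ, ℝ × ℝ) 𝓘(ℝ, E) Γ q = (0 : ℝ × ℝ →L[ℝ] E) :=
      eq_zero_of_finrank_range (E := E) (L := mfderiv 𝓘(ℝ, ℝ × ℝ) 𝓘(ℝ, E) Γ q) (hr q hqU)
    rw [h3, h5] at h4
    refine h4.congr_fderiv ?_
    exact ContinuousLinearMap.comp_zero (M₁ := ℝ × ℝ)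
      (mfderiv 𝓘(ℝ, E) 𝓘(ℝ, E) (extChartAt 𝓘(ℝ, E) (Γ p)) (Γ q) : E →L[ℝ] E)
  have hL' := hL.mono fun q hq => (⟨hUs (hball (hbox hq)).2, (hball (hbox hq)).1.1⟩ :
    q ∈ square ∩ N)
  filter_upwards [(isOpen_Ioo.prod isOpen_Ioo).mem_nhds hpI] with q hq
  refine (extChartAt 𝓘(ℝ, E) (Γ p)).injOn (hball (hsub hq)).1.2
    (mem_extChartAt_source (Γ p)) ?_
  exact eq_of_ae_hasFDerivAt_zero hL' hae hq hpI

/-- The last two inequalities place p above the edge from (0, 0) to (x₀, y₀) and below the edge from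
(0, 1) to (x₀, y₁). They define an open set, and each point of it is a convex combination of the
points vertically below and above it on these edges. -/
lemma mem_interior_trapezoid {x₀ y₀ y₁ : ℝ} (hx₀ : 0 < x₀) {p : ℝ × ℝ} (h1 : 0 < p.1)
    (h2 : p.1 < x₀) (h3 : y₀ * p.1 < p.2 * x₀) (h4 : (1 - y₁) * p.1 < (1 - p.2) * x₀) :
    p ∈ interior (convexHull ℝ {((0 : ℝ), (0 : ℝ)), (0, 1), (x₀, y₀), (x₀, y₁)}) := by
  set S := {q : ℝ × ℝ | 0 < q.1 ∧ q.1 < x₀ ∧ y₀ * q.1 < q.2 * x₀ ∧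
    (1 - y₁) * q.1 < (1 - q.2) * x₀} with hS
  have hSo : IsOpen S := by
    have hl : ∀ f g : ℝ × ℝ → ℝ, Continuous f → Continuous g → IsOpen {q | f q < g q} :=
      fun f g hf hg => isOpen_lt hf hg
    exact (hl (fun _ => 0) (fun q => q.1) (by fun_prop) (by fun_prop)).inter
      ((hl (fun q => q.1) (fun _ => x₀) (by fun_prop) (by fun_prop)).inter
      ((hl (fun q => y₀ * q.1) (fun q => q.2 * x₀) (by fun_prop) (by fun_prop)).inter
      (hl (fun q => (1 - y₁) * q.1) (fun q => (1 - q.2) * x₀) (by fun_prop) (by fun_prop))))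
  refine interior_maximal ?_ hSo ⟨h1, h2, h3, h4⟩
  rintro ⟨x, y⟩ ⟨e1, e2, e3, e4⟩
  simp only at e1 e2 e3 e4
  set T : Set (ℝ × ℝ) := {((0 : ℝ), (0 : ℝ)), (0, 1), (x₀, y₀), (x₀, y₁)} with hT
  have hc := convex_convexHull ℝ T
  have hsub := subset_convexHull ℝ T
  have hl0 : 0 ≤ x / x₀ := by positivity
  have hl1 : 0 ≤ 1 - x / x₀ := by
    rw [sub_nonneg, div_le_one hx₀]; exact e2.le
  have m1 := hc (hsub (show ((0 : ℝ), (0 : ℝ)) ∈ T by simp [hT]))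
    (hsub (show (x₀, y₀) ∈ T by simp [hT])) hl1 hl0 (by ring)
  have m2 := hc (hsub (show ((0 : ℝ), (1 : ℝ)) ∈ T by simp [hT]))
    (hsub (show (x₀, y₁) ∈ T by simp [hT])) hl1 hl0 (by ring)
  have f1 : y₀ * (x / x₀) < y := by
    rw [mul_div_assoc', div_lt_iff₀ hx₀]; exact e3
  have f2 : y < 1 - x / x₀ + y₁ * (x / x₀) := by
    have : (1 - y₁) * (x / x₀) < 1 - y := by rw [mul_div_assoc', div_lt_iff₀ hx₀]; exact e4
    linarith
  set lo := y₀ * (x / x₀) with hlo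
  set up := 1 - x / x₀ + y₁ * (x / x₀) with hup
  have hd : 0 < up - lo := by linarith
  have m3 := hc m1 m2 (a := (up - y) / (up - lo)) (b := (y - lo) / (up - lo))
    (div_nonneg (by linarith) hd.le) (div_nonneg (by linarith) hd.le)
    (by field_simp; ring)
  have hx : x / x₀ * x₀ = x := div_mul_cancel₀ _ hx₀.ne'
  convert m3 using 1
  ext
  · simp only [Prod.fst_add, Prod.smul_fst, smul_eq_mul, mul_zero, zero_add, hx]
    field_simp
    ring
  · simp only [Prod.snd_add, Prod.smul_snd, smul_eq_mul, mul_zero, zero_add, mul_one]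
    rw [show x / x₀ * y₀ = lo by rw [hlo]; ring,
      show 1 - x / x₀ + x / x₀ * y₁ = up by rw [hup]; ring]
    field_simp
    ring

end LocallyConstant

/-! ### The folded 2-path and the evaluation of `Z` -/

section Folded

set_option maxSynthPendingDepth 3

open Set Filter Topology

variable {E : Type*} [NormedAddCommGroup E] [NormedSpace ℝ E] [FiniteDimensional ℝ E]
  {M : Type*} [TopologicalSpace M] [ChartedSpace E M] [IsManifold 𝓘(ℝ, E) ∞ M]
  {V : Type*} [NormedAddCommGroup V] [NormedSpace ℝ V] [FiniteDimensional ℝ V]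
  {C : GradedComplex V} {Γ : ℝ × ℝ → M}

/-- The restriction of `Γ` to the simplex `s ≤ t`, composed with a retraction of the square onto
the simplex, in the coordinates `(1 - t, 1 - s)`. -/
def foldPath (Γ : ℝ × ℝ → M) (p : ℝ × ℝ) : M := Γ (1 - min p.1 p.2, 1 - p.2)

/-- The affine map `p ↦ c + L p`. -/
def affineMapOf (c : ℝ × ℝ) (L : ℝ × ℝ →L[ℝ] ℝ × ℝ) : (ℝ × ℝ) →ᴬ[ℝ] (ℝ × ℝ) :=
  ContinuousAffineMap.const ℝ (ℝ × ℝ) c + L.toContinuousAffineMap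

lemma affineMapOf_apply (c : ℝ × ℝ) (L : ℝ × ℝ →L[ℝ] ℝ × ℝ) (p : ℝ × ℝ) :
    affineMapOf c L p = c + L p := rfl

lemma isClosed_square : IsClosed square := isCompact_square.isClosed

lemma IsPiecewiseSmooth.swap (h : IsPiecewiseSmooth E Γ) : IsPiecewiseSmooth E (Γ ∘ Prod.swap) := by
  set T := affineMapOf 0 ((ContinuousLinearMap.snd ℝ ℝ ℝ).prod (ContinuousLinearMap.fst ℝ ℝ ℝ))
  have hT : ∀ p, T p = p.swap := fun p => by rw [affineMapOf_apply, zero_add]; rfl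
  have h1 : ∀ p ∈ square, T p ∈ square ∧ (Γ ∘ Prod.swap) p = Γ (T p) := fun p hp =>
    ⟨by rw [hT]; exact ⟨hp.2, hp.1⟩, by rw [hT]; rfl⟩
  exact h.comp_affine isClosed_square isClosed_square convex_square convex_square (union_self _)
    T T h1 h1

lemma IsPiecewiseSmooth.comp_muMap (h : IsPiecewiseSmooth E Γ) :
    IsPiecewiseSmooth E (Γ ∘ muMap) := by
  set T := affineMapOf (1, 0)
    ((-ContinuousLinearMap.fst ℝ ℝ ℝ).prod (ContinuousLinearMap.snd ℝ ℝ ℝ))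
  have hT : ∀ p, T p = muMap p := fun p => by
    rw [affineMapOf_apply, muMap]; ext <;> simp [sub_eq_add_neg]
  have h1 : ∀ p ∈ square, T p ∈ square ∧ (Γ ∘ muMap) p = Γ (T p) := fun p hp =>
    ⟨by rw [hT]; exact ⟨⟨sub_nonneg.mpr hp.1.2, sub_le_self _ hp.1.1⟩, hp.2⟩, by rw [hT]; rfl⟩
  exact h.comp_affine isClosed_square isClosed_square convex_square convex_square (union_self _)
    T T h1 h1

lemma IsPiecewiseSmooth.foldPath (h : IsPiecewiseSmooth E Γ) :
    IsPiecewiseSmooth E (foldPath Γ) := by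
  set T := affineMapOf (1, 1) (-ContinuousLinearMap.id ℝ (ℝ × ℝ))
  set T' := affineMapOf (1, 1)
    ((-ContinuousLinearMap.snd ℝ ℝ ℝ).prod (-ContinuousLinearMap.snd ℝ ℝ ℝ))
  have hT : ∀ p, T p = (1 - p.1, 1 - p.2) := fun p => by
    rw [affineMapOf_apply]; ext <;> simp [sub_eq_add_neg]
  have hT' : ∀ p, T' p = (1 - p.2, 1 - p.2) := fun p => by
    rw [affineMapOf_apply]; ext <;> simp [sub_eq_add_neg]
  have hI : ∀ x ∈ Icc (0 : ℝ) 1, 1 - x ∈ Icc (0 : ℝ) 1 := fun x hx =>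
    ⟨sub_nonneg.mpr hx.2, sub_le_self _ hx.1⟩
  have hlin : ∀ c d : ℝ, Convex ℝ {p : ℝ × ℝ | c * p.1 + d * p.2 ≤ 0} := fun c d =>
    convex_halfSpace_le (f := fun p : ℝ × ℝ => c * p.1 + d * p.2)
      ⟨fun _ _ => by simp; ring, fun _ _ => by simp; ring⟩ 0
  have hcl : ∀ c d : ℝ, IsClosed {p : ℝ × ℝ | c * p.1 + d * p.2 ≤ 0} := fun c d =>
    isClosed_le (by fun_prop) (by fun_prop)
  refine h.comp_affine (D := square ∩ {p | 1 * p.1 + -1 * p.2 ≤ 0})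
    (D' := square ∩ {p | -1 * p.1 + 1 * p.2 ≤ 0})
    (isClosed_square.inter (hcl _ _)) (isClosed_square.inter (hcl _ _))
    (convex_square.inter (hlin _ _)) (convex_square.inter (hlin _ _)) ?_ T T' ?_ ?_
  · rw [← inter_union_distrib_left, inter_eq_left]
    intro p _
    rcases le_total p.1 p.2 with h | h
    · left; change 1 * p.1 + -1 * p.2 ≤ 0; linarith
    · right; change -1 * p.1 + 1 * p.2 ≤ 0; linarith
  · rintro p ⟨hp, hp' : 1 * p.1 + -1 * p.2 ≤ 0⟩
    rw [hT, SurfaceHolonomy.foldPath, min_eq_left (by linarith)]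
    exact ⟨⟨hI _ hp.1, hI _ hp.2⟩, rfl⟩
  · rintro p ⟨hp, hp' : -1 * p.1 + 1 * p.2 ≤ 0⟩
    rw [hT', SurfaceHolonomy.foldPath, min_eq_right (by linarith)]
    exact ⟨⟨hI _ hp.2, hI _ hp.2⟩, rfl⟩

lemma IsTwoPath.foldPath_left (h : IsTwoPath E Γ) {v : ℝ} (hv : v ∈ Icc (0 : ℝ) 1) :
    foldPath Γ (0, v) = foldPath Γ (0, 0) := by
  rw [foldPath, foldPath, min_eq_left hv.1, min_self, sub_zero,
    h.right_const (1 - v) ⟨sub_nonneg.mpr hv.2, sub_le_self _ hv.1⟩, h.right_const 1 (by simp)]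

/-- The retraction collapses the whole bottom edge to the vertex of the simplex with Γ-value Γ(1,
1). As the left edge goes to the same point, horizontal and vertical transports have a common
origin. -/
lemma foldPath_bot {x : ℝ} (hx : x ∈ Icc (0 : ℝ) 1) :
    foldPath Γ (x, 0) = foldPath Γ (0, 0) := by
  rw [foldPath, foldPath, min_eq_right hx.1, min_self]

/-- The part of the definition of a well-supported 2-path that is used below. -/
structure SupportedIn (E : Type*) [NormedAddCommGroup E] [NormedSpace ℝ E]
    {M : Type*} [TopologicalSpace M] [ChartedSpace E M] (Γ : ℝ × ℝ → M) (x₀ y₀ y₁ : ℝ) : Prop where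
  isTwoPath : IsTwoPath E Γ
  lt_x₀ : 1 / 2 < x₀
  x₀_lt : x₀ < 1
  y₀_pos : 0 < y₀
  y₀_lt : y₀ < y₁
  y₁_lt : y₁ < 1 / 2
  rank_le : ∀ p ∈ interior square, p.2 ∉ Icc y₀ y₁ → rankAt E Γ p ≤ 1
  rank_eq : ∀ p ∈ interior (convexHull ℝ {((0 : ℝ), (0 : ℝ)), (0, 1), (x₀, y₀), (x₀, y₁)}),
    rankAt E Γ p = 0

lemma IsWellSupported.exists_supportedIn (h : IsWellSupported E Γ) :
    ∃ x₀ y₀ y₁, SupportedIn E Γ x₀ y₀ y₁ := by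
  obtain ⟨x₀, x₁, y₀, y₁, h1, h2, h3, h4, h5, h6, h7, h8, -⟩ := h.support
  exact ⟨x₀, y₀, y₁, h.isTwoPath, h1, h2.trans h3, h4, h5, h6,
    fun p hp hp' => h7 p ⟨hp, fun hq => hp' hq.2⟩, h8⟩

lemma ae_fst_ne_one_sub_snd : ∀ᵐ p : ℝ × ℝ, p.1 ≠ 1 - p.2 := by
  have hm : MeasurableSet {p : ℝ × ℝ | p.1 = 1 - p.2} :=
    (isClosed_eq (by fun_prop) (by fun_prop)).measurableSet
  have h : volume {p : ℝ × ℝ | p.1 = 1 - p.2} = 0 := by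
    rw [Measure.volume_eq_prod, Measure.measure_prod_null hm]
    refine Eventually.of_forall fun t => ?_
    have : Prod.mk t ⁻¹' {p : ℝ × ℝ | p.1 = 1 - p.2} ⊆ {1 - t} := by
      intro s (hs : t = 1 - s)
      rw [mem_singleton_iff, hs]; ring
    exact measure_mono_null this (measure_singleton _)
  rw [measure_eq_zero_iff_ae_notMem] at h
  exact h

/-- Comparison of the pullbacks to the square along `Γ` and along the folded path. -/
lemma SupportedIn.ae_compare {x₀ y₀ y₁ : ℝ} (h : SupportedIn E Γ x₀ y₀ y₁)
    (α : FlatSuperconnection E M C) :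
    ∀ᵐ p : ℝ × ℝ, p ∈ square →
      (p.2 ∈ Ioo y₀ y₁ → hor α (Γ ∘ muMap) p = hor α (foldPath Γ) (p.1, 1 - p.2) ∧
        area α (Γ ∘ muMap) p = -area α (foldPath Γ) (p.1, 1 - p.2)) ∧
      (p.2 ∉ Icc y₀ y₁ → area α (Γ ∘ muMap) p = 0 ∧ area α (foldPath Γ) (p.1, 1 - p.2) = 0) := by
  have hΓ := h.isTwoPath.piecewiseSmooth
  have q1 := quasiMeasurePreserving_one_sub
  have q2 : Measure.QuasiMeasurePreserving muMap volume volume :=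
    QuasiMeasurePreserving.prodMap q1 (Measure.QuasiMeasurePreserving.id volume)
  have q3 : Measure.QuasiMeasurePreserving (fun p : ℝ × ℝ => (p.1, 1 - p.2)) volume volume :=
    QuasiMeasurePreserving.prodMap (Measure.QuasiMeasurePreserving.id volume) q1
  filter_upwards [q2.ae hΓ.niceMap.smooth_ae, q3.ae hΓ.foldPath.niceMap.smooth_ae,
    hΓ.comp_muMap.niceMap.smooth_ae, ae_fst_ne_one_sub_snd] with p hpΓ hpG hpH hne hp
  obtain ⟨t, s⟩ := p
  have hI : ∀ x ∈ Icc (0 : ℝ) 1, 1 - x ∈ Icc (0 : ℝ) 1 := fun x hx =>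
    ⟨sub_nonneg.mpr hx.2, sub_le_self _ hx.1⟩
  have rH := hpH hp
  have rG : (t, 1 - s) ∈ regularSet E (foldPath Γ) := hpG ⟨hp.1, hI _ hp.2⟩
  have rΓ : muMap (t, s) ∈ regularSet E Γ := hpΓ ⟨hI _ hp.1, hp.2⟩
  have hpi := rH.1
  rw [interior_square] at hpi
  have aH : area α (Γ ∘ muMap) (t, s) = pullTwo α (Γ ∘ muMap) (t, s) := indicator_of_mem rH _
  have aG : area α (foldPath Γ) (t, 1 - s) = pullTwo α (foldPath Γ) (t, 1 - s) :=
    indicator_of_mem rG _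
  have lμ : HasFDerivAt muMap
      ((-ContinuousLinearMap.fst ℝ ℝ ℝ).prod (ContinuousLinearMap.snd ℝ ℝ ℝ)) (t, s) :=
    (hasFDerivAt_fst.const_sub 1).prodMk hasFDerivAt_snd
  obtain ⟨pΓ1, pΓ2⟩ := pull_comp α (H := Γ ∘ muMap) (EventuallyEq.refl _ _)
    (mdifferentiableAt_of_mem_regularSet rΓ) lμ
  have hzero : s ∉ Icc y₀ y₁ → area α (Γ ∘ muMap) (t, s) = 0 := fun hs => by
    rw [aH, pΓ2, pullTwo_eq_zero_of_rankAt α (h.rank_le _ rΓ.1 hs), smul_zero]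
  -- For t < 1 - s the minimum in `foldPath` is t, and the two maps agree up to the reflection of s,
  -- which changes the sign of the area.
  rcases lt_or_gt_of_ne hne with hlt | hgt
  · have hlt' : t < 1 - s := hlt
    have hloc : Γ ∘ muMap =ᶠ[𝓝 (t, s)] foldPath Γ ∘ fun p : ℝ × ℝ => (p.1, 1 - p.2) := by
      filter_upwards [(isOpen_lt (f := fun p : ℝ × ℝ => p.1) (g := fun p : ℝ × ℝ => 1 - p.2)
        (by fun_prop) (by fun_prop)).mem_nhds hlt'] with q hq
      have hq' : q.1 < 1 - q.2 := hq
      simp only [Function.comp_apply, foldPath, muMap, min_eq_left hq'.le, sub_sub_cancel]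
    have lT : HasFDerivAt (fun p : ℝ × ℝ => (p.1, 1 - p.2))
        ((ContinuousLinearMap.fst ℝ ℝ ℝ).prod (-ContinuousLinearMap.snd ℝ ℝ ℝ)) (t, s) :=
      hasFDerivAt_fst.prodMk (hasFDerivAt_snd.const_sub 1)
    obtain ⟨p1, p2⟩ := pull_comp α hloc (mdifferentiableAt_of_mem_regularSet rG) lT
    have hh : hor α (Γ ∘ muMap) (t, s) = hor α (foldPath Γ) (t, 1 - s) := by
      rw [hor_eq_pullOne α rH, hor_eq_pullOne α rG, p1 (1, 0)]
      simp
    have ha : area α (Γ ∘ muMap) (t, s) = -area α (foldPath Γ) (t, 1 - s) := by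
      rw [aH, aG, p2]
      simp
    refine ⟨fun _ => ⟨hh, ha⟩, fun hs => ⟨hzero hs, ?_⟩⟩
    rw [← neg_eq_zero, ← ha, hzero hs]
  -- For t > 1 - s the folded path does not depend on its first variable, so its contributions
  -- vanish; it remains to see that those of Γ ∘ μ vanish too.
  · have hgt' : 1 - s < t := hgt
    have hG0 : hor α (foldPath Γ) (t, 1 - s) = 0 := by
      refine hor_eq_zero (x := Γ (1 - (1 - s), 1 - (1 - s))) ?_
      filter_upwards [lt_mem_nhds hgt'] with x hx
      rw [foldPath, min_eq_right (le_of_lt hx)]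
    have hGa : area α (foldPath Γ) (t, 1 - s) = 0 := by
      have hloc : foldPath Γ =ᶠ[𝓝 (t, 1 - s)] foldPath Γ ∘ fun p : ℝ × ℝ => (t, p.2) := by
        filter_upwards [(isOpen_lt (f := fun p : ℝ × ℝ => p.2) (g := fun p : ℝ × ℝ => p.1)
          (by fun_prop) (by fun_prop)).mem_nhds hgt',
          (isOpen_lt (f := fun p : ℝ × ℝ => p.2) (g := fun p : ℝ × ℝ => t)
          (by fun_prop) (by fun_prop)).mem_nhds hgt'] with q hq hq2
        have hq' : q.2 < q.1 := hq
        have hq2' : q.2 < t := hq2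
        simp only [Function.comp_apply, foldPath, min_eq_right hq'.le, min_eq_right hq2'.le]
      have lT : HasFDerivAt (fun p : ℝ × ℝ => (t, p.2))
          ((0 : ℝ × ℝ →L[ℝ] ℝ).prod (ContinuousLinearMap.snd ℝ ℝ ℝ)) (t, 1 - s) :=
        (hasFDerivAt_const t _).prodMk hasFDerivAt_snd
      rw [aG, (pull_comp α hloc (mdifferentiableAt_of_mem_regularSet rG) lT).2]
      simp
    refine ⟨fun hs => ?_, fun hs => ⟨hzero hs, hGa⟩⟩
    have hs' : s ∈ Ioo y₀ y₁ := hs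
    -- Here 1 - t < s < y₁ < 1/2 < x₀, so (1 - t, s) lies in the left trapezoid.
    have h0 : rankAt E Γ (muMap (t, s)) = 0 := by
      have ht1 : t < 1 := hpi.1.2
      have := h.lt_x₀
      have := h.y₀_pos
      have := h.y₁_lt
      have := hs'.1
      have := hs'.2
      refine h.rank_eq _ (mem_interior_trapezoid (by linarith) ?_ ?_ ?_ ?_)
      · change 0 < 1 - t; linarith
      · change 1 - t < x₀; linarith
      · change y₀ * (1 - t) < s * x₀
        nlinarith
      · change (1 - y₁) * (1 - t) < (1 - s) * x₀
        nlinarith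
    rw [hG0, hGa, hor_eq_pullOne α rH, aH, pΓ1 (1, 0), pΓ2, pullOne_eq_zero_of_rankAt α h0,
      pullOne_eq_zero_of_rankAt α h0, pullTwo_eq_zero_of_rankAt α (h0.le.trans zero_le_one)]
    simp

end Folded

/-! ### Evaluation of `Z` and the transport along the diagonal -/

section EvalZ

set_option maxSynthPendingDepth 3

open Set Filter Topology

variable {E : Type*} [NormedAddCommGroup E] [NormedSpace ℝ E] [FiniteDimensional ℝ E]
  {M : Type*} [TopologicalSpace M] [ChartedSpace E M] [IsManifold 𝓘(ℝ, E) ∞ M]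
  {V : Type*} [NormedAddCommGroup V] [NormedSpace ℝ V] [FiniteDimensional ℝ V]
  {C : GradedComplex V} {Γ : ℝ × ℝ → M} {x₀ y₀ y₁ : ℝ}

/-- The folded path carries no curvature over the heights outside of the support. -/
lemma SupportedIn.ae_horBeta_eq_zero (h : SupportedIn E Γ x₀ y₀ y₁)
    (α : FlatSuperconnection E M C) :
    ∀ᵐ s : ℝ, s ∈ Ioo (0 : ℝ) 1 → s ∉ Icc y₀ y₁ → horBeta α (foldPath Γ) (1, 1 - s) = 0 := by
  filter_upwards [ae_ae_of_ae_swap (h.ae_compare α)] with s hs hsI hsn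
  refine intervalIntegral.integral_zero_ae ?_
  filter_upwards [hs, ae_mem_Ioo_of_mem_uIoc] with t ht ht' htI
  have h1 := ((ht ⟨Ioo_subset_Icc_self (ht' htI), Ioo_subset_Icc_self hsI⟩).2 hsn).2
  rw [h1, mul_zero, zero_mul]

/-- The series `Z` in terms of the parallel transport along the folded path. -/
theorem SupportedIn.zSeries_eq (h : SupportedIn E Γ x₀ y₀ y₁) (α : FlatSuperconnection E M C) :
    (∀ m n, IntegrableOn (omegaDensity α (Γ ∘ muMap) m n) (simplexTimesInterval (m + n + 1))) ∧
    (Summable fun p => ‖zTerm α Γ p‖) ∧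
    zSeries α Γ = -∫ y in (0 : ℝ)..1,
      horTransport α (foldPath Γ) (1, y) * horBeta α (foldPath Γ) (1, y) := by
  have hΓ := h.isTwoPath.piecewiseSmooth
  have hH := hΓ.comp_muMap.niceMap
  have hG := hΓ.foldPath.niceMap
  set G := foldPath Γ with hGdef
  obtain ⟨c₁, hc₁⟩ := hH.exists_hor_le α
  obtain ⟨c₂, hc₂⟩ := hH.exists_area_le α
  obtain ⟨c₃, hc₃⟩ := hG.exists_hor_le α
  have ht := hG.transportPair hc₃
  obtain ⟨i1, i2, i3⟩ := omegaIntegral_series_eq α (H := Γ ∘ muMap) (a := hor α (Γ ∘ muMap))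
    (B := area α (Γ ∘ muMap)) (c := max c₁ c₂)
    (W := fun s => -(horTransport α G (1, 1 - s) * horBeta α G (1, 1 - s)))
    ((norm_nonneg _).trans ((hc₁ 0).trans (le_max_left _ _))) hH.smooth_ae
    (hH.smooth_ae.mono fun p hp hps => ⟨⟨(hor_eq_pullOne α (hp hps)).symm,
      (hc₁ p).trans (le_max_left _ _)⟩, (indicator_of_mem (hp hps) _).symm,
      (hc₂ p).trans (le_max_right _ _)⟩) (by
      filter_upwards [ae_ae_of_ae_swap (h.ae_compare α), h.ae_horBeta_eq_zero α, ae_ne_real y₀,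
        ae_ne_real y₁] with s hs hβ hs0 hs1 hsI
      have hsq : ∀ t ∈ Ioo (0 : ℝ) 1, (t, s) ∈ square := fun t ht =>
        ⟨Ioo_subset_Icc_self ht, Ioo_subset_Icc_self hsI⟩
      -- At heights inside the support Γ ∘ μ and the folded path have the same connection on almost
      -- all of the line. At other heights the connections may differ, but neither map carries area.
      by_cases hsy : s ∈ Icc y₀ y₁
      · right
        have hso : s ∈ Ioo y₀ y₁ :=
          ⟨lt_of_le_of_ne hsy.1 hs0.symm, lt_of_le_of_ne hsy.2 hs1⟩
        have hy : 1 - s ∈ Icc (0 : ℝ) 1 := ⟨by linarith [hsI.2], by linarith [hsI.1]⟩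
        refine ⟨fun t => horTransport α G (t, 1 - s), fun t => horInv α G (t, 1 - s),
          (ht.g_eq _ hy).congr_deriv ?_, horTransport_zero α G _,
          fun t ht' => ht.kg t ht' _ hy, ?_⟩
        · filter_upwards [hs] with t hst htI
          rw [((hst (hsq t htI)).1 hso).1]
        · rw [← mul_neg]
          congr 1
          rw [horBeta, ← intervalIntegral.integral_neg]
          refine intervalIntegral.integral_congr_ae ?_
          filter_upwards [hs, ae_mem_Ioo_of_mem_uIoc] with t hst ht' htI
          rw [((hst (hsq t (ht' htI))).1 hso).2, mul_neg, neg_mul]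
      · left
        refine ⟨by rw [hβ hsI hsy, mul_zero, neg_zero], ?_⟩
        filter_upwards [hs] with t hst htI
        exact ((hst (hsq t htI)).2 hsy).1)
  refine ⟨i1, ?_, ?_⟩
  · refine i2.congr fun p => ?_
    rw [zTerm, norm_smul, norm_pow, norm_neg, norm_one, one_pow, one_mul]
  · refine i3.trans ?_
    rw [intervalIntegral.integral_neg, intervalIntegral.integral_comp_sub_left
      (fun y => horTransport α G (1, y) * horBeta α G (1, y))]
    simp

/-- The transport along the diagonal is trivial on the part that lies in the trapezoid. -/
lemma SupportedIn.horTransport_diagonal (h : SupportedIn E Γ x₀ y₀ y₁)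
    (α : FlatSuperconnection E M C) {y : ℝ} (hy : y ∈ Icc (1 - y₁) 1) :
    horTransport α (foldPath Γ ∘ Prod.swap) (y, 1) =
      horTransport α (foldPath Γ ∘ Prod.swap) (1, 1) := by
  have hΓ := h.isTwoPath.piecewiseSmooth
  have hG := hΓ.foldPath.swap.niceMap
  have e1 := h.lt_x₀
  have e2 := h.x₀_lt
  have e3 := h.y₀_pos
  have e4 := h.y₀_lt
  have e5 := h.y₁_lt
  obtain ⟨c, hc⟩ := hG.exists_hor_le α
  have hL := ((hG.transportPair hc).g_eq 1 (by simp)).mono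
    (c := 1 - y₁) (d := 1) (by linarith) le_rfl
  have hz : ∀ᵐ x, x ∈ Ioo (1 - y₁) 1 → -(hor α (foldPath Γ ∘ Prod.swap) (x, 1) *
      horTransport α (foldPath Γ ∘ Prod.swap) (x, 1)) = 0 := by
    refine Eventually.of_forall fun x hx => ?_
    have hx1 := hx.1
    have hx2 := hx.2
    set U := interior (convexHull ℝ {((0 : ℝ), (0 : ℝ)), (0, 1), (x₀, y₀), (x₀, y₁)}) with hU
    have hUs : U ⊆ square := by
      refine interior_subset.trans (convexHull_min ?_ convex_square)
      rintro p hp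
      simp only [mem_insert_iff, mem_singleton_iff] at hp
      rcases hp with rfl | rfl | rfl | rfl <;> refine ⟨⟨?_, ?_⟩, ?_, ?_⟩ <;> norm_num <;> linarith
    -- The right edge of the folded path is the diagonal of Γ. From 1 - x < y₁ < 1/2 < x₀ it follows
    -- that (1 - y₁)(1 - x) < x x₀, since 1 - y₁ < x and 1 - x < x₀; the remaining inequalities are
    -- immediate.
    have hm : (1 - x, 1 - x) ∈ U := by
      refine mem_interior_trapezoid (by linarith) ?_ ?_ ?_ ?_
      · change 0 < 1 - x; linarith
      · change 1 - x < x₀; linarith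
      · change y₀ * (1 - x) < (1 - x) * x₀
        nlinarith
      · change (1 - y₁) * (1 - x) < (1 - (1 - x)) * x₀
        nlinarith
    have hconst := hΓ.niceMap.eventuallyEq_const isOpen_interior hUs h.rank_eq hm
    have h0 : hor α (foldPath Γ ∘ Prod.swap) (x, 1) = 0 := by
      refine hor_eq_zero (x := Γ (1 - x, 1 - x)) ?_
      have hcont : Tendsto (fun y : ℝ => (1 - y, 1 - y)) (𝓝 x) (𝓝 (1 - x, 1 - x)) :=
        Continuous.tendsto (by fun_prop : Continuous fun y : ℝ => (1 - y, 1 - y)) x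
      filter_upwards [hcont.eventually hconst, Iio_mem_nhds hx2] with y hy hy1
      rw [Function.comp_apply, Prod.swap_prod_mk, foldPath, min_eq_right (le_of_lt hy1)]
      exact hy
    rw [h0, zero_mul, neg_zero]
  exact (hL.eq_const hz hy).trans (hL.eq_const hz ⟨by linarith, le_rfl⟩).symm

end EvalZ

/-! ### The evaluation of `X` -/

section EvalX

set_option maxSynthPendingDepth 3

open Set Filter Topology

lemma LipDeriv.piecewise_half {X : Type*} [NormedAddCommGroup X] [NormedSpace ℝ X]
    {F₁ f₁ F₂ f₂ : ℝ → X} (h₁ : LipDeriv F₁ f₁ 0 (1 / 2)) (h₂ : LipDeriv F₂ f₂ (1 / 2) 1)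
    (h : F₁ (1 / 2) = F₂ (1 / 2)) :
    LipDeriv (fun t => if t ≤ 1 / 2 then F₁ t else F₂ t) (fun t => if t ≤ 1 / 2 then f₁ t else f₂ t)
      0 1 := by
  refine LipDeriv.glue (b := 1 / 2) (by norm_num) (by norm_num) ?_ ?_
  · refine (h₁.congr fun t ht => ?_).congr_deriv (Eventually.of_forall fun t ht => ?_)
    · rw [if_pos ht.2]
    · rw [if_pos ht.2.le]
  · refine (h₂.congr fun t ht => ?_).congr_deriv (Eventually.of_forall fun t ht => ?_)
    · rcases ht.1.eq_or_lt with rfl | ht'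
      · rw [if_pos le_rfl, h]
      · rw [if_neg (not_le.mpr ht')]
    · rw [if_neg (not_le.mpr ht.1)]

variable {E : Type*} [NormedAddCommGroup E] [NormedSpace ℝ E] [FiniteDimensional ℝ E]
  {M : Type*} [TopologicalSpace M] [ChartedSpace E M] [IsManifold 𝓘(ℝ, E) ∞ M]
  {V : Type*} [NormedAddCommGroup V] [NormedSpace ℝ V] [FiniteDimensional ℝ V]
  {C : GradedComplex V} {Γ : ℝ × ℝ → M}

/-- In the first half, the s-th path of Θ is the vertical line of the folded path over 1 - s, run
upwards at double speed. -/
lemma thetaMap_of_le {q : ℝ × ℝ} (hq : q.1 ≤ 1 / 2) :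
    ((Γ ∘ lowerEmbedding) ∘ thetaMap) q = foldPath Γ (1 - q.2, 2 * q.1) := by
  have h : max q.2 (1 - 2 * q.1) = 1 - min (1 - q.2) (2 * q.1) := by
    rcases le_total (1 - q.2) (2 * q.1) with h | h
    · rw [min_eq_left h, max_eq_left (by linarith)]; ring
    · rw [min_eq_right h, max_eq_right (by linarith)]
  simp only [Function.comp_apply, lowerEmbedding, thetaMap, lambdaMap, if_pos hq, foldMap, foldPath,
    h]

/-- In the second half, the path continues along the top edge from (1 - s, 1) to (1, 1). -/
lemma thetaMap_of_lt {q : ℝ × ℝ} (hq : 1 / 2 < q.1) :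
    ((Γ ∘ lowerEmbedding) ∘ thetaMap) q = foldPath Γ (1 - (2 - 2 * q.1) * q.2, 1) := by
  set r := (2 - 2 * q.1) * q.2 with hr
  have h : max r 0 = 1 - min (1 - r) 1 := by
    rcases le_total (1 - r) 1 with h | h
    · rw [min_eq_left h, max_eq_left (by linarith)]; ring
    · rw [min_eq_right h, max_eq_right (by linarith)]; ring
  simp only [Function.comp_apply, lowerEmbedding, thetaMap, lambdaMap, if_neg (not_le.mpr hq),
    foldMap, foldPath, ← hr, h, sub_self]

/-- The pullback of `α¹` along `Θ`, evaluated on `∂/∂t`. -/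
def thetaConn (α : FlatSuperconnection E M C) (G : ℝ × ℝ → M) (p : ℝ × ℝ) : V →L[ℝ] V :=
  if p.1 ≤ 1 / 2 then (2 : ℝ) • hor α (G ∘ Prod.swap) (2 * p.1, 1 - p.2)
  else (2 * p.2) • hor α G (1 - (2 - 2 * p.1) * p.2, 1)

/-- The pullback of `α²` along `Θ`. -/
def thetaArea (α : FlatSuperconnection E M C) (G : ℝ × ℝ → M) (p : ℝ × ℝ) : V →L[ℝ] V :=
  if p.1 ≤ 1 / 2 then (2 : ℝ) • area α G (1 - p.2, 2 * p.1) else 0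

/-- The first half is an affine reparametrization with Jacobian determinant 2, so regularity almost
everywhere pulls back. The second half factors through the top edge, a null set on which
two-variable regularity says nothing; smoothness of the restriction at almost every point of that
edge is used instead, and the area vanishes. -/
lemma ae_pull_theta (hΓ : IsPiecewiseSmooth E Γ) (α : FlatSuperconnection E M C) :
    ∀ᵐ p : ℝ × ℝ, p ∈ square → p ∈ regularSet E ((Γ ∘ lowerEmbedding) ∘ thetaMap) ∧
      pullOne α ((Γ ∘ lowerEmbedding) ∘ thetaMap) p (1, 0) = thetaConn α (foldPath Γ) p ∧
      pullTwo α ((Γ ∘ lowerEmbedding) ∘ thetaMap) p = thetaArea α (foldPath Γ) p := by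
  set H := (Γ ∘ lowerEmbedding) ∘ thetaMap with hH
  set G := foldPath Γ with hGdef
  have hG : IsPiecewiseSmooth E G := hΓ.foldPath
  have q1 := quasiMeasurePreserving_one_sub
  have q2 : Measure.QuasiMeasurePreserving (fun x : ℝ => 2 * x) volume volume := by
    have := quasiMeasurePreserving_affine (c := 2) (by norm_num) 0
    simpa using this
  have q3 : Measure.QuasiMeasurePreserving (fun p : ℝ × ℝ => (1 - p.2, 2 * p.1)) volume volume :=
    (QuasiMeasurePreserving.prodMap q1 q2).comp
      (Measure.measurePreserving_swap (μ := (volume : Measure ℝ))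
        (ν := (volume : Measure ℝ))).quasiMeasurePreserving
  have n1 : ∀ᵐ p : ℝ × ℝ, p.1 ≠ 1 / 2 :=
    (Measure.quasiMeasurePreserving_fst (μ := (volume : Measure ℝ))
      (ν := (volume : Measure ℝ))).ae (ae_ne_real (1 / 2))
  filter_upwards [q3.ae hG.niceMap.smooth_ae,
    ae_comp_bilinear (hG.ae_contMDiffAt_slice (v := 1) (by simp)), hΓ.niceMap.smooth_ae, n1]
    with p hp1 hp2 hp3 hne hp
  obtain ⟨t, s⟩ := p
  have hpi := (hp3 hp).1
  have hpi' := hpi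
  rw [interior_square] at hpi'
  have ht0 : 0 < t := hpi'.1.1
  have ht1 : t < 1 := hpi'.1.2
  have hs0 : 0 < s := hpi'.2.1
  have hs1 : s < 1 := hpi'.2.2
  rcases lt_or_gt_of_ne hne with hlt | hgt
  · have hlt' : t < 1 / 2 := hlt
    have hle : t ≤ 1 / 2 := hlt'.le
    have hr : (1 - s, 2 * t) ∈ regularSet E G :=
      hp1 ⟨⟨by linarith, by linarith⟩, by simp only; linarith, by simp only; linarith⟩
    have hloc : H =ᶠ[𝓝 (t, s)] G ∘ fun p : ℝ × ℝ => (1 - p.2, 2 * p.1) := by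
      filter_upwards [(isOpen_lt (f := fun p : ℝ × ℝ => p.1) (g := fun _ => (1 / 2 : ℝ))
        (by fun_prop) (by fun_prop)).mem_nhds hlt'] with q hq
      exact thetaMap_of_le (le_of_lt hq)
    have lT : HasFDerivAt (fun p : ℝ × ℝ => (1 - p.2, 2 * p.1))
        ((-ContinuousLinearMap.snd ℝ ℝ ℝ).prod ((2 : ℝ) • ContinuousLinearMap.fst ℝ ℝ ℝ)) (t, s) :=
      (hasFDerivAt_snd.const_sub 1).prodMk (hasFDerivAt_fst.const_mul 2)
    obtain ⟨p1, p2⟩ := pull_comp α hloc (mdifferentiableAt_of_mem_regularSet hr) lT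
    refine ⟨mem_regularSet_of_comp hloc hr.2 (by fun_prop) hpi, ?_, ?_⟩
    · have hsw : HasFDerivAt (Prod.swap : ℝ × ℝ → ℝ × ℝ)
          ((ContinuousLinearMap.snd ℝ ℝ ℝ).prod (ContinuousLinearMap.fst ℝ ℝ ℝ)) (2 * t, 1 - s) :=
        hasFDerivAt_snd.prodMk hasFDerivAt_fst
      have e1 := (pull_comp α (H := G ∘ Prod.swap) (T := Prod.swap) (p := (2 * t, 1 - s))
        (EventuallyEq.refl _ _) (mdifferentiableAt_of_mem_regularSet hr) hsw).1 (1, 0)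
      have e2 : hor α (G ∘ Prod.swap) (2 * t, 1 - s) = pullOne α (G ∘ Prod.swap) (2 * t, 1 - s) (1, 0) :=
        hor_eq_pullOne α (mem_regularSet_swap hr)
      rw [thetaConn, if_pos hle, e2, e1, p1 (1, 0)]
      simp
    · rw [thetaArea, if_pos hle, area, indicator_of_mem hr, p2]
      simp
  · have hgt' : 1 / 2 < t := hgt
    have hρ : 1 - (2 - 2 * t) * s ∈ Icc (0 : ℝ) 1 := by
      constructor
      · nlinarith
      · nlinarith
    obtain ⟨hρ', hφ⟩ := hp2 hρ
    simp only at hρ' hφ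
    set ρ : ℝ × ℝ → ℝ := fun p => 1 - (2 - 2 * p.1) * p.2 with hρdef
    set Φ : ℝ × ℝ → M := fun p => G (p.1, 1) with hΦ
    have hΦs : ContMDiffAt 𝓘(ℝ, ℝ × ℝ) 𝓘(ℝ, E) 2 Φ (ρ (t, s), 1) :=
      ContMDiffAt.comp (g := fun x => G (x, 1)) (f := Prod.fst) (ρ (t, s), (1 : ℝ)) hφ
        contDiff_fst.contMDiff.contMDiffAt
    have hΦd := hΦs.mdifferentiableAt (by simp)
    have hloc : H =ᶠ[𝓝 (t, s)] Φ ∘ fun p : ℝ × ℝ => (ρ p, 1) := by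
      filter_upwards [(isOpen_lt (f := fun _ : ℝ × ℝ => (1 / 2 : ℝ)) (g := fun p => p.1)
        (by fun_prop) (by fun_prop)).mem_nhds hgt'] with q hq
      exact thetaMap_of_lt hq
    have lρ : HasFDerivAt ρ ((2 * s) • ContinuousLinearMap.fst ℝ ℝ ℝ -
        (2 - 2 * t) • ContinuousLinearMap.snd ℝ ℝ ℝ) (t, s) := by
      have h1 : HasFDerivAt (fun p : ℝ × ℝ => 2 - 2 * p.1)
          (-((2 : ℝ) • ContinuousLinearMap.fst ℝ ℝ ℝ)) (t, s) :=
        (hasFDerivAt_fst.const_mul 2).const_sub 2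
      have h2 := (h1.mul (hasFDerivAt_snd (𝕜 := ℝ) (E := ℝ) (F := ℝ) (p := (t, s)))).const_sub 1
      refine h2.congr_fderiv ?_
      ext <;> simp
      ring
    have lT : HasFDerivAt (fun p : ℝ × ℝ => (ρ p, (1 : ℝ)))
        (((2 * s) • ContinuousLinearMap.fst ℝ ℝ ℝ -
        (2 - 2 * t) • ContinuousLinearMap.snd ℝ ℝ ℝ).prod 0) (t, s) :=
      lρ.prodMk (hasFDerivAt_const _ _)
    obtain ⟨p1, p2⟩ := pull_comp α hloc hΦd lT
    refine ⟨mem_regularSet_of_comp hloc hΦs ?_ hpi, ?_, ?_⟩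
    · have : ContDiff ℝ 2 fun p : ℝ × ℝ => (ρ p, (1 : ℝ)) := by
        rw [hρdef]; fun_prop
      exact this.contDiffAt
    · have e1 : hor α G (ρ (t, s), 1) = pullOne α Φ (ρ (t, s), 1) (1, 0) :=
        (show hor α G (ρ (t, s), 1) = hor α Φ (ρ (t, s), 1) from rfl).trans
          (hor_eq_pullOne_of_mdifferentiableAt α hρ' (by simp) hΦd)
      rw [thetaConn, if_neg (not_le.mpr hgt'), p1 (1, 0)]
      change _ = (2 * s) • hor α G (ρ (t, s), 1)
      rw [e1]
      simp
    · rw [thetaArea, if_neg (not_le.mpr hgt'), p2]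
      simp

end EvalX

/-! ### Evaluation of `X` -/

section SumX

set_option maxSynthPendingDepth 3

open Set Filter Topology

variable {E : Type*} [NormedAddCommGroup E] [NormedSpace ℝ E] [FiniteDimensional ℝ E]
  {M : Type*} [TopologicalSpace M] [ChartedSpace E M] [IsManifold 𝓘(ℝ, E) ∞ M]
  {V : Type*} [NormedAddCommGroup V] [NormedSpace ℝ V] [FiniteDimensional ℝ V]
  {C : GradedComplex V} {Γ G : ℝ × ℝ → M}

/-- Parallel transport along `Θ`, for a fixed value of `s`. -/
lemma exists_thetaTransport (hG : NiceMap E G) (hG' : NiceMap E (G ∘ Prod.swap))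
    (α : FlatSuperconnection E M C) {s : ℝ} (hs : s ∈ Ioo (0 : ℝ) 1) :
    ∃ U K : ℝ → V →L[ℝ] V, LipDeriv U (fun t => -(thetaConn α G (t, s) * U t)) 0 1 ∧ U 0 = 1 ∧
      (∀ t ∈ Icc (0 : ℝ) 1, K t * U t = 1) ∧
      horTransport α G (1, 1) * (horInv α G (1 - s, 1) * horTransport α (G ∘ Prod.swap) (1, 1 - s) *
        -horBeta α (G ∘ Prod.swap) (1, 1 - s)) =
        U 1 * ∫ t in (0 : ℝ)..1, K t * thetaArea α G (t, s) * U t := by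
  obtain ⟨hs0, hs1⟩ := hs
  obtain ⟨c, hc⟩ := hG.exists_hor_le α
  obtain ⟨c', hc'⟩ := hG'.exists_hor_le α
  have ht := hG.transportPair hc
  have ht' := hG'.transportPair hc'
  set x := 1 - s with hx
  have hxI : x ∈ Icc (0 : ℝ) 1 := ⟨by linarith, by linarith⟩
  have h1I : (1 : ℝ) ∈ Icc (0 : ℝ) 1 := by simp
  set g := fun u => horTransport α G (u, 1) with hg
  set k := fun u => horInv α G (u, 1) with hk
  set h := fun y => horTransport α (G ∘ Prod.swap) (y, x) with hh
  set l := fun y => horInv α (G ∘ Prod.swap) (y, x) with hl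
  set γ := fun y => -horBeta α (G ∘ Prod.swap) (y, x) with hγ
  have hgk : ∀ u ∈ Icc (0 : ℝ) 1, g u * k u = 1 := fun u hu => ht.gk u hu 1 h1I
  have hkg : ∀ u ∈ Icc (0 : ℝ) 1, k u * g u = 1 := fun u hu => ht.kg u hu 1 h1I
  have hlh : ∀ y ∈ Icc (0 : ℝ) 1, l y * h y = 1 := fun y hy => ht'.kg y hy x hxI
  have d1 : LipDeriv (fun t => h (2 * t))
      (fun t => -((2 : ℝ) • hor α (G ∘ Prod.swap) (2 * t, x) * h (2 * t))) 0 (1 / 2) := by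
    have := LipDeriv.comp_affine (c := 2) (d := 0) (a := 0) (b := 1 / 2) two_pos
      (F := h) (f := fun y => -(hor α (G ∘ Prod.swap) (y, x) * h y))
      (by simpa using ht'.g_eq x hxI)
    simp only [add_zero] at this
    refine this.congr_deriv (Eventually.of_forall fun t _ => ?_)
    rw [smul_neg, smul_mul_assoc]
  have hρ : ∀ t : ℝ, 2 * s * t + (1 - 2 * s) = 1 - (2 - 2 * t) * s := fun t => by ring
  have d2 : LipDeriv (fun t => g (1 - (2 - 2 * t) * s) * (k x * h 1))
      (fun t => -((2 * s) • hor α G (1 - (2 - 2 * t) * s, 1) *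
        (g (1 - (2 - 2 * t) * s) * (k x * h 1)))) (1 / 2) 1 := by
    have h1 : LipDeriv g (fun u => -(hor α G (u, 1) * g u)) (2 * s * (1 / 2) + (1 - 2 * s))
        (2 * s * 1 + (1 - 2 * s)) :=
      (ht.g_eq 1 h1I).mono (by linarith) (by linarith)
    have h2 := (h1.comp_affine (by positivity)).mul (LipDeriv.const (k x * h 1) (1 / 2) 1)
    simp only [hρ] at h2
    refine h2.congr_deriv (Eventually.of_forall fun t _ => ?_)
    rw [mul_zero, add_zero, smul_neg, neg_mul, smul_mul_assoc, smul_mul_assoc, mul_assoc]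
  have hhalf : (1 : ℝ) - (2 - 2 * (1 / 2)) * s = x := by rw [hx]; ring
  have h2half : (2 : ℝ) * (1 / 2) = 1 := by norm_num
  have hU : LipDeriv _ _ 0 1 := d1.piecewise_half d2 (by
    rw [hhalf, h2half, ← mul_assoc, hgk x hxI, one_mul])
  -- The transport up the vertical line, continued along the top edge; the factor k(x) h(1) makes
  -- the two halves agree at t = 1/2, and there U(1/2) = h(1).
  set U : ℝ → V →L[ℝ] V := fun t => if t ≤ 1 / 2 then h (2 * t)
    else g (1 - (2 - 2 * t) * s) * (k x * h 1) with hUdef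
  set K : ℝ → V →L[ℝ] V := fun t => if t ≤ 1 / 2 then l (2 * t)
    else l 1 * g x * k (1 - (2 - 2 * t) * s) with hKdef
  have hnot : ¬ (1 : ℝ) ≤ 1 / 2 := by norm_num
  have hU1 : U 1 = g 1 * (k x * h 1) := by
    rw [hUdef]
    simp only [if_neg hnot]
    rw [show (1 : ℝ) - (2 - 2 * 1) * s = 1 by ring]
  refine ⟨U, K, hU.congr_deriv (Eventually.of_forall fun t _ => ?_), ?_, fun t htI => ?_, ?_⟩
  · by_cases h12 : t ≤ 1 / 2
    · simp only [hUdef, thetaConn, if_pos h12]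
      rfl
    · simp only [hUdef, thetaConn, if_neg h12]
  · have : U 0 = h (2 * 0) := if_pos (by norm_num)
    rw [this, mul_zero]
    exact horTransport_zero α _ x
  · by_cases h12 : t ≤ 1 / 2
    · simp only [hUdef, hKdef, if_pos h12]
      exact hlh _ ⟨by linarith [htI.1], by linarith⟩
    · simp only [hUdef, hKdef, if_neg h12]
      have h12' : 1 / 2 < t := not_le.mp h12
      have hm : 1 - (2 - 2 * t) * s ∈ Icc (0 : ℝ) 1 := by
        constructor
        · nlinarith
        · nlinarith [htI.2]
      calc l 1 * g x * k (1 - (2 - 2 * t) * s) * (g (1 - (2 - 2 * t) * s) * (k x * h 1))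
          = l 1 * g x * (k (1 - (2 - 2 * t) * s) * g (1 - (2 - 2 * t) * s)) * (k x * h 1) := by
            simp only [mul_assoc]
        _ = l 1 * (g x * k x) * h 1 := by rw [hkg _ hm, mul_one]; simp only [mul_assoc]
        _ = 1 := by rw [hgk x hxI, mul_one, hlh 1 h1I]
  · have e1 : LipDeriv (fun t => γ (2 * t))
        (fun t => l (2 * t) * ((2 : ℝ) • area α G (x, 2 * t)) * h (2 * t)) 0 (1 / 2) := by
      have h1 := (LipDeriv.const (0 : V →L[ℝ] V) 0 1).sub (hG'.lipDeriv_horBeta (α := α) hxI)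
      have h2 : LipDeriv γ (fun y => l y * area α G (x, y) * h y) 0 1 := by
        refine (h1.congr_deriv (Eventually.of_forall fun y _ => ?_)).congr
          (fun y _ => by simp [hγ])
        have h2 : area α (G ∘ Prod.swap) (y, x) = -area α G (x, y) := area_swap α G (x, y)
        rw [h2, mul_neg, neg_mul, zero_sub, neg_neg]
      have h3 := LipDeriv.comp_affine (c := 2) (d := 0) (a := 0) (b := 1 / 2) two_pos
        (F := γ) (f := fun y => l y * area α G (x, y) * h y) (by simpa using h2)
      simp only [add_zero] at h3
      refine h3.congr_deriv (Eventually.of_forall fun t _ => ?_)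
      rw [mul_smul_comm, smul_mul_assoc]
    have e2 : LipDeriv _ _ 0 1 := e1.piecewise_half (LipDeriv.const (γ 1) (1 / 2) 1)
      (by simp only [h2half])
    have e3 := e2.integral_eq zero_le_one
    -- Only the vertical half carries area. There the integrand is the derivative of γ(2t), and γ
    -- starts at 0.
    have e4 : ∫ t in (0 : ℝ)..1, K t * thetaArea α G (t, s) * U t = γ 1 := by
      have hcong : (fun t => K t * thetaArea α G (t, s) * U t) = fun t => if t ≤ 1 / 2 then
          l (2 * t) * ((2 : ℝ) • area α G (x, 2 * t)) * h (2 * t) else 0 := by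
        funext t
        by_cases h12 : t ≤ 1 / 2
        · simp only [hUdef, hKdef, thetaArea, if_pos h12]
          rfl
        · simp only [thetaArea, if_neg h12, mul_zero, zero_mul]
      rw [hcong, e3, if_neg hnot, if_pos (by norm_num)]
      have : γ (2 * 0) = 0 := by
        rw [mul_zero, hγ]
        simp only [horBeta_zero, neg_zero]
      rw [this, sub_zero]
    rw [e4, hU1, mul_assoc (g 1)]

/-- The series `X` in terms of the parallel transport along the folded path. -/
theorem xSeries_eq (hΓ : IsPiecewiseSmooth E Γ) (α : FlatSuperconnection E M C) :
    (∀ m n, IntegrableOn (omegaDensity α ((Γ ∘ lowerEmbedding) ∘ thetaMap) m n)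
      (simplexTimesInterval (m + n + 1))) ∧
    (Summable fun p => ‖betaTwoTerm α (Γ ∘ lowerEmbedding) p‖) ∧
    xSeries α Γ = -∫ x in (0 : ℝ)..1, horTransport α (foldPath Γ) (1, 1) *
      (horInv α (foldPath Γ) (x, 1) * horTransport α (foldPath Γ ∘ Prod.swap) (1, x) *
        -horBeta α (foldPath Γ ∘ Prod.swap) (1, x)) := by
  have hG := hΓ.foldPath.niceMap
  have hG' := hΓ.foldPath.swap.niceMap
  set G := foldPath Γ with hGdef
  obtain ⟨c₁, hc₁⟩ := hG.exists_hor_le α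
  obtain ⟨c₂, hc₂⟩ := hG'.exists_hor_le α
  obtain ⟨c₃, hc₃⟩ := hG.exists_area_le α
  have p1 : 0 ≤ c₁ := (norm_nonneg _).trans (hc₁ 0)
  have p2 : 0 ≤ c₂ := (norm_nonneg _).trans (hc₂ 0)
  have p3 : 0 ≤ c₃ := (norm_nonneg _).trans (hc₃ 0)
  obtain ⟨i1, i2, i3⟩ := omegaIntegral_series_eq α (H := (Γ ∘ lowerEmbedding) ∘ thetaMap)
    (a := thetaConn α G) (B := thetaArea α G) (c := 2 * (c₁ + c₂ + c₃))
    (W := fun s => horTransport α G (1, 1) * (horInv α G (1 - s, 1) *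
      horTransport α (G ∘ Prod.swap) (1, 1 - s) * -horBeta α (G ∘ Prod.swap) (1, 1 - s)))
    (by positivity) ((ae_pull_theta hΓ α).mono fun p hp hps => (hp hps).1)
    ((ae_pull_theta hΓ α).mono fun p hp hps => ⟨⟨(hp hps).2.1, by
      rw [thetaConn]
      split_ifs
      · rw [norm_smul, Real.norm_two]
        linarith [hc₂ (2 * p.1, 1 - p.2)]
      · rw [norm_smul, norm_mul, Real.norm_two, Real.norm_of_nonneg hps.2.1]
        have := hc₁ (1 - (2 - 2 * p.1) * p.2, 1)
        have h2 : p.2 * ‖hor α G (1 - (2 - 2 * p.1) * p.2, 1)‖ ≤ 1 * c₁ :=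
          mul_le_mul hps.2.2 this (norm_nonneg _) zero_le_one
        linarith⟩, (hp hps).2.2, by
      rw [thetaArea]
      split_ifs
      · rw [norm_smul, Real.norm_two]
        linarith [hc₃ (1 - p.2, 2 * p.1)]
      · rw [norm_zero]; positivity⟩)
    (Eventually.of_forall fun s hs => Or.inr (exists_thetaTransport hG hG' α hs))
  refine ⟨i1, ?_, ?_⟩
  · refine i2.congr fun p => ?_
    rw [betaTwoTerm, norm_smul, norm_pow, norm_neg, norm_one, one_pow, one_mul]
  · rw [xSeries, betaTwo]
    -- The additional sign in the definition of β² accounts for the overall minus, which also occurs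
    -- in the formula for Z.
    have hn : ∀ p : ℕ × ℕ, betaTwoTerm α (Γ ∘ lowerEmbedding) p =
        -((-1 : ℝ) ^ (p.1 + p.2) • omegaIntegral α ((Γ ∘ lowerEmbedding) ∘ thetaMap) p.1 p.2) :=
      fun p => by rw [betaTwoTerm, pow_succ, mul_neg_one, neg_smul]
    simp only [hn]
    rw [tsum_neg, i3, intervalIntegral.integral_comp_sub_left (fun x => horTransport α G (1, 1) *
      (horInv α G (x, 1) * horTransport α (G ∘ Prod.swap) (1, x) *
        -horBeta α (G ∘ Prod.swap) (1, x)))]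
    simp

end SumX

/-! ### Comparison of `Z` and `X` -/

section Comparison

set_option maxSynthPendingDepth 3

open Set Filter Topology

lemma Coeff.continuousOn_mul {𝔄 : Type*} [NormedRing 𝔄] {f B : ℝ → 𝔄} {c : ℝ}
    (hB : Coeff c B) (hf : ContinuousOn f (Icc 0 1)) : ∃ c', Coeff c' fun t => f t * B t := by
  obtain ⟨d, hd⟩ := isCompact_Icc.exists_bound_of_continuousOn hf
  exact ⟨d * c, (hf.aestronglyMeasurable measurableSet_Icc).mul hB.meas, fun t ht =>
    (norm_mul_le _ _).trans (mul_le_mul (hd t ht) (hB.bound t ht) (norm_nonneg _)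
      ((norm_nonneg _).trans (hd t ht)))⟩

lemma Coeff.integral_const_mul {𝔄 : Type*} [NormedRing 𝔄] [NormedAlgebra ℝ 𝔄] [CompleteSpace 𝔄]
    {B : ℝ → 𝔄} {c : ℝ} (hB : Coeff c B) (x : 𝔄) :
    ∫ t in (0 : ℝ)..1, x * B t = x * ∫ t in (0 : ℝ)..1, B t :=
  ContinuousLinearMap.intervalIntegral_comp_comm (ContinuousLinearMap.mul ℝ 𝔄 x)
    (hB.intervalIntegrable (by simp) (by simp))

variable {E : Type*} [NormedAddCommGroup E] [NormedSpace ℝ E] [FiniteDimensional ℝ E]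
  {M : Type*} [TopologicalSpace M] [ChartedSpace E M] [IsManifold 𝓘(ℝ, E) ∞ M]
  {V : Type*} [NormedAddCommGroup V] [NormedSpace ℝ V] [FiniteDimensional ℝ V]
  {C : GradedComplex V} {Γ : ℝ × ℝ → M} {x₀ y₀ y₁ : ℝ}

lemma SupportedIn.zSeries_mem (h : SupportedIn E Γ x₀ y₀ y₁) (α : FlatSuperconnection E M C) :
    zSeries α Γ ∈ C.endDeg (-1) := by
  rw [(h.zSeries_eq α).2.2]
  refine neg_mem (intervalIntegral_mem (GradedComplex.isClosed_submodule _) zero_le_one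
    fun y _ => ?_)
  exact C.mul_mem_endDeg (horTransport_mem α _ (by simp) y).1.1 (horBeta_mem (by simp) y)
    (zero_add (-1))

lemma xSeries_mem (hΓ : IsPiecewiseSmooth E Γ) (α : FlatSuperconnection E M C) :
    xSeries α Γ ∈ C.endDeg (-1) := by
  rw [(xSeries_eq hΓ α).2.2]
  refine neg_mem (intervalIntegral_mem (GradedComplex.isClosed_submodule _) zero_le_one
    fun x hx => ?_)
  exact C.mul_mem_endDeg (horTransport_mem α _ (by simp) 1).1.1
    (C.mul_mem_endDeg (C.mul_mem_endDeg (horTransport_mem α _ hx 1).2.1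
      (horTransport_mem α _ (by simp) x).1.1 (add_zero 0))
      (neg_mem (horBeta_mem (by simp) x)) (zero_add (-1))) (zero_add (-1))

/-- The comparison of horizontal with vertical transport holds for any folded path. The support
condition is needed to bring Z to the form in which h(1, 1) l(1, y), the transport along the
diagonal above y, multiplies the integrand. -/
theorem SupportedIn.zSeries_sub_xSeries_mem (h : SupportedIn E Γ x₀ y₀ y₁)
    (α : FlatSuperconnection E M C) : zSeries α Γ - xSeries α Γ ∈ C.boundaries (-2) := by
  have hΓ := h.isTwoPath.piecewiseSmooth
  have hG := hΓ.foldPath.niceMap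
  have hG' := hΓ.foldPath.swap.niceMap
  have hleft : ∀ v ∈ Icc (0 : ℝ) 1, foldPath Γ (0, v) = foldPath Γ (0, 0) := fun v hv =>
    h.isTwoPath.foldPath_left hv
  have hbot : ∀ x ∈ Icc (0 : ℝ) 1, foldPath Γ (x, 0) = foldPath Γ (0, 0) := fun x hx =>
    foldPath_bot hx
  have hdiag := fun y hy => h.horTransport_diagonal α (y := y) hy
  have hZ := (h.zSeries_eq α).2.2
  have hX := (xSeries_eq hΓ α).2.2
  have hβ := h.ae_horBeta_eq_zero α
  set G := foldPath Γ with hGdef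
  obtain ⟨c, hc⟩ := hG.exists_hor_le α
  obtain ⟨c', hc'⟩ := hG'.exists_hor_le α
  have ht := hG.transportPair hc
  have ht' := hG'.transportPair hc'
  obtain ⟨gc, kc⟩ := hG.continuousOn_horTransport α hleft
  obtain ⟨hhc, lc⟩ := hG'.continuousOn_horTransport α hbot
  have h1 : (1 : ℝ) ∈ Icc (0 : ℝ) 1 := by simp
  have slice₁ : ∀ {f : ℝ × ℝ → V →L[ℝ] V}, ContinuousOn f square →
      ContinuousOn (fun x => f (x, 1)) (Icc 0 1) := fun hf =>
    hf.comp (f := fun x : ℝ => (x, (1 : ℝ))) (by fun_prop) fun x hx => ⟨hx, h1⟩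
  have slice₂ : ∀ {f : ℝ × ℝ → V →L[ℝ] V}, ContinuousOn f square →
      ContinuousOn (fun y => f (1, y)) (Icc 0 1) := fun hf =>
    hf.comp (f := fun y : ℝ => ((1 : ℝ), y)) (by fun_prop) fun x hx => ⟨h1, hx⟩
  obtain ⟨d₁, hd₁⟩ := hG.coeff_horBeta α hleft
  obtain ⟨d₂, hd₂⟩ := hG'.coeff_horBeta α hbot
  obtain ⟨d₃, hd₃⟩ := hd₁.continuousOn_mul ((slice₁ lc).mul (slice₂ gc))
  have hd₂' : Coeff d₂ fun x => -horBeta α (G ∘ Prod.swap) (1, x) :=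
    ⟨hd₂.meas.neg, fun t ht => by rw [norm_neg]; exact hd₂.bound t ht⟩
  obtain ⟨d₄, hd₄⟩ := hd₂'.continuousOn_mul ((slice₁ kc).mul (slice₂ hhc))
  simp only [Pi.mul_apply] at hd₃ hd₄
  -- Above height 1 - y₁ the diagonal transport no longer changes, so h(1, 1) l(1, y) = 1; below
  -- that height β(1, y) vanishes almost everywhere.
  have hZ' : ∫ y in (0 : ℝ)..1, horTransport α G (1, y) * horBeta α G (1, y) =
      horTransport α (G ∘ Prod.swap) (1, 1) * ∫ y in (0 : ℝ)..1,
        horInv α (G ∘ Prod.swap) (y, 1) * horTransport α G (1, y) * horBeta α G (1, y) := by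
    rw [← hd₃.integral_const_mul]
    refine intervalIntegral.integral_congr_ae ?_
    filter_upwards [quasiMeasurePreserving_one_sub.ae hβ, ae_mem_Ioo_of_mem_uIoc] with y hy hy' hyI
    have hyI' := hy' hyI
    by_cases hyy : 1 - y₁ ≤ y
    · rw [← hdiag y ⟨hyy, hyI'.2.le⟩, ← mul_assoc, ← mul_assoc,
        ht'.gk y (Ioo_subset_Icc_self hyI') 1 h1, one_mul]
    · have h0 := hy ⟨by linarith [hyI'.2], by linarith [hyI'.1]⟩
        fun hmem => hyy (by linarith [hmem.2])
      rw [sub_sub_cancel] at h0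
      rw [h0, mul_zero, mul_zero, mul_zero]
  obtain ⟨η, hη, hη'⟩ := hG.exists_evenBracket_eq hG' α hleft hbot
  have hgm := (horTransport_mem α G h1 1).1
  set g₁ := horTransport α G (1, 1) with hg₁
  have hgk : g₁ * horInv α G (1, 1) = 1 := ht.gk 1 h1 1 h1
  rw [hd₄.integral_const_mul] at hX
  -- Multiplication by the cochain map g(1, 1) turns H(1, 1) = k(1, 1) h(1, 1) into h(1, 1) and
  -- preserves boundaries. The minus sign comes from the overall signs of Z and X.
  have key : zSeries α Γ - xSeries α Γ = C.evenBracket (-(g₁ * η)) := by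
    rw [map_neg, C.mul_evenBracket hgm, ← hη', hZ, hX, hZ', mul_sub, ← mul_assoc, ← mul_assoc, hgk,
      one_mul]
    abel
  rw [key]
  exact C.evenBracket_mem_boundaries (neg_mem (C.mul_mem_endDeg hgm.1 hη (zero_add (-2))))

end Comparison

end SurfaceHolonomy

end

theorem mainTheorem3
    {E : Type*} [NormedAddCommGroup E] [NormedSpace ℝ E] [FiniteDimensional ℝ E]
    {M : Type*} [TopologicalSpace M] [T2Space M] [SecondCountableTopology M]
    [ChartedSpace E M] [IsManifold 𝓘(ℝ, E) ∞ M]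
    {V : Type*} [NormedAddCommGroup V] [NormedSpace ℝ V] [FiniteDimensional ℝ V]
    (C : SurfaceHolonomy.GradedComplex V)
    (α : SurfaceHolonomy.FlatSuperconnection E M C)
    (Γ : ℝ × ℝ → M) (hΓ : SurfaceHolonomy.IsWellSupported E Γ) :
    -- both series of integrals are well defined and absolutely convergent
    (∀ m n : ℕ, IntegrableOn
      (SurfaceHolonomy.omegaDensity α (Γ ∘ SurfaceHolonomy.muMap) m n)
      (SurfaceHolonomy.simplexTimesInterval (m + n + 1))) ∧
    (∀ m n : ℕ, IntegrableOn
      (SurfaceHolonomy.omegaDensity α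
        ((Γ ∘ SurfaceHolonomy.lowerEmbedding) ∘ SurfaceHolonomy.thetaMap) m n)
      (SurfaceHolonomy.simplexTimesInterval (m + n + 1))) ∧
    (Summable fun p : ℕ × ℕ => ‖SurfaceHolonomy.zTerm α Γ p‖) ∧
    (Summable fun p : ℕ × ℕ =>
      ‖SurfaceHolonomy.betaTwoTerm α (Γ ∘ SurfaceHolonomy.lowerEmbedding) p‖) ∧
    -- their sums lie in `End^{-1}(V)` and agree modulo `[∂, End^{-2}(V)]`
    SurfaceHolonomy.zSeries α Γ ∈ C.endDeg (-1) ∧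
    SurfaceHolonomy.xSeries α Γ ∈ C.endDeg (-1) ∧
    SurfaceHolonomy.zSeries α Γ - SurfaceHolonomy.xSeries α Γ ∈ C.boundaries (-2) := by
  obtain ⟨x₀, y₀, y₁, h⟩ := hΓ.exists_supportedIn
  obtain ⟨hZ, hZ', -⟩ := h.zSeries_eq α
  obtain ⟨hX, hX', -⟩ := SurfaceHolonomy.xSeries_eq h.isTwoPath.piecewiseSmooth α
  exact ⟨hZ, hX, hZ', hX', h.zSeries_mem α,
    SurfaceHolonomy.xSeries_mem h.isTwoPath.piecewiseSmooth α, h.zSeries_sub_xSeries_mem α⟩
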